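/- **Definitions.** A *(unitary) quiver* is a triple $Q=(V,A,K)$ with $V$ a finite set, $A:V\times V\to\mathbb Z$ and $K:V\to\mathbb Z_{>0}$ such that: (i) $A(x,x)=-2+2g_x$ with $g_x\in\mathbb Z_{\ge 0}$, and $A(x,x)=-2$ if $K(x)=1$; (ii) for $x\ne y$, $A(x,y)=0$ iff $A(y,x)=0$, and otherwise both are positive and one divides the other; (iii) there is $L:V\to\mathbb Z_{>0}$ with $A(x,y)L(y)=A(y,x)L(x)$ for all $x,y$. Its underlying graph joins $x\neq y$ when $A(x,y)\ne0$. Put $\Lambda=\prod_{x}\mathbb Z^{K(x)}$, $W=\prod_x S_{K(x)}$, $$\Delta(m)=\tfrac12\sum_{x,y\in V}\operatorname{sgn}(A(x,y))\sum_{i,j}|A(x,y)\,m_{x,i}-A(y,x)\,m_{y,j}|\qquad(m\in\Lambda),$$ and let $\mathbf L\in\Lambda$ be the primitive positive vector that is constant on each vertex and satisfies $A(x,y)\mathbf L_x=A(y,x)\mathbf L_y$ (so $\Delta(m+\mathbf L)=\Delta(m)$). The Hilbert series is $$\mathrm{HS}_Q(t)=\frac{1-t^2}{|W|}\sum_{m\in\Lambda/\mathbb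 Z\mathbf L}\ \sum_{w\in W,\ wm=m}\frac{t^{\Delta(m)}}{\det(1-wt^2)},$$ when this converges (as a series of formal Laurent series in $t$), $w$ acting as a permutation matrix. A connected non-empty quiver is *good* if either $\mathrm{HS}_Q$ converges, is non-constant and has zero coefficient at order $t$, or $Q$ is $N\cdot A_0^{(1)}$ (one vertex with one loop and weight $N$) with $N\ge2$, or $Q$ is a simply-laced affine Dynkin quiver $A_n^{(1)}$ ($n\ge1$), $D_n^{(1)}$ ($n\ge4$), $E_{6,7,8}^{(1)}$ with all weights (the Dynkin marks) multiplied by some $N\ge1$. A non-empty quiver that is not connected is called good if all its connected components are good. A *subquiver* of $Q$ is $(V',A',K')$ with $V'\subseteq V$, $0<K'\le K|_{V'}$, and $A'$ the restriction of $A$ except that $A'(x,x)=-2$ when $K'(x)=1$. A *decay product* of $Q$ is a good connected subquiver of $Q$. **Notation.** Numbers are weights of vertices. $x\Rightarrow y$ (resp. $x\Rrightarrow y$, $x\xrightarrow{\ell}y$) is an edge with $A(x,y)=2$ (resp. $3$, $\ell$) and $A(y,x)=1$; $x - y$ is an edge with $A(x,y)=A(y,x)=1$. Unless stated otherwise there are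 no loops ($A(x,x)=-2$), and all parameters $\ell,\ell_i,k_i$ are integers $\ge1$. **Proposition.** Every good quiver $Q$ has a decay product isomorphic to one of the following quivers. *Abelian (all weights $1$):* - $A_{N-1}$: two vertices $x,y$ with $A(x,y)=N\ell$, $A(y,x)=N$, where $N\ge2$, $\ell\ge1$. - $h_{n,\delta,\sigma}$, $n\ge2$: a linear quiver $v_0,\dots,v_n$ with $A(v_{i-1},v_i)=\ell_i$, $A(v_i,v_{i-1})=k_i$, where $\ell_i=1$ or $k_i=1$ for each $i$, $\delta=\gcd(\ell_1,k_n)>1$, and $\gcd(\ell_i,k_j)=1$ for all other $1\le i\le j\le n$. - $\overline h_{n,\sigma}$, $n\ge2$: a cycle $v_i$, $i\in\mathbb Z/(n+1)$, with $A(v_i,v_{i+1})=\ell_i$, $A(v_{i+1},v_i)=k_i$, where $\ell_i=1$ or $k_i=1$ for each $i$, $\prod_ik_i=\prod_i\ell_i$, and $\gcd(\ell_i,k_j)=1$ whenever $i-j\not\equiv1,2\pmod{n+1}$. *Non-Abelian:* - $D_{g+1}$, $g\ge1$: one vertex of weight $2$ with $g$ loops. - $\mathcal Y(\ell)$, $\ell\ge4$: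 $2\xrightarrow{\ell}1$. - $gc_n$, $n\ge2$: $2\Rrightarrow2-\cdots-2\Leftarrow2$ ($n+1$ vertices). - $gb_n$, $n\ge2$: $2\Rrightarrow2-\cdots-2\Rightarrow1$ ($n+1$ vertices). - $gd_n$, $n\ge3$: $2\Rrightarrow2-\cdots-2$ with two further vertices of weight $1$ attached to the last vertex by edges $1\xrightarrow{\ell_1}2$, $1\xrightarrow{\ell_2}2$ ($n+1$ vertices), $\ell_1,\ell_2,3$ pairwise coprime. - $\mathcal J_{2,3}$: $1\Leftarrow2\Rrightarrow1$; $\mathcal J_{3,3}$: $1\Lleftarrow2\Rrightarrow1$. *Affine Dynkin type* (in each quiver the $\ell_i$ are pairwise coprime; families have $n+1$ vertices): - $A_{2n}^{(2)}$, $n\ge2$: $2\Rightarrow2-\cdots-2\Rightarrow1$. - $A_{2n-1}^{(2)}$, $n\ge3$: $2\Rightarrow2-\cdots-2$ with two edges $1\xrightarrow{\ell_1}2$, $1\xrightarrow{\ell_2}2$ into the last vertex, $\ell_1,\ell_2$ odd. - $B_n^{(1)}$, $n\ge3$: $1\Leftarrow2-\cdots-2$ with two edges $1\xrightarrow{\ell_1}2$,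 $1\xrightarrow{\ell_2}2$ into the last vertex. - $D_n^{(1)}$, $n\ge4$: $2-\cdots-2$ ($n-3$ vertices) with edges $1\xrightarrow{\ell_1}2$, $1\xrightarrow{\ell_2}2$ into the first and $1\xrightarrow{\ell_3}2$, $1\xrightarrow{\ell_4}2$ into the last of them. - $D_{n+1}^{(2)}$, $n\ge2$: $1\Leftarrow2-\cdots-2\Rightarrow1$. - $D_4^{(3)}$: $1\xrightarrow{\ell_1}2\Lleftarrow3$, $3\nmid\ell_1$. - $E_6^{(1)}$: a vertex of weight $3$ with three legs $3-2\xleftarrow{\ell_i}1$, $i=1,2,3$. - $E_6^{(2)}$: $2-4\Rightarrow3-2\xleftarrow{\ell_1}1$, $\ell_1$ odd. - $E_7^{(1)}$: $1\xrightarrow{\ell_1}2-3-4-3-2\xleftarrow{\ell_2}1$ with a vertex of weight $2$ attached to the vertex of weight $4$ by a simple edge. - $E_8^{(1)}$: $1\xrightarrow{\ell}2-3-4-5-6-4-2$ with a vertex of weight $3$ attached to the vertex of weight $6$ by a simple edge. - $F_4^{(1)}$: $1\xrightarrow{\ell_1}2-3\Rightarrow2\xleftarrow{\ell_2}1$, $\ell_2$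 odd. - $G_2^{(1)}$: $1\xrightarrow{\ell_1}2\Rrightarrow1$. -/

import Mathlib

/-- A unitary quiver `(V, A, K)`: a (finite) vertex type `V`, an adjacency matrix `A` and a positive
weight function `K`, subject to the three axioms of the definition. -/
structure UnitaryQuiver (V : Type*) where
  /-- the adjacency matrix -/
  A : V → V → ℤ
  /-- the weight function -/
  K : V → ℕ
  weight_pos : ∀ x, 0 < K x
  diag : ∀ x, ∃ g : ℕ, A x x = -2 + 2 * (g : ℤ)
  diag_of_weight_one : ∀ x, K x = 1 → A x x = -2
  zero_iff : ∀ x y, x ≠ y → (A x y = 0 ↔ A y x = 0)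
  pos_and_dvd : ∀ x y, x ≠ y → A x y ≠ 0 →
    0 < A x y ∧ 0 < A y x ∧ (A x y ∣ A y x ∨ A y x ∣ A x y)
  length_function : ∃ L : V → ℕ, (∀ x, 0 < L x) ∧ ∀ x y, A x y * (L y : ℤ) = A y x * (L x : ℤ)

namespace UnitaryQuiver

variable {V : Type*}

/-- The underlying graph: distinct vertices are joined when the adjacency coefficient is non-zero. -/
def graph (Q : UnitaryQuiver V) : SimpleGraph V where
  Adj x y := x ≠ y ∧ Q.A x y ≠ 0
  symm := ⟨fun x y h => ⟨h.1.symm, fun h0 => h.2 ((Q.zero_iff x y h.1).2 h0)⟩⟩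
  loopless := ⟨fun _ h => h.1 rfl⟩

/-! ### Monopole formula -/

/-- The index set of the coordinates of a magnetic charge: pairs of a vertex `x` and an index
`i < K x`. -/
abbrev Coord (Q : UnitaryQuiver V) : Type _ := (x : V) × Fin (Q.K x)

/-- The lattice `Λ = ∏_x ℤ^{K x}` of magnetic charges. -/
abbrev Charge (Q : UnitaryQuiver V) : Type _ := Q.Coord → ℤ

/-- The summand `sgn (A x y) * |m_{x,i} A x y - m_{y,j} A y x|` of the conformal dimension. -/
def dimTerm (Q : UnitaryQuiver V) (m : Q.Charge) (p q : Q.Coord) : ℤ :=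
  (Q.A p.1 q.1).sign * |Q.A p.1 q.1 * m p - Q.A q.1 p.1 * m q|

/-- The conformal dimension `Δ(m) = ½ ∑_{x,y} sgn (A x y) ∑_{i,j} |m_{x,i} A x y - m_{y,j} A y x|`.
The integer division is exact, see `two_mul_conformalDim`. -/
def conformalDim [Fintype V] (Q : UnitaryQuiver V) (m : Q.Charge) : ℤ :=
  (∑ p : Q.Coord, ∑ q : Q.Coord, Q.dimTerm m p q) / 2

lemma dimTerm_comm (Q : UnitaryQuiver V) (m : Q.Charge) (p q : Q.Coord) :
    Q.dimTerm m p q = Q.dimTerm m q p := by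
  unfold dimTerm
  have h : (Q.A p.1 q.1).sign = (Q.A q.1 p.1).sign := by
    by_cases hpq : p.1 = q.1
    · rw [hpq]
    · by_cases h0 : Q.A p.1 q.1 = 0
      · rw [h0, (Q.zero_iff _ _ hpq).1 h0]
      · obtain ⟨h1, h2, -⟩ := Q.pos_and_dvd _ _ hpq h0
        rw [Int.sign_eq_one_of_pos h1, Int.sign_eq_one_of_pos h2]
  rw [h, abs_sub_comm]

lemma two_mul_conformalDim [Fintype V] (Q : UnitaryQuiver V) (m : Q.Charge) :
    2 * Q.conformalDim m = ∑ p : Q.Coord, ∑ q : Q.Coord, Q.dimTerm m p q := by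
  classical
  refine Int.mul_ediv_cancel' ?_
  rw [← Fintype.sum_prod_type' (f := fun p q => Q.dimTerm m p q)]
  rw [← Nat.cast_ofNat (R := ℤ) (n := 2), ← ZMod.intCast_zmod_eq_zero_iff_dvd _ 2, Int.cast_sum]
  refine Finset.sum_ninvolution (fun a : Q.Coord × Q.Coord => (a.2, a.1)) ?_ ?_ ?_ ?_
  · rintro ⟨p, q⟩
    simp only [Q.dimTerm_comm m q p]
    exact CharTwo.add_self_eq_zero _
  · rintro ⟨p, q⟩ h he
    simp only [Prod.mk.injEq] at he
    apply h
    simp [he.1, dimTerm]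
  · simp
  · simp

/-- `u` is the primitive vector `𝐋` by which magnetic charges can be shifted: it has positive
coprime entries, constant on every vertex, and leaves `Δ` invariant (`conformalDim_add_shift`).
For a connected quiver it exists and is unique. -/
def IsShift (Q : UnitaryQuiver V) (u : V → ℕ) : Prop :=
  (∀ x, 0 < u x) ∧ (∀ d : ℕ, (∀ x, d ∣ u x) → d = 1) ∧
    ∀ x y, Q.A x y * (u x : ℤ) = Q.A y x * (u y : ℤ)

/-- The charge equal to `u x` on all the coordinates of the vertex `x`. -/
def shiftCharge (Q : UnitaryQuiver V) (u : V → ℕ) : Q.Charge := fun p => (u p.1 : ℤ)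

lemma conformalDim_add_shift [Fintype V] (Q : UnitaryQuiver V) {u : V → ℕ} (hu : Q.IsShift u)
    (m : Q.Charge) : Q.conformalDim (m + Q.shiftCharge u) = Q.conformalDim m := by
  unfold conformalDim
  congr 1
  refine Finset.sum_congr rfl fun p _ => Finset.sum_congr rfl fun q _ => ?_
  unfold dimTerm
  congr 2
  have := hu.2.2 p.1 q.1
  simp only [Pi.add_apply, shiftCharge, mul_add, this]
  ring

/-- The Weyl group `W = ∏_x S_{K x}`. -/
abbrev Weyl (Q : UnitaryQuiver V) : Type _ := (x : V) → Equiv.Perm (Fin (Q.K x))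

/-- A Weyl group element as a permutation of all the coordinates. -/
def Weyl.perm {Q : UnitaryQuiver V} (w : Q.Weyl) : Equiv.Perm Q.Coord :=
  Equiv.sigmaCongrRight w

/-- The variable `t` of the field of formal Laurent series over `ℚ`. -/
noncomputable def tVar : LaurentSeries ℚ := HahnSeries.single 1 1

open Classical in
/-- The contribution `∑_{w ∈ W(m)} t^{Δ(m)} / det (1 - w t²)` of a magnetic charge `m`, where `W(m)`
is the stabilizer of `m` in `W` and `w` is seen as a permutation matrix. -/
noncomputable def monopoleTerm [Fintype V] (Q : UnitaryQuiver V) (m : Q.Charge) :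
    LaurentSeries ℚ :=
  ∑ w ∈ (Finset.univ : Finset Q.Weyl).filter (fun w => ∀ p, m (w.perm p) = m p),
    HahnSeries.single (Q.conformalDim m) 1 *
      (Matrix.det (1 - tVar ^ 2 • w.perm.permMatrix (LaurentSeries ℚ)))⁻¹

open Classical in
/-- `Q.HasHilbertSeries H`: the monopole formula converges, as a series of formal Laurent series
in `t` indexed by `Λ / 𝐋ℤ`, and its value is `H`. The contribution of a class is computed on a
representative, on which it does not depend. -/
def HasHilbertSeries [Fintype V] (Q : UnitaryQuiver V) (H : LaurentSeries ℚ) : Prop :=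
  ∃ u : V → ℕ, Q.IsShift u ∧
    ∃ s : HahnSeries.SummableFamily ℤ ℚ (Q.Charge ⧸ AddSubgroup.zmultiples (Q.shiftCharge u)),
      (∀ c, s c = Q.monopoleTerm (Quotient.out c)) ∧
      H = (1 - tVar ^ 2) / (Fintype.card Q.Weyl : LaurentSeries ℚ) * s.hsum

/-! ### Subquivers -/

/-- A subquiver is determined by its weight function, extended by zero outside of its vertex set. -/
structure Subquiver (Q : UnitaryQuiver V) where
  /-- the weight function, extended by zero -/
  K : V → ℕ
  le : ∀ x, K x ≤ Q.K x

open Classical in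
/-- The quiver carried by a subquiver: its vertices are those of non-zero weight, and its adjacency
matrix is restricted from `Q`, except that the vertices of weight one lose their loops. -/
noncomputable def Subquiver.toQuiver {Q : UnitaryQuiver V} (S : Q.Subquiver) :
    UnitaryQuiver {x : V // 0 < S.K x} where
  A x y := if x = y ∧ S.K x.1 = 1 then -2 else Q.A x.1 y.1
  K x := S.K x.1
  weight_pos x := x.2
  diag x := by
    by_cases h : S.K x.1 = 1
    · exact ⟨0, by simp [h]⟩
    · simpa [h] using Q.diag x.1
  diag_of_weight_one x h := by simp [h]
  zero_iff x y h := by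
    simpa [h, h.symm] using Q.zero_iff x.1 y.1 (fun e => h (Subtype.ext e))
  pos_and_dvd x y h := by
    simpa [h, h.symm] using Q.pos_and_dvd x.1 y.1 (fun e => h (Subtype.ext e))
  length_function := by
    obtain ⟨L, hL, h⟩ := Q.length_function
    refine ⟨fun x => L x.1, fun x => hL x.1, fun x y => ?_⟩
    by_cases hxy : x = y
    · subst hxy; rfl
    · simpa [hxy, Ne.symm hxy] using h x.1 y.1

open Classical in
/-- The connected component `c` of a quiver, as a subquiver. -/
noncomputable def componentSubquiver (Q : UnitaryQuiver V) (c : Q.graph.ConnectedComponent) :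
    Q.Subquiver where
  K x := if x ∈ c.supp then Q.K x else 0
  le x := by split_ifs <;> simp

end UnitaryQuiver

/-! ### Explicit quivers -/

/-- An explicit adjacency matrix and weight vector. -/
structure QuiverShape where
  /-- the number of vertices -/
  size : ℕ
  /-- the adjacency matrix -/
  A : Fin size → Fin size → ℤ
  /-- the weight vector -/
  K : Fin size → ℕ

namespace QuiverShape

/-- The shape with all weights multiplied by `N`. -/
def smul (N : ℕ) (s : QuiverShape) : QuiverShape := ⟨s.size, s.A, fun i => N * s.K i⟩

/-- One vertex of weight `k` with `g` loops. -/
def oneVertex (g k : ℕ) : QuiverShape := ⟨1, fun _ _ => -2 + 2 * (g : ℤ), fun _ => k⟩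

/-- The tree on the vertices `0, …, n` in which every vertex `j ≥ 1` is attached to the vertex
`p j < j` by an edge with `A (p j) j = d j` and `A j (p j) = u j`; vertex `i` has weight `k i`. -/
def tree (n : ℕ) (p d u k : ℕ → ℕ) : QuiverShape where
  size := n + 1
  A i j :=
    if i = j then -2
    else if (j : ℕ) ≠ 0 ∧ p j = i then (d j : ℤ)
    else if (i : ℕ) ≠ 0 ∧ p i = j then (u i : ℤ)
    else 0
  K i := k i

/-- The linear quiver `0 — 1 — ⋯ — n`, with `A (j-1) j = d j` and `A j (j-1) = u j`. -/
def linear (n : ℕ) (d u k : ℕ → ℕ) : QuiverShape := tree n (fun j => j - 1) d u k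

/-- The quiver `0 — 1 — ⋯ — (n-2)` with two more vertices `n-1` and `n` attached to `n-2`. -/
def forked (n : ℕ) (d u k : ℕ → ℕ) : QuiverShape :=
  tree n (fun j => if j = n then n - 2 else j - 1) d u k

/-- The Abelian cycle on `n + 1 ≥ 3` vertices, with `A i (i+1) = ℓ i` and `A (i+1) i = k i`
(indices modulo `n + 1`). -/
def cycle (n : ℕ) (ℓ k : Fin (n + 1) → ℕ) : QuiverShape where
  size := n + 1
  A i j :=
    if i = j then -2
    else if j = i + 1 then (ℓ i : ℤ)
    else if i = j + 1 then (k j : ℤ)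
    else 0
  K _ := 1

/-- `A_{N-1}`: two vertices of weight one joined by `N` copies of an `ℓ`-edge. -/
def typeA (N ℓ : ℕ) : QuiverShape := linear 1 (fun _ => N * ℓ) (fun _ => N) (fun _ => 1)

/-- `𝒴(ℓ)`: an `ℓ`-edge from a vertex of weight two to a vertex of weight one. -/
def typeY (ℓ : ℕ) : QuiverShape :=
  linear 1 (fun _ => ℓ) (fun _ => 1) (fun i => if i = 0 then 2 else 1)

/-- `gc_n`: `2 ⇛ 2 — ⋯ — 2 ⇐ 2`. -/
def gc (n : ℕ) : QuiverShape :=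
  linear n (fun j => if j = 1 then 3 else 1) (fun j => if j = n then 2 else 1) (fun _ => 2)

/-- `gb_n`: `2 ⇛ 2 — ⋯ — 2 ⇒ 1`. -/
def gb (n : ℕ) : QuiverShape :=
  linear n (fun j => if j = 1 then 3 else if j = n then 2 else 1) (fun _ => 1)
    (fun i => if i = n then 1 else 2)

/-- `gd_n`: `2 ⇛ 2 — ⋯ — 2`, the last vertex being the target of two edges of lacedness `ℓ₁`, `ℓ₂`
sourced at vertices of weight one. -/
def gd (n ℓ₁ ℓ₂ : ℕ) : QuiverShape :=
  forked n (fun j => if j = 1 then 3 else 1)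
    (fun j => if j = n - 1 then ℓ₁ else if j = n then ℓ₂ else 1)
    (fun i => if n - 1 ≤ i then 1 else 2)

/-- `𝒥_{a,b}`: `1 ⇐ 2 ⇒ 1`, of lacedness `a` and `b`. -/
def typeJ (a b : ℕ) : QuiverShape :=
  linear 2 (fun j => if j = 2 then b else 1) (fun j => if j = 1 then a else 1)
    (fun i => if i = 1 then 2 else 1)

/-- `A_{2n}^{(2)}`: `2 ⇒ 2 — ⋯ — 2 ⇒ 1`. -/
def affA2even (n : ℕ) : QuiverShape :=
  linear n (fun j => if j = 1 ∨ j = n then 2 else 1) (fun _ => 1) (fun i => if i = n then 1 else 2)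

/-- `A_{2n-1}^{(2)}`: `2 ⇒ 2 — ⋯ — 2`, with two vertices of weight one attached at the end. -/
def affA2odd (n ℓ₁ ℓ₂ : ℕ) : QuiverShape :=
  forked n (fun j => if j = 1 then 2 else 1)
    (fun j => if j = n - 1 then ℓ₁ else if j = n then ℓ₂ else 1)
    (fun i => if n - 1 ≤ i then 1 else 2)

/-- `B_n^{(1)}`: `1 ⇐ 2 — ⋯ — 2`, with two vertices of weight one attached at the end. -/
def affB (n ℓ₁ ℓ₂ : ℕ) : QuiverShape :=
  forked n (fun _ => 1)
    (fun j => if j = 1 then 2 else if j = n - 1 then ℓ₁ else if j = n then ℓ₂ else 1)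
    (fun i => if i = 0 ∨ n - 1 ≤ i then 1 else 2)

/-- `D_n^{(1)}`: the chain `1 — 2 — ⋯ — 2 — 1` on the vertices `0, …, n-2`, with two more vertices
of weight one, `n - 1` attached to `n - 3` and `n` attached to `1`. -/
def affD (n ℓ₁ ℓ₂ ℓ₃ ℓ₄ : ℕ) : QuiverShape :=
  tree n (fun j => if j = n then 1 else if j = n - 1 then n - 3 else j - 1)
    (fun j => if j = 1 then ℓ₁ else 1)
    (fun j => if j = n then ℓ₂ else if j = n - 2 then ℓ₃ else if j = n - 1 then ℓ₄ else 1)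
    (fun i => if i = 0 ∨ n - 2 ≤ i then 1 else 2)

/-- `D_{n+1}^{(2)}`: `1 ⇐ 2 — ⋯ — 2 ⇒ 1`. -/
def affD2 (n : ℕ) : QuiverShape :=
  linear n (fun j => if j = n then 2 else 1) (fun j => if j = 1 then 2 else 1)
    (fun i => if i = 0 ∨ i = n then 1 else 2)

/-- `D_4^{(3)}`: `1 — 2 ⇚ 3`. -/
def affD43 (ℓ₁ : ℕ) : QuiverShape :=
  linear 2 (fun j => if j = 1 then ℓ₁ else 1) (fun j => if j = 2 then 3 else 1) (fun i => i + 1)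

/-- `E_6^{(1)}`: the chain `1 — 2 — 3 — 2 — 1` with a leg `2 — 1` attached to its middle. -/
def affE6 (ℓ₁ ℓ₂ ℓ₃ : ℕ) : QuiverShape :=
  tree 6 (fun j => if j = 5 then 2 else j - 1) (fun j => if j = 1 then ℓ₁ else 1)
    (fun j => if j = 4 then ℓ₂ else if j = 6 then ℓ₃ else 1)
    (fun i => [1, 2, 3, 2, 1, 2, 1].getD i 0)

/-- `E_6^{(2)}`: `2 — 4 ⇒ 3 — 2 — 1`. -/
def affE62 (ℓ₁ : ℕ) : QuiverShape :=
  linear 4 (fun j => if j = 2 then 2 else 1) (fun j => if j = 4 then ℓ₁ else 1)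
    (fun i => [2, 4, 3, 2, 1].getD i 0)

/-- `E_7^{(1)}`: the chain `1 — 2 — 3 — 4 — 3 — 2 — 1` with a vertex of weight `2` attached to its
middle. -/
def affE7 (ℓ₁ ℓ₂ : ℕ) : QuiverShape :=
  tree 7 (fun j => if j = 7 then 3 else j - 1) (fun j => if j = 1 then ℓ₁ else 1)
    (fun j => if j = 6 then ℓ₂ else 1) (fun i => [1, 2, 3, 4, 3, 2, 1, 2].getD i 0)

/-- `E_8^{(1)}`: the chain `1 — 2 — 3 — 4 — 5 — 6 — 4 — 2` with a vertex of weight `3` attached to the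
vertex of weight `6`. -/
def affE8 (ℓ : ℕ) : QuiverShape :=
  tree 8 (fun j => if j = 8 then 5 else j - 1) (fun j => if j = 1 then ℓ else 1)
    (fun _ => 1) (fun i => [1, 2, 3, 4, 5, 6, 4, 2, 3].getD i 0)

/-- `F_4^{(1)}`: `1 — 2 — 3 ⇒ 2 — 1`. -/
def affF4 (ℓ₁ ℓ₂ : ℕ) : QuiverShape :=
  linear 4 (fun j => if j = 1 then ℓ₁ else if j = 3 then 2 else 1)
    (fun j => if j = 4 then ℓ₂ else 1) (fun i => [1, 2, 3, 2, 1].getD i 0)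

/-- `G_2^{(1)}`: `1 — 2 ⇛ 1`. -/
def affG2 (ℓ₁ : ℕ) : QuiverShape :=
  linear 2 (fun j => if j = 1 then ℓ₁ else 3) (fun _ => 1) (fun i => [1, 2, 1].getD i 0)

/-- The simply-laced affine Dynkin quivers `A_n^{(1)}`, `D_n^{(1)}`, `E_6^{(1)}`, `E_7^{(1)}`,
`E_8^{(1)}`. -/
inductive IsSimplyLacedAffine : QuiverShape → Prop
  | A1 : IsSimplyLacedAffine (typeA 2 1)
  | A (n : ℕ) (hn : 2 ≤ n) : IsSimplyLacedAffine (cycle n (fun _ => 1) (fun _ => 1))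
  | D (n : ℕ) (hn : 4 ≤ n) : IsSimplyLacedAffine (affD n 1 1 1 1)
  | E6 : IsSimplyLacedAffine (affE6 1 1 1)
  | E7 : IsSimplyLacedAffine (affE7 1 1)
  | E8 : IsSimplyLacedAffine (affE8 1)

/-- The classification list. The parameters `ℓ`, `ℓ₁`, … of the affine Dynkin quivers are the
lacednesses of the edges sourced at their end vertices of weight one. -/
inductive IsListed : QuiverShape → Prop
  /- Abelian quivers -/
  | typeA (N ℓ : ℕ) (hN : 2 ≤ N) (hl : 1 ≤ ℓ) : IsListed (typeA N ℓ)
  /- The linear quiver `h_{n,δ,σ}` with `δ = gcd (ℓ 1) (k n)`. The charge vector `σ` is determined up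
  to a unit by the edges, and always exists. -/
  | h (n : ℕ) (ℓ k : ℕ → ℕ) (hn : 2 ≤ n) (hpos : ∀ i, 1 ≤ ℓ i ∧ 1 ≤ k i)
      (hone : ∀ i, ℓ i = 1 ∨ k i = 1) (hgcd : 1 < Nat.gcd (ℓ 1) (k n))
      (hcop : ∀ i j, 1 ≤ i → i ≤ j → j ≤ n → ¬ (i = 1 ∧ j = n) → Nat.Coprime (ℓ i) (k j)) :
      IsListed (linear n ℓ k (fun _ => 1))
  /- The cyclic quiver `h̄_{n,σ}`, including `A_n^{(1)}`; here `σ i = gcd (ℓ (i + 2)) (k i)`. -/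
  | hbar (n : ℕ) (ℓ k : Fin (n + 1) → ℕ) (hn : 2 ≤ n) (hpos : ∀ i, 1 ≤ ℓ i ∧ 1 ≤ k i)
      (hone : ∀ i, ℓ i = 1 ∨ k i = 1) (hprod : ∏ i, k i = ∏ i, ℓ i)
      (hcop : ∀ i j, i ≠ j + 1 → i ≠ j + 1 + 1 → Nat.Coprime (ℓ i) (k j)) :
      IsListed (cycle n ℓ k)
  /- Non-Abelian quivers -/
  | loops (g : ℕ) (hg : 1 ≤ g) : IsListed (oneVertex g 2)
  | typeY (ℓ : ℕ) (hl : 4 ≤ ℓ) : IsListed (typeY ℓ)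
  | gc (n : ℕ) (hn : 2 ≤ n) : IsListed (gc n)
  | gb (n : ℕ) (hn : 2 ≤ n) : IsListed (gb n)
  | gd (n ℓ₁ ℓ₂ : ℕ) (hn : 3 ≤ n) (h₁ : 1 ≤ ℓ₁) (h₂ : 1 ≤ ℓ₂) (h₁₂ : Nat.Coprime ℓ₁ ℓ₂)
      (h₁3 : Nat.Coprime ℓ₁ 3) (h₂3 : Nat.Coprime ℓ₂ 3) : IsListed (gd n ℓ₁ ℓ₂)
  | J23 : IsListed (typeJ 2 3)
  | J33 : IsListed (typeJ 3 3)
  /- Affine Dynkin quivers -/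
  | affA2even (n : ℕ) (hn : 2 ≤ n) : IsListed (affA2even n)
  | affA2odd (n ℓ₁ ℓ₂ : ℕ) (hn : 3 ≤ n) (h₁ : Odd ℓ₁) (h₂ : Odd ℓ₂) (h₁₂ : Nat.Coprime ℓ₁ ℓ₂) :
      IsListed (affA2odd n ℓ₁ ℓ₂)
  | affB (n ℓ₁ ℓ₂ : ℕ) (hn : 3 ≤ n) (h₁ : 1 ≤ ℓ₁) (h₂ : 1 ≤ ℓ₂) (h₁₂ : Nat.Coprime ℓ₁ ℓ₂) :
      IsListed (affB n ℓ₁ ℓ₂)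
  | affD (n ℓ₁ ℓ₂ ℓ₃ ℓ₄ : ℕ) (hn : 4 ≤ n) (h₁ : 1 ≤ ℓ₁) (h₂ : 1 ≤ ℓ₂) (h₃ : 1 ≤ ℓ₃) (h₄ : 1 ≤ ℓ₄)
      (hcop : [ℓ₁, ℓ₂, ℓ₃, ℓ₄].Pairwise Nat.Coprime) : IsListed (affD n ℓ₁ ℓ₂ ℓ₃ ℓ₄)
  | affD2 (n : ℕ) (hn : 2 ≤ n) : IsListed (affD2 n)
  | affD43 (ℓ₁ : ℕ) (h₁ : 1 ≤ ℓ₁) (h₁3 : Nat.Coprime ℓ₁ 3) : IsListed (affD43 ℓ₁)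
  | affE6 (ℓ₁ ℓ₂ ℓ₃ : ℕ) (h₁ : 1 ≤ ℓ₁) (h₂ : 1 ≤ ℓ₂) (h₃ : 1 ≤ ℓ₃)
      (hcop : [ℓ₁, ℓ₂, ℓ₃].Pairwise Nat.Coprime) : IsListed (affE6 ℓ₁ ℓ₂ ℓ₃)
  | affE62 (ℓ₁ : ℕ) (h₁ : Odd ℓ₁) : IsListed (affE62 ℓ₁)
  | affE7 (ℓ₁ ℓ₂ : ℕ) (h₁ : 1 ≤ ℓ₁) (h₂ : 1 ≤ ℓ₂) (h₁₂ : Nat.Coprime ℓ₁ ℓ₂) :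
      IsListed (affE7 ℓ₁ ℓ₂)
  | affE8 (ℓ : ℕ) (hl : 1 ≤ ℓ) : IsListed (affE8 ℓ)
  | affF4 (ℓ₁ ℓ₂ : ℕ) (h₁ : 1 ≤ ℓ₁) (h₂ : Odd ℓ₂) (h₁₂ : Nat.Coprime ℓ₁ ℓ₂) :
      IsListed (affF4 ℓ₁ ℓ₂)
  | affG2 (ℓ₁ : ℕ) (h₁ : 1 ≤ ℓ₁) : IsListed (affG2 ℓ₁)

end QuiverShape

/-! ### Good quivers and decay products -/

namespace UnitaryQuiver

variable {V : Type*}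

/-- A quiver is isomorphic to an explicit one when a bijection of the vertices preserves the
adjacency matrices and the weights. -/
def IsoShape (Q : UnitaryQuiver V) (s : QuiverShape) : Prop :=
  ∃ e : V ≃ Fin s.size, (∀ x y, Q.A x y = s.A (e x) (e y)) ∧ ∀ x, Q.K x = s.K (e x)

/-- A connected (in particular non-empty) quiver is good if (i) its Hilbert series converges, is
non-constant and has no term of order `t`, or (ii) it is `N · A_0^{(1)}` with `N ≥ 2` or `N · X` with
`N ≥ 1` and `X` a simply-laced affine Dynkin quiver. -/
def IsGoodConnected [Fintype V] (Q : UnitaryQuiver V) : Prop :=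
  Q.graph.Connected ∧
    ((∃ H : LaurentSeries ℚ, Q.HasHilbertSeries H ∧ (¬ ∃ a : ℚ, H = HahnSeries.C a) ∧
        H.coeff 1 = 0) ∨
      (∃ N : ℕ, 2 ≤ N ∧ Q.IsoShape (QuiverShape.oneVertex 1 N)) ∨
      (∃ (N : ℕ) (s : QuiverShape), 1 ≤ N ∧ s.IsSimplyLacedAffine ∧
        Q.IsoShape (QuiverShape.smul N s)))

/-- A non-empty quiver is good if it is connected and good in the sense of `IsGoodConnected`, or,
more generally, if all of its connected components are. -/
def IsGood [Fintype V] (Q : UnitaryQuiver V) : Prop :=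
  Q.IsGoodConnected ∨
    (Nonempty V ∧ ∀ c : Q.graph.ConnectedComponent,
      (Q.componentSubquiver c).toQuiver.IsGoodConnected)

/-- A fission product: a multiset of good connected subquivers whose weights sum up to at most the
weights of the quiver. -/
def IsFissionProduct [Fintype V] (Q : UnitaryQuiver V) (F : Multiset Q.Subquiver) : Prop :=
  (∀ S ∈ F, S.toQuiver.IsGoodConnected) ∧ ∀ x, (F.map fun S => S.K x).sum ≤ Q.K x

/-- A decay product: a subquiver which alone is a fission product. -/
def IsDecayProduct [Fintype V] (Q : UnitaryQuiver V) (S : Q.Subquiver) : Prop :=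
  Q.IsFissionProduct {S}

end UnitaryQuiver

/-! Goodness is first turned into an inequality on charges. All coefficients of the monopole formula
are non-negative, so nothing cancels in it: a non-constant charge with Δ ≤ 0 would destroy
convergence through its multiples, and one with Δ = 1 would be visible at order t. Hence a connected
quiver that is good through its Hilbert series satisfies Δ(m) ≥ 2 for every m not proportional to 𝐋
(`DimBound`, from `dimBound_of_hasHilbertSeries`). Conversely, on a connected quiver with at least
two coordinates this bound implies goodness (`isGoodConnected_of_dimBound`), convergence being a
consequence of Dickson's lemma.

The converse serves to show that the listed quivers are good. For most of them Δ is bounded below by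
the balances ∑_y A(x,y) K(y) through an energy-distance inequality, and Δ is even because the
balances are (`dimBound_of_balance`). Stars centred at weight two (`dimBound_of_star`) and Abelian
quivers are treated by hand.

The heart is that a connected quiver with the bound and at least two coordinates contains a listed
shape (`NoListed.false_of_dimBound`). Suppose it contains none. Avoiding loops and the three Abelian
families makes it a loopless tree in which every edge has multiplicity one in at least one direction
and the outer multiplicities of any path are coprime. Coprimality produces a charge with Δ = 1
across an edge between two vertices of weight one, so there is no such edge. A unit charge at a
vertex of weight at least two has Δ equal to its balance plus 2, so this balance is non-negative.

From there the argument resembles the classification of affine Dynkin diagrams, with weights. A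
chain with a special end (multiple edge or branching, a `Cap`) cannot have a second special end, so
beyond a cap the quiver is a `Leg` along which the weights decrease convexly. At a trivalent vertex
with legs of p₁, p₂, p₃ vertices the balance requires ∑ 1/(pᵢ+1) ≤ 1, which forces an E-type
subquiver; a multiple edge leaving a vertex of weight at least two forces D₄⁽³⁾, F₄⁽¹⁾ or E₆⁽²⁾.
What is left has only simple outgoing multiplicities and valency at most two at its vertices of
weight at least two; then a vertex of maximal weight has two neighbours of the same weight, this
spreads over the whole tree, and a finite tree has a leaf.

The exceptional good quivers contain a listed shape directly, and a disconnected quiver contains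
whatever one of its components contains. -/

/-! ### Power series with non-negative coefficients -/

namespace PowerSeries

/-- All coefficients are non-negative. -/
def IsNonneg (f : PowerSeries ℚ) : Prop := ∀ n, 0 ≤ coeff n f

lemma IsNonneg.mul {f g : PowerSeries ℚ} (hf : f.IsNonneg) (hg : g.IsNonneg) :
    (f * g).IsNonneg := fun n => by
  rw [coeff_mul]
  exact Finset.sum_nonneg fun p _ => mul_nonneg (hf _) (hg _)

lemma IsNonneg.one : (1 : PowerSeries ℚ).IsNonneg := fun n => by
  rw [coeff_one]; split_ifs <;> norm_num

lemma IsNonneg.pow {f : PowerSeries ℚ} (hf : f.IsNonneg) (n : ℕ) : (f ^ n).IsNonneg := by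
  induction n with
  | zero => simpa using IsNonneg.one
  | succ n ih => rw [pow_succ]; exact ih.mul hf

/-- The entries of the inverse of `1 - N` are non-negative if those of `N` are, and if `N` vanishes
at the origin. -/
lemma isNonneg_of_eq_one_add_mul {n : ℕ} (N B : Matrix (Fin n) (Fin n) (PowerSeries ℚ))
    (hN : ∀ i j, (N i j).IsNonneg) (h0 : ∀ i j, coeff 0 (N i j) = 0) (hB : B = 1 + N * B) :
    ∀ i j, (B i j).IsNonneg := by
  intro i j k
  induction k using Nat.strong_induction_on generalizing i with
  | _ k ih =>
    rw [hB, Matrix.add_apply, Matrix.mul_apply, map_add, map_sum]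
    refine add_nonneg ?_ (Finset.sum_nonneg fun l _ => ?_)
    · rw [Matrix.one_apply]
      split_ifs
      · exact IsNonneg.one k
      · simp
    · rw [coeff_mul]
      refine Finset.sum_nonneg fun p hp => ?_
      rw [Finset.HasAntidiagonal.mem_antidiagonal] at hp
      rcases Nat.eq_zero_or_pos p.1 with h | h
      · rw [h, h0, zero_mul]
      · exact mul_nonneg (hN _ _ _) (ih _ (by omega) _)

/-- By Cramer's rule the (0,0) entry of (1 - N)⁻¹ is the quotient of the minor of 1 - N without
first row and column by the full determinant. So 1 / det is this entry times the inverse of the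
minor: the first factor is non-negative by the recursion B = 1 + N B, the second by induction on the
size. -/
lemma exists_isNonneg_mul_det_eq_one {n : ℕ} (N : Matrix (Fin n) (Fin n) (PowerSeries ℚ))
    (hN : ∀ i j, (N i j).IsNonneg) (h0 : ∀ i j, coeff 0 (N i j) = 0) :
    ∃ f : PowerSeries ℚ, f.IsNonneg ∧ f * (1 - N).det = 1 := by
  induction n with
  | zero => exact ⟨1, IsNonneg.one, by simp⟩
  | succ n ih =>
    obtain ⟨f, hf, hf1⟩ := ih (N.submatrix Fin.succ Fin.succ) (fun _ _ => hN _ _)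
      (fun _ _ => h0 _ _)
    have hu : IsUnit (1 - N).det := by
      rw [PowerSeries.isUnit_iff_constantCoeff, RingHom.map_det]
      have : (constantCoeff (R := ℚ)).mapMatrix (1 - N) = 1 := by
        ext i j
        have := h0 i j
        rw [coeff_zero_eq_constantCoeff_apply] at this
        simp [Matrix.one_apply, this, apply_ite]
      rw [this]
      simp
    have hB : (1 - N)⁻¹ = 1 + N * (1 - N)⁻¹ := by
      have := Matrix.mul_nonsing_inv (1 - N) hu
      rw [sub_mul, one_mul, sub_eq_iff_eq_add] at this
      exact this
    have hpos := isNonneg_of_eq_one_add_mul N _ hN h0 hB 0 0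
    refine ⟨(1 - N)⁻¹ 0 0 * f, hpos.mul hf, ?_⟩
    have hadj : (1 - N)⁻¹ 0 0 * (1 - N).det = (1 - N.submatrix Fin.succ Fin.succ).det := by
      have h2 : (1 - N)⁻¹ 0 0 * (1 - N).det = (1 - N).adjugate 0 0 := by
        rw [Matrix.inv_def, Matrix.smul_apply, smul_eq_mul, mul_right_comm,
          Ring.inverse_mul_cancel _ hu, one_mul]
      rw [h2, Matrix.adjugate_fin_succ_eq_det_submatrix]
      simp only [Fin.val_zero, add_zero, pow_zero, one_mul, Fin.succAbove_zero]
      congr 1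
      ext i j : 2
      simp [Matrix.one_apply]
    rw [mul_right_comm, hadj, mul_comm, hf1]

/-- The geometric series `∑ X ^ (2 j)`. -/
def evenGeom : PowerSeries ℚ := mk fun n => if Even n then 1 else 0

lemma evenGeom_mul : evenGeom * (1 - X ^ 2) = 1 := by
  ext n
  rw [mul_sub, mul_one, map_sub, coeff_one]
  rcases n with _ | _ | n
  · simp [evenGeom, coeff_mul_X_pow']
  · simp [evenGeom, coeff_mul_X_pow']
  · rw [show n + 1 + 1 = n + 2 from rfl, coeff_mul_X_pow]
    simp [evenGeom, parity_simps]

lemma isNonneg_evenGeom : evenGeom.IsNonneg := fun n => by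
  rw [evenGeom, coeff_mk]; split_ifs <;> norm_num

/-- Unbounded coefficients in the contribution of the trivial charge will exclude a constant Hilbert
series; linear growth suffices for this. -/
lemma le_coeff_evenGeom_pow {r : ℕ} (hr : 2 ≤ r) (k : ℕ) :
    (k + 1 : ℚ) ≤ coeff (2 * k) (evenGeom ^ r) := by
  induction r, hr using Nat.le_induction with
  | base =>
    rw [sq, coeff_mul]
    calc (k + 1 : ℚ) = ∑ i ∈ Finset.range (k + 1), (1 : ℚ) := by simp
      _ = ∑ p ∈ (Finset.range (k + 1)).image fun i => (2 * i, 2 * (k - i)),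
            coeff p.1 evenGeom * coeff p.2 evenGeom := by
          rw [Finset.sum_image (by intro a _ b _ h; simp at h; omega)]
          simp [evenGeom]
      _ ≤ _ := by
          refine Finset.sum_le_sum_of_subset_of_nonneg ?_ fun p _ _ =>
            mul_nonneg (isNonneg_evenGeom _) (isNonneg_evenGeom _)
          intro p hp
          simp only [Finset.mem_image, Finset.mem_range] at hp
          obtain ⟨i, hi, rfl⟩ := hp
          rw [Finset.HasAntidiagonal.mem_antidiagonal]
          omega
  | succ r _ ih =>
    refine ih.trans ?_
    rw [pow_succ, coeff_mul]
    have h := Finset.single_le_sum (s := Finset.HasAntidiagonal.antidiagonal (2 * k))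
      (f := fun p => coeff p.1 (evenGeom ^ r) * coeff p.2 evenGeom)
      (fun p _ => mul_nonneg (isNonneg_evenGeom.pow r _) (isNonneg_evenGeom _))
      (a := (2 * k, 0)) (by simp)
    simpa [evenGeom] using h

end PowerSeries

/-! ### The expansion of the Casimir factors 1 / det (1 - w t²) -/

namespace UnitaryQuiver

open PowerSeries in
/-- The expansion of `1 / det (1 - σ t²)` for a permutation `σ`. -/
lemma exists_powerSeries_eq_inv_det {ι : Type*} [Fintype ι] [DecidableEq ι] (σ : Equiv.Perm ι) :
    ∃ f : PowerSeries ℚ, f.IsNonneg ∧ coeff 0 f = 1 ∧ coeff 1 f = 0 ∧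
      HahnSeries.ofPowerSeries ℤ ℚ f =
        (Matrix.det (1 - tVar ^ 2 • σ.permMatrix (LaurentSeries ℚ)))⁻¹ := by
  set P : Matrix ι ι (PowerSeries ℚ) := (X ^ 2 : PowerSeries ℚ) • σ.permMatrix (PowerSeries ℚ)
    with hP
  have hPij : ∀ i j, P i j = X ^ 2 ∨ P i j = 0 := by
    intro i j
    simp only [hP, Matrix.smul_apply, Equiv.Perm.permMatrix, PEquiv.toMatrix_apply, smul_eq_mul]
    split_ifs <;> simp
  let e := Fintype.equivFin ι
  obtain ⟨f, hf, hf1⟩ := exists_isNonneg_mul_det_eq_one (P.submatrix e.symm e.symm)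
    (fun i j n => by
      rcases hPij (e.symm i) (e.symm j) with h | h <;> rw [Matrix.submatrix_apply, h]
      · rw [coeff_X_pow]; split_ifs <;> norm_num
      · simp)
    (fun i j => by
      rcases hPij (e.symm i) (e.symm j) with h | h <;> rw [Matrix.submatrix_apply, h] <;> simp)
  have hdet : (1 - P.submatrix e.symm e.symm).det = (1 - P).det := by
    rw [← Matrix.det_submatrix_equiv_self e.symm (1 - P)]
    congr 1
    ext i j : 2
    simp [Matrix.one_apply]
  rw [hdet] at hf1
  have hmap : HahnSeries.ofPowerSeries ℤ ℚ (1 - P).det =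
      Matrix.det (1 - tVar ^ 2 • σ.permMatrix (LaurentSeries ℚ)) := by
    rw [RingHom.map_det]
    congr 1
    ext i j : 2
    simp only [hP, RingHom.mapMatrix_apply, Matrix.map_apply, Matrix.sub_apply, Matrix.one_apply,
      Matrix.smul_apply, Equiv.Perm.permMatrix, PEquiv.toMatrix_apply, smul_eq_mul, map_sub,
      map_mul, map_pow, HahnSeries.ofPowerSeries_X, apply_ite (HahnSeries.ofPowerSeries ℤ ℚ),
      map_one, map_zero, tVar]
  -- The determinant is 1 modulo X ^ 2, which fixes the coefficients of its inverse in degrees 0 and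
  -- 1.
  obtain ⟨g, hg⟩ : ∃ g : PowerSeries ℚ, (1 - P).det = 1 + X ^ 2 * g := by
    obtain ⟨c, hc⟩ : ∃ c : PowerSeries ℚ,
        (1 + (-(X ^ 2 : PowerSeries ℚ)) • σ.permMatrix (PowerSeries ℚ)).det =
          1 + (σ.permMatrix (PowerSeries ℚ)).trace * (-(X ^ 2)) + c * (-(X ^ 2)) ^ 2 :=
      ⟨_, Matrix.det_one_add_smul _ _⟩
    rw [neg_smul, ← sub_eq_add_neg, ← hP] at hc
    exact ⟨-(Matrix.trace (σ.permMatrix (PowerSeries ℚ))) + c * X ^ 2, by rw [hc]; ring⟩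
  rw [hg, mul_add, mul_one] at hf1
  refine ⟨f, hf, ?_, ?_, ?_⟩
  · have := congrArg (coeff 0) hf1
    simpa [coeff_zero_eq_constantCoeff] using this
  · have := congrArg (coeff 1) hf1
    rw [map_add, mul_left_comm, coeff_X_pow_mul', coeff_one] at this
    simpa using this
  · rw [← hmap, hg]
    refine eq_inv_of_mul_eq_one_left ?_
    rw [← map_mul, mul_add, mul_one, hf1, map_one]

open PowerSeries in
lemma inv_det_one {ι : Type*} [Fintype ι] [DecidableEq ι] :
    HahnSeries.ofPowerSeries ℤ ℚ (evenGeom ^ Fintype.card ι) =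
      (Matrix.det (1 - tVar ^ 2 • (1 : Equiv.Perm ι).permMatrix (LaurentSeries ℚ)))⁻¹ := by
  refine eq_inv_of_mul_eq_one_left ?_
  have : (1 - tVar ^ 2 • (1 : Equiv.Perm ι).permMatrix (LaurentSeries ℚ)) =
      (1 - tVar ^ 2) • (1 : Matrix ι ι (LaurentSeries ℚ)) := by
    rw [sub_smul, one_smul]
    congr 2
    ext i j : 2
    simp [Equiv.Perm.permMatrix, PEquiv.toMatrix_apply, Matrix.one_apply]
  rw [this, Matrix.det_smul, Matrix.det_one, mul_one, map_pow, ← mul_pow]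
  have h : HahnSeries.ofPowerSeries ℤ ℚ (1 - X ^ 2) = 1 - tVar ^ 2 := by
    simp [tVar]
  rw [← h, ← map_mul, evenGeom_mul, map_one, one_pow]

end UnitaryQuiver


/-! ### Constant charges and the bound on the conformal dimension -/

namespace UnitaryQuiver

variable {V : Type*}

/-- The charges at which all the arguments of the absolute values in `Δ` vanish. -/
def IsConst (Q : UnitaryQuiver V) (m : Q.Charge) : Prop :=
  (∀ p q : Q.Coord, p.1 = q.1 → m p = m q) ∧ ∀ p q, Q.A p.1 q.1 * m p = Q.A q.1 p.1 * m q

/-- The bound `Δ(m) ≥ 2` for all charges which are non-trivial modulo shifts. -/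
def DimBound [Fintype V] (Q : UnitaryQuiver V) : Prop :=
  ∀ m : Q.Charge, Q.IsConst m ∨ 2 ≤ Q.conformalDim m

/-! ### Shifts -/

lemma IsConst.zsmul {Q : UnitaryQuiver V} {m : Q.Charge} (h : Q.IsConst m) (k : ℤ) :
    Q.IsConst (k • m) :=
  ⟨fun p q e => by simp [h.1 p q e], fun p q => by
    simp [mul_left_comm _ k, h.2 p q]⟩

lemma IsConst.of_zsmul {Q : UnitaryQuiver V} {m : Q.Charge} {k : ℤ} (hk : k ≠ 0)
    (h : Q.IsConst (k • m)) : Q.IsConst m := by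
  refine ⟨fun p q e => ?_, fun p q => ?_⟩
  · have := h.1 p q e
    simpa [hk] using this
  · have := h.2 p q
    simpa [mul_left_comm _ k, hk] using this

lemma IsShift.isConst {Q : UnitaryQuiver V} {u : V → ℕ} (hu : Q.IsShift u) :
    Q.IsConst (Q.shiftCharge u) :=
  ⟨fun p q e => by simp [shiftCharge, e], fun p q => hu.2.2 p.1 q.1⟩

/-- The shift relation is inverse to that of the length function: u x = (∏ L) / L x satisfies it,
and dividing by the gcd makes it primitive. -/
lemma exists_isShift [Fintype V] [Nonempty V] (Q : UnitaryQuiver V) : ∃ u, Q.IsShift u := by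
  classical
  obtain ⟨L, hL, h⟩ := Q.length_function
  set P : ℕ := ∏ x, L x with hP
  have hdvd : ∀ x, L x ∣ P := fun x => Finset.dvd_prod_of_mem L (Finset.mem_univ x)
  have hPpos : 0 < P := Finset.prod_pos fun x _ => hL x
  choose v hv using hdvd
  have hvpos : ∀ x, 0 < v x := fun x => by
    rcases Nat.eq_zero_or_pos (v x) with h0 | h0
    · rw [hv x, h0, mul_zero] at hPpos; exact absurd hPpos (lt_irrefl _)
    · exact h0
  have hv2 : ∀ x y, Q.A x y * (v x : ℤ) = Q.A y x * (v y : ℤ) := by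
    intro x y
    have h1 : (L x : ℤ) * v x = P := by exact_mod_cast (hv x).symm
    have h2 : (L y : ℤ) * v y = P := by exact_mod_cast (hv y).symm
    have hx : (L x : ℤ) ≠ 0 := by exact_mod_cast (hL x).ne'
    have hy : (L y : ℤ) ≠ 0 := by exact_mod_cast (hL y).ne'
    apply mul_left_cancel₀ (mul_ne_zero hx hy)
    linear_combination (Q.A x y * L y) * h1 - (Q.A y x * L x) * h2 + (P : ℤ) * h x y
  obtain ⟨g, hg, hg1⟩ := Finset.extract_gcd v (Finset.univ_nonempty (α := V))
  have hd : Finset.univ.gcd v ≠ 0 := by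
    intro h0
    obtain ⟨x⟩ := ‹Nonempty V›
    have := hg x (Finset.mem_univ x)
    rw [h0, zero_mul] at this
    exact (hvpos x).ne' this
  refine ⟨g, fun x => ?_, fun d hd1 => ?_, fun x y => ?_⟩
  · rcases Nat.eq_zero_or_pos (g x) with h0 | h0
    · have := hg x (Finset.mem_univ x)
      rw [h0, mul_zero] at this
      exact absurd this (hvpos x).ne'
    · exact h0
  · have := Finset.dvd_gcd (s := Finset.univ) (f := g) fun x _ => hd1 x
    rw [hg1] at this
    exact Nat.dvd_one.1 this
  · have h1 := hv2 x y
    rw [hg x (Finset.mem_univ x), hg y (Finset.mem_univ y)] at h1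
    have hd' : ((Finset.univ.gcd v : ℕ) : ℤ) ≠ 0 := by exact_mod_cast hd
    apply mul_left_cancel₀ hd'
    push_cast at h1
    linear_combination h1

/-- On a connected quiver, an edgewise relation propagates. -/
lemma mul_eq_mul_of_connected {Q : UnitaryQuiver V} (hc : Q.graph.Connected) {u : V → ℕ}
    (hu : Q.IsShift u) {f : V → ℤ} (hf : ∀ x y, Q.graph.Adj x y → Q.A x y * f x = Q.A y x * f y)
    (x y : V) : f x * u y = f y * u x := by
  have key : ∀ x y, Q.graph.Adj x y → f x * u y = f y * u x := by
    intro x y hxy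
    apply mul_left_cancel₀ hxy.2
    linear_combination (u y : ℤ) * hf x y hxy - f y * hu.2.2 x y
  obtain ⟨p⟩ := hc.preconnected x y
  induction p with
  | nil => rfl
  | @cons a b c hab _ ih =>
    have hb : (u b : ℤ) ≠ 0 := by exact_mod_cast (hu.1 b).ne'
    apply mul_left_cancel₀ hb
    linear_combination (u c : ℤ) * key a b hab + (u a : ℤ) * ih

/-- A constant charge is a function f of the vertex with f x * u y = f y * u x. Thus u y divides f y
* u x for all x, hence divides f y since the entries of u are coprime; the quotients f y / u y all
agree. -/
lemma mem_zmultiples_iff [Fintype V] {Q : UnitaryQuiver V} (hc : Q.graph.Connected) {u : V → ℕ}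
    (hu : Q.IsShift u) (m : Q.Charge) :
    m ∈ AddSubgroup.zmultiples (Q.shiftCharge u) ↔ Q.IsConst m := by
  refine ⟨?_, fun h => ?_⟩
  · rw [AddSubgroup.mem_zmultiples_iff]
    rintro ⟨k, rfl⟩
    exact hu.isConst.zsmul k
  · let f : V → ℤ := fun x => m ⟨x, ⟨0, Q.weight_pos x⟩⟩
    have hmf : ∀ p : Q.Coord, m p = f p.1 := fun p => h.1 _ _ rfl
    have hf := mul_eq_mul_of_connected hc hu (f := f) fun x y _ =>
      h.2 ⟨x, ⟨0, Q.weight_pos x⟩⟩ ⟨y, ⟨0, Q.weight_pos y⟩⟩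
    have hdvd : ∀ y, (u y : ℤ) ∣ f y := by
      intro y
      have h1 : Finset.univ.gcd (fun x => f y * (u x : ℤ)) = normalize (f y) := by
        rw [Finset.gcd_mul_left]
        have : Finset.univ.gcd (fun x => (u x : ℤ)) = 1 := by
          have h2 : (Finset.univ.gcd (fun x => (u x : ℤ))).natAbs = 1 :=
            hu.2.1 _ fun x => by
              have := Finset.gcd_dvd (s := Finset.univ) (f := fun x => (u x : ℤ))
                (Finset.mem_univ x)
              exact Int.natAbs_dvd_natAbs.2 this
          have h3 : 0 ≤ Finset.univ.gcd (fun x => (u x : ℤ)) := by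
            have := Finset.normalize_gcd (s := Finset.univ) (f := fun x => (u x : ℤ))
            rw [← this]
            rw [← Int.abs_eq_normalize]
            exact abs_nonneg _
          omega
        rw [this, mul_one]
      have h2 : (u y : ℤ) ∣ Finset.univ.gcd (fun x => f y * (u x : ℤ)) :=
        Finset.dvd_gcd fun x _ => ⟨f x, by linarith [hf x y]⟩
      rw [h1] at h2
      exact (normalize_associated (f y)).dvd_iff_dvd_right.1 h2
    obtain ⟨x0⟩ := hc.nonempty
    obtain ⟨k, hk⟩ := hdvd x0
    rw [AddSubgroup.mem_zmultiples_iff]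
    refine ⟨k, funext fun p => ?_⟩
    have hx0 : (u x0 : ℤ) ≠ 0 := by exact_mod_cast (hu.1 x0).ne'
    rw [hmf p]
    simp only [Pi.smul_apply, shiftCharge, smul_eq_mul]
    apply mul_left_cancel₀ hx0
    linear_combination -(u p.1 : ℤ) * hk - hf p.1 x0

/-! ### The conformal dimension -/

section

variable [Fintype V]

lemma conformalDim_nsmul (Q : UnitaryQuiver V) (k : ℕ) (m : Q.Charge) :
    Q.conformalDim (k • m) = k * Q.conformalDim m := by
  have h := Q.two_mul_conformalDim (k • m)
  have h2 := Q.two_mul_conformalDim m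
  have : ∀ p q, Q.dimTerm (k • m) p q = k * Q.dimTerm m p q := by
    intro p q
    have : Q.A p.1 q.1 * (k • m) p - Q.A q.1 p.1 * (k • m) q =
        k * (Q.A p.1 q.1 * m p - Q.A q.1 p.1 * m q) := by
      simp; ring
    rw [dimTerm, this, abs_mul, Nat.abs_cast, dimTerm]
    ring
  simp only [this, ← Finset.mul_sum, ← h2] at h
  linarith

lemma conformalDim_add_zsmul {Q : UnitaryQuiver V} {u : V → ℕ} (hu : Q.IsShift u) (m : Q.Charge)
    (k : ℤ) : Q.conformalDim (m + k • Q.shiftCharge u) = Q.conformalDim m := by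
  have h : ∀ (k : ℕ) m, Q.conformalDim (m + k • Q.shiftCharge u) = Q.conformalDim m := by
    intro k
    induction k with
    | zero => simp
    | succ k ih => intro m; rw [succ_nsmul, ← add_assoc, conformalDim_add_shift _ hu, ih]
  obtain ⟨n, rfl | rfl⟩ := k.eq_nat_or_neg
  · simpa using h n m
  · have := h n (m + (-(n : ℤ)) • Q.shiftCharge u)
    rw [← this]
    simp

lemma conformalDim_out {Q : UnitaryQuiver V} {u : V → ℕ} (hu : Q.IsShift u) (m : Q.Charge) :
    Q.conformalDim (Quotient.out
      (QuotientAddGroup.mk m : Q.Charge ⧸ AddSubgroup.zmultiples (Q.shiftCharge u))) =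
      Q.conformalDim m := by
  obtain ⟨⟨h, hh⟩, e⟩ := QuotientAddGroup.mk_out_eq_add (AddSubgroup.zmultiples (Q.shiftCharge u)) m
  obtain ⟨k, rfl⟩ := AddSubgroup.mem_zmultiples_iff.1 hh
  rw [e]
  exact conformalDim_add_zsmul hu m k

lemma conformalDim_of_isConst {Q : UnitaryQuiver V} {m : Q.Charge} (h : Q.IsConst m) :
    Q.conformalDim m = 0 := by
  have := Q.two_mul_conformalDim m
  have h0 : ∑ p : Q.Coord, ∑ q : Q.Coord, Q.dimTerm m p q = 0 :=
    Finset.sum_eq_zero fun p _ => Finset.sum_eq_zero fun q _ => by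
      rw [dimTerm, h.2 p q, sub_self, abs_zero, mul_zero]
  omega

/-! ### The coefficients of the monopole formula -/

open Classical in
-- Everything used later about a single contribution. Non-negativity excludes cancellations, the
-- vanishing linear coefficient keeps the trivial charge from contributing at order t, and the
-- growth, which comes from w = 1 alone, makes the series non-constant.
lemma exists_monopoleTerm_eq (Q : UnitaryQuiver V) (m : Q.Charge) :
    ∃ f : PowerSeries ℚ, f.IsNonneg ∧
      PowerSeries.coeff 0 f = ((Finset.univ : Finset Q.Weyl).filter
        (fun w => ∀ p, m (w.perm p) = m p)).card ∧
      PowerSeries.coeff 1 f = 0 ∧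
      (2 ≤ Fintype.card Q.Coord → ∀ k : ℕ, (k + 1 : ℚ) ≤ PowerSeries.coeff (2 * k) f) ∧
      Q.monopoleTerm m =
        HahnSeries.single (Q.conformalDim m) 1 * HahnSeries.ofPowerSeries ℤ ℚ f := by
  choose F hF0 hF1 hF2 hF using fun w : Q.Weyl => exists_powerSeries_eq_inv_det w.perm
  refine ⟨∑ w ∈ (Finset.univ : Finset Q.Weyl).filter (fun w => ∀ p, m (w.perm p) = m p), F w,
    fun n => ?_, ?_, ?_, fun h2 k => ?_, ?_⟩
  · rw [map_sum]; exact Finset.sum_nonneg fun w _ => hF0 w n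
  · rw [map_sum, Finset.sum_congr rfl fun w _ => hF1 w]; simp
  · rw [map_sum, Finset.sum_eq_zero fun w _ => hF2 w]
  · rw [map_sum]
    have hone : (1 : Q.Weyl).perm = 1 := Equiv.sigmaCongrRight_refl
    refine le_trans ?_ (Finset.single_le_sum (f := fun w => PowerSeries.coeff (2 * k) (F w))
      (fun w _ => hF0 w _) (a := 1) ?_)
    · have : F 1 = PowerSeries.evenGeom ^ Fintype.card Q.Coord := by
        apply HahnSeries.ofPowerSeries_injective (Γ := ℤ)
        rw [hF 1, inv_det_one, hone]
      rw [this]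
      exact PowerSeries.le_coeff_evenGeom_pow h2 k
    · simp [hone]
  · rw [monopoleTerm, map_sum, Finset.mul_sum]
    exact Finset.sum_congr rfl fun w _ => by rw [hF w]

lemma coeff_single_mul_ofPowerSeries (D n : ℤ) (f : PowerSeries ℚ) :
    (HahnSeries.single D 1 * HahnSeries.ofPowerSeries ℤ ℚ f : LaurentSeries ℚ).coeff n =
      if D ≤ n then PowerSeries.coeff (n - D).toNat f else 0 := by
  have := HahnSeries.coeff_single_mul_add (r := (1 : ℚ)) (x := HahnSeries.ofPowerSeries ℤ ℚ f)
    (a := n - D) (b := D)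
  rw [sub_add_cancel, one_mul] at this
  rw [this]
  split_ifs with h
  · obtain ⟨k, hk⟩ := Int.eq_ofNat_of_zero_le (sub_nonneg.2 h)
    rw [hk, Int.toNat_natCast]
    exact HahnSeries.ofPowerSeries_apply_coeff _ _
  · rw [HahnSeries.ofPowerSeries_apply, HahnSeries.embDomain_of_notMem_range]
    rintro ⟨k, hk⟩
    simp at hk
    omega

lemma monopoleTerm_coeff_nonneg (Q : UnitaryQuiver V) (m : Q.Charge) (n : ℤ) :
    0 ≤ (Q.monopoleTerm m).coeff n := by
  obtain ⟨f, h0, -, -, -, h⟩ := Q.exists_monopoleTerm_eq m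
  rw [h, coeff_single_mul_ofPowerSeries]
  split_ifs
  · exact h0 _
  · exact le_rfl

lemma monopoleTerm_coeff_of_lt (Q : UnitaryQuiver V) (m : Q.Charge) {n : ℤ}
    (hn : n < Q.conformalDim m) : (Q.monopoleTerm m).coeff n = 0 := by
  obtain ⟨f, -, -, -, -, h⟩ := Q.exists_monopoleTerm_eq m
  rw [h, coeff_single_mul_ofPowerSeries, if_neg (not_le.2 hn)]

open Classical in
lemma monopoleTerm_coeff_dim (Q : UnitaryQuiver V) (m : Q.Charge) :
    (Q.monopoleTerm m).coeff (Q.conformalDim m) = ((Finset.univ : Finset Q.Weyl).filter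
        (fun w => ∀ p, m (w.perm p) = m p)).card := by
  obtain ⟨f, -, h0, -, -, h⟩ := Q.exists_monopoleTerm_eq m
  rw [h, coeff_single_mul_ofPowerSeries, if_pos le_rfl, sub_self, Int.toNat_zero, h0]

lemma monopoleTerm_coeff_dim_pos (Q : UnitaryQuiver V) (m : Q.Charge) :
    0 < (Q.monopoleTerm m).coeff (Q.conformalDim m) := by
  classical
  rw [monopoleTerm_coeff_dim, Nat.cast_pos, Finset.card_pos]
  have hone : (1 : Q.Weyl).perm = 1 := Equiv.sigmaCongrRight_refl
  exact ⟨1, by simp [hone]⟩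

open Classical in
lemma monopoleTerm_coeff_dim_of_isConst (Q : UnitaryQuiver V) {m : Q.Charge} (hm : Q.IsConst m) :
    (Q.monopoleTerm m).coeff 0 = Fintype.card Q.Weyl := by
  have := Q.monopoleTerm_coeff_dim m
  rw [conformalDim_of_isConst hm] at this
  rw [this, Finset.filter_true_of_mem, Finset.card_univ]
  intro w _ p
  exact hm.1 _ _ rfl

lemma monopoleTerm_coeff_dim_add_one (Q : UnitaryQuiver V) (m : Q.Charge) :
    (Q.monopoleTerm m).coeff (Q.conformalDim m + 1) = 0 := by
  obtain ⟨f, -, -, h1, -, h⟩ := Q.exists_monopoleTerm_eq m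
  rw [h, coeff_single_mul_ofPowerSeries, if_pos (by omega)]
  simpa using h1

lemma le_monopoleTerm_coeff (Q : UnitaryQuiver V) {m : Q.Charge} (hm : Q.IsConst m)
    (h2 : 2 ≤ Fintype.card Q.Coord) (k : ℕ) :
    (k + 1 : ℚ) ≤ (Q.monopoleTerm m).coeff (2 * k : ℕ) := by
  obtain ⟨f, -, -, -, hk, h⟩ := Q.exists_monopoleTerm_eq m
  rw [h, coeff_single_mul_ofPowerSeries, conformalDim_of_isConst hm, if_pos (by omega)]
  have : ((2 * k : ℕ) - 0 : ℤ).toNat = 2 * k := by omega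
  rw [this]
  exact hk h2 k

lemma natCast_mul_coeff {N : ℕ} (hN : N ≠ 0) {H R : LaurentSeries ℚ}
    (h : H = (1 - tVar ^ 2) / (N : LaurentSeries ℚ) * R) (n : ℤ) :
    N * H.coeff n = R.coeff n - R.coeff (n - 2) := by
  have hc : (N : LaurentSeries ℚ) ≠ 0 := by
    rw [← map_natCast (HahnSeries.C (Γ := ℤ) (R := ℚ))]
    intro h0
    have := congrArg (fun x : LaurentSeries ℚ => x.coeff 0) h0
    simp only [HahnSeries.C_apply, HahnSeries.coeff_single_same, HahnSeries.coeff_zero] at this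
    exact hN (by exact_mod_cast this)
  have h1 : N • H = R - HahnSeries.single (2 : ℤ) (1 : ℚ) * R := by
    rw [nsmul_eq_mul, h, ← mul_assoc, mul_div_cancel₀ _ hc, tVar, HahnSeries.single_pow]
    simp [sub_mul]
  have h2 := congrArg (fun x : LaurentSeries ℚ => x.coeff n) h1
  simp only [HahnSeries.coeff_nsmul, HahnSeries.coeff_sub, HahnSeries.coeff_single_mul,
    one_mul] at h2
  rw [← h2, Pi.smul_apply, nsmul_eq_mul]

open Classical in
/-- The coefficients of a Hilbert series in terms of those of the sum over charges. -/
lemma card_mul_coeff {Q : UnitaryQuiver V} {H R : LaurentSeries ℚ}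
    (h : H = (1 - tVar ^ 2) / (Fintype.card Q.Weyl : LaurentSeries ℚ) * R) (n : ℤ) :
    Fintype.card Q.Weyl * H.coeff n = R.coeff n - R.coeff (n - 2) :=
  natCast_mul_coeff Fintype.card_ne_zero h n

end

end UnitaryQuiver


namespace UnitaryQuiver

variable {V : Type*} [Fintype V]

/-! ### Convergence -/

/-- Along a sequence of charges on which the positive and negative parts of all the arguments of
the absolute values increase, `Δ` is additive. -/
lemma conformalDim_add_of_le {Q : UnitaryQuiver V} {m m' : Q.Charge}
    (h : ∀ p q : Q.Coord,
      (Q.A p.1 q.1 * m p - Q.A q.1 p.1 * m q).toNat ≤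
        (Q.A p.1 q.1 * m' p - Q.A q.1 p.1 * m' q).toNat ∧
      (-(Q.A p.1 q.1 * m p - Q.A q.1 p.1 * m q)).toNat ≤
        (-(Q.A p.1 q.1 * m' p - Q.A q.1 p.1 * m' q)).toNat) :
    Q.conformalDim m' = Q.conformalDim m + Q.conformalDim (m' - m) := by
  have h1 := Q.two_mul_conformalDim m
  have h2 := Q.two_mul_conformalDim m'
  have h3 := Q.two_mul_conformalDim (m' - m)
  have : ∀ p q, Q.dimTerm m' p q = Q.dimTerm m p q + Q.dimTerm (m' - m) p q := by
    intro p q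
    obtain ⟨ha, hb⟩ := h p q
    have e : Q.A p.1 q.1 * (m' - m) p - Q.A q.1 p.1 * (m' - m) q =
        (Q.A p.1 q.1 * m' p - Q.A q.1 p.1 * m' q) - (Q.A p.1 q.1 * m p - Q.A q.1 p.1 * m q) := by
      simp; ring
    rw [dimTerm, dimTerm, dimTerm, e, ← mul_add]
    congr 1
    generalize Q.A p.1 q.1 * m' p - Q.A q.1 p.1 * m' q = a at *
    generalize Q.A p.1 q.1 * m p - Q.A q.1 p.1 * m q = b at *
    rw [Int.abs_eq_natAbs, Int.abs_eq_natAbs, Int.abs_eq_natAbs]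
    omega
  simp only [this, Finset.sum_add_distrib] at h2
  linarith

/-- Finitely many classes of charges lie below any bound as soon as `Δ` is positive. -/
lemma finite_conformalDim_le {Q : UnitaryQuiver V} (hc : Q.graph.Connected) {u : V → ℕ}
    (hu : Q.IsShift u) (hpos : ∀ m : Q.Charge, Q.IsConst m ∨ 1 ≤ Q.conformalDim m) (N : ℤ) :
    {c : Q.Charge ⧸ AddSubgroup.zmultiples (Q.shiftCharge u) |
      Q.conformalDim (Quotient.out c) ≤ N}.Finite := by
  by_contra hinf
  let F := (Set.not_finite.1 hinf).natEmbedding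
  let f : ℕ → Q.Charge := fun k => Quotient.out (F k).1
  have hf : ∀ k, Q.conformalDim (f k) ≤ N := fun k => (F k).2
  have hne : ∀ k l, k ≠ l → ¬ Q.IsConst (f l - f k) := by
    intro k l hkl hcst
    rw [← mem_zmultiples_iff hc hu] at hcst
    apply hkl
    apply F.injective
    apply Subtype.ext
    have h1 : (QuotientAddGroup.mk (f k) : Q.Charge ⧸ AddSubgroup.zmultiples (Q.shiftCharge u)) =
        QuotientAddGroup.mk (f l) := by
      rw [QuotientAddGroup.eq]
      rwa [neg_add_eq_sub]
    simpa [f] using h1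
  let g : ℕ → Q.Coord → Q.Coord → ℕ × ℕ := fun k p q =>
    ((Q.A p.1 q.1 * f k p - Q.A q.1 p.1 * f k q).toNat,
      (-(Q.A p.1 q.1 * f k p - Q.A q.1 p.1 * f k q)).toNat)
  -- Dickson's lemma: tuples of natural numbers are well-quasi-ordered, so along some subsequence
  -- all positive and negative parts increase. There Δ is additive, and every increment is a
  -- non-constant charge, so Δ grows by at least 1 at each step and cannot stay below N.
  obtain ⟨φ, hφ⟩ := (wellQuasiOrdered_le
    (α := Q.Coord → Q.Coord → ℕ × ℕ)).exists_monotone_subseq g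
  have hstep : ∀ k, Q.conformalDim (f (φ k)) + 1 ≤ Q.conformalDim (f (φ (k + 1))) := by
    intro k
    have hle := hφ k (k + 1) (Nat.le_succ k)
    rw [conformalDim_add_of_le (m := f (φ k)) (m' := f (φ (k + 1)))
      fun p q => ⟨(hle p q).1, (hle p q).2⟩]
    have := (hpos (f (φ (k + 1)) - f (φ k))).resolve_left
      (hne _ _ fun e => by have := φ.injective e; omega)
    omega
  have hgrow : ∀ k : ℕ, Q.conformalDim (f (φ 0)) + k ≤ Q.conformalDim (f (φ k)) := by
    intro k
    induction k with
    | zero => simp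
    | succ k ih => have := hstep k; push_cast; omega
  have := hgrow (N - Q.conformalDim (f (φ 0)) + 1).toNat
  have h2 := hf (φ (N - Q.conformalDim (f (φ 0)) + 1).toNat)
  omega

/-! ### Characterization of the good quivers -/

/-- The multiples k m of a non-constant charge lie in distinct classes, and the class of k m has a
positive coefficient at order k Δ(m). If Δ(m) < 0 the orders are unbounded below; if Δ(m) = 0
infinitely many classes contribute at order 0. Both contradict summability. -/
lemma one_le_conformalDim_of_summable {Q : UnitaryQuiver V} (hc : Q.graph.Connected) {u : V → ℕ}
    (hu : Q.IsShift u)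
    (s : HahnSeries.SummableFamily ℤ ℚ (Q.Charge ⧸ AddSubgroup.zmultiples (Q.shiftCharge u)))
    (hs : ∀ c, s c = Q.monopoleTerm (Quotient.out c)) (m : Q.Charge) :
    Q.IsConst m ∨ 1 ≤ Q.conformalDim m := by
  by_contra! hm
  let c : ℕ → Q.Charge ⧸ AddSubgroup.zmultiples (Q.shiftCharge u) := fun k =>
    QuotientAddGroup.mk (k • m)
  have hinj : Function.Injective c := by
    intro k l hkl
    have h1 := QuotientAddGroup.eq.1 hkl
    rw [mem_zmultiples_iff hc hu] at h1
    by_contra hne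
    apply hm.1
    refine IsConst.of_zsmul (k := (l : ℤ) - k) (by omega) ?_
    convert h1 using 1
    rw [sub_smul, natCast_zsmul, natCast_zsmul]
    abel
  have hco : ∀ k : ℕ, (s (c k)).coeff (k * Q.conformalDim m) ≠ 0 := by
    intro k
    rw [hs, ← conformalDim_nsmul, ← conformalDim_out hu]
    exact (monopoleTerm_coeff_dim_pos Q _).ne'
  rcases (show Q.conformalDim m ≤ 0 by omega).lt_or_eq with hlt | h0
  · obtain ⟨g, hg⟩ := s.isPWO_iUnion_support.exists_monotone_subseq
      (f := fun k : ℕ => (k : ℤ) * Q.conformalDim m) fun k => Set.mem_iUnion.2 ⟨c k, hco k⟩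
    have h1 := hg (Nat.zero_le 1)
    have h2 : g 0 < g 1 := g.strictMono Nat.zero_lt_one
    simp only [Function.comp_apply] at h1
    have h2' : (g 0 : ℤ) < g 1 := by exact_mod_cast h2
    nlinarith
  · have hfin := s.finite_co_support 0
    refine Set.infinite_of_injective_forall_mem hinj (fun k => ?_) hfin
    have := hco k
    rw [h0, mul_zero] at this
    exact this

open Classical in
-- Nothing occurs at order -1, so up to the factor |W| the coefficient of H at order t is the sum of
-- the order-t coefficients of all classes. These are non-negative, and a class with Δ = 1 has a
-- positive one.
lemma dimBound_of_hasHilbertSeries {Q : UnitaryQuiver V} (hc : Q.graph.Connected)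
    {H : LaurentSeries ℚ} (hH : Q.HasHilbertSeries H) (h1 : H.coeff 1 = 0) : Q.DimBound := by
  obtain ⟨u, hu, s, hs, hH⟩ := hH
  have hpos := one_le_conformalDim_of_summable hc hu s hs
  have hnn : ∀ m : Q.Charge, 0 ≤ Q.conformalDim m := fun m => by
    rcases hpos m with h | h
    · rw [conformalDim_of_isConst h]
    · omega
  have hcoeff := card_mul_coeff hH 1
  rw [h1, mul_zero] at hcoeff
  have hneg : s.hsum.coeff (1 - 2) = 0 := by
    rw [HahnSeries.SummableFamily.coeff_hsum]
    refine finsum_eq_zero_of_forall_eq_zero fun c => ?_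
    rw [hs]
    exact monopoleTerm_coeff_of_lt _ _ (lt_of_lt_of_le (by norm_num) (hnn _))
  rw [hneg, sub_zero, HahnSeries.SummableFamily.coeff_hsum] at hcoeff
  intro m
  rcases hpos m with h | h
  · exact Or.inl h
  · refine Or.inr ?_
    by_contra! hlt
    have hm1 : Q.conformalDim m = 1 := by omega
    have := single_le_finsum (QuotientAddGroup.mk m) (s.finite_co_support 1) fun c => by
      rw [hs]; exact monopoleTerm_coeff_nonneg _ _ _
    rw [← hcoeff, hs] at this
    have h2 := monopoleTerm_coeff_dim_pos Q (Quotient.out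
      (QuotientAddGroup.mk m : Q.Charge ⧸ AddSubgroup.zmultiples (Q.shiftCharge u)))
    rw [conformalDim_out hu, hm1] at h2
    exact absurd this (not_le.2 h2)

open Classical in
-- With a single coordinate both W and Λ / 𝐋ℤ are trivial, and the series is (1 - t²) / (1 - t²) =
-- 1.
lemma two_le_card_coord_of_hasHilbertSeries {Q : UnitaryQuiver V} (hc : Q.graph.Connected)
    {H : LaurentSeries ℚ} (hH : Q.HasHilbertSeries H) (hne : ¬ ∃ a : ℚ, H = HahnSeries.C a) :
    2 ≤ Fintype.card Q.Coord := by
  by_contra! hlt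
  apply hne
  obtain ⟨u, hu, s, hs, hH⟩ := hH
  have hsub : Subsingleton Q.Coord := Fintype.card_le_one_iff_subsingleton.1 (by omega)
  obtain ⟨x0⟩ := hc.nonempty
  have hcard : Fintype.card Q.Coord = 1 :=
    le_antisymm (by omega) (Fintype.card_pos_iff.2 ⟨⟨x0, ⟨0, Q.weight_pos x0⟩⟩⟩)
  have hcst : ∀ m : Q.Charge, Q.IsConst m := fun m =>
    ⟨fun p q _ => by rw [Subsingleton.elim p q], fun p q => by rw [Subsingleton.elim p q]⟩
  have hW : Subsingleton Q.Weyl := by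
    refine ⟨fun w w' => funext fun x => Equiv.ext fun i => ?_⟩
    have := Subsingleton.elim (⟨x, w x i⟩ : Q.Coord) ⟨x, w' x i⟩
    simpa using this
  have hWcard : Fintype.card Q.Weyl = 1 := Fintype.card_eq_one_iff.2 ⟨1, fun w =>
    Subsingleton.elim _ _⟩
  have hsubq : ∀ c : Q.Charge ⧸ AddSubgroup.zmultiples (Q.shiftCharge u), c = 0 := by
    intro c
    induction c using QuotientAddGroup.induction_on with
    | H m => exact (QuotientAddGroup.eq_zero_iff m).2 ((mem_zmultiples_iff hc hu m).2 (hcst m))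
  have hsum : s.hsum = s 0 := by
    ext n
    rw [HahnSeries.SummableFamily.coeff_hsum, finsum_eq_single _ 0]
    exact fun c hc0 => absurd (hsubq c) hc0
  have hterm : s 0 = (1 - tVar ^ 2)⁻¹ := by
    have hone : (1 : Q.Weyl).perm = 1 := Equiv.sigmaCongrRight_refl
    have huniv : (Finset.univ : Finset Q.Weyl).filter (fun w => ∀ p,
        (Quotient.out (0 : Q.Charge ⧸ AddSubgroup.zmultiples (Q.shiftCharge u))) (w.perm p) =
        (Quotient.out (0 : Q.Charge ⧸ AddSubgroup.zmultiples (Q.shiftCharge u))) p) = {1} := by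
      ext w
      simp [Subsingleton.elim w 1, hone]
    rw [hs, monopoleTerm, huniv, Finset.sum_singleton, conformalDim_of_isConst (hcst _), hone,
      ← inv_det_one, hcard, pow_one]
    have h : HahnSeries.ofPowerSeries ℤ ℚ (1 - PowerSeries.X ^ 2) = 1 - tVar ^ 2 := by
      simp [tVar]
    have h2 : (HahnSeries.single (0 : ℤ) (1 : ℚ)) = (1 : LaurentSeries ℚ) := rfl
    rw [h2, one_mul]
    refine eq_inv_of_mul_eq_one_left ?_
    rw [← h, ← map_mul, PowerSeries.evenGeom_mul, map_one]
  have hne0 : (1 - tVar ^ 2 : LaurentSeries ℚ) ≠ 0 := by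
    intro h0
    have := congrArg (fun x : LaurentSeries ℚ => x.coeff 0) h0
    simp [tVar, HahnSeries.single_pow] at this
  refine ⟨1, ?_⟩
  rw [hH, hsum, hterm, hWcard, Nat.cast_one, div_one, mul_inv_cancel₀ hne0, map_one]

open Classical in
-- Convergence is `finite_conformalDim_le`. Below order 2 only the trivial class contributes, and
-- its coefficient at order t vanishes.
lemma isGoodConnected_of_dimBound {Q : UnitaryQuiver V} (hc : Q.graph.Connected)
    (h2 : 2 ≤ Fintype.card Q.Coord) (hD : Q.DimBound) : Q.IsGoodConnected := by
  have := hc.nonempty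
  obtain ⟨u, hu⟩ := Q.exists_isShift
  have hnn : ∀ m : Q.Charge, 0 ≤ Q.conformalDim m := fun m => by
    rcases hD m with h | h
    · rw [conformalDim_of_isConst h]
    · omega
  let s : HahnSeries.SummableFamily ℤ ℚ
      (Q.Charge ⧸ AddSubgroup.zmultiples (Q.shiftCharge u)) :=
    { toFun := fun c => Q.monopoleTerm (Quotient.out c)
      isPWO_iUnion_support' := by
        refine Set.IsWF.isPWO (BddBelow.isWF ⟨0, ?_⟩)
        rintro n hn
        obtain ⟨c, hc⟩ := Set.mem_iUnion.1 hn
        by_contra! hlt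
        exact hc (monopoleTerm_coeff_of_lt _ _ (hlt.trans_le (hnn _)))
      finite_co_support' := fun n => by
        refine (finite_conformalDim_le hc hu (fun m => (hD m).imp_right (by omega)) n).subset ?_
        intro c hc
        by_contra hlt
        exact hc (monopoleTerm_coeff_of_lt _ _ (not_le.1 hlt)) }
  have hs : ∀ c, s c = Q.monopoleTerm (Quotient.out c) := fun c => rfl
  have hzero : ∀ c : Q.Charge ⧸ AddSubgroup.zmultiples (Q.shiftCharge u), c ≠ 0 →
      2 ≤ Q.conformalDim (Quotient.out c) := by
    intro c hc0
    refine (hD _).resolve_left fun h => hc0 ?_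
    rw [← mem_zmultiples_iff hc hu, ← QuotientAddGroup.eq_zero_iff] at h
    rw [← h]
    exact (Quotient.out_eq c).symm
  have hcst : Q.IsConst (Quotient.out
      (0 : Q.Charge ⧸ AddSubgroup.zmultiples (Q.shiftCharge u))) := by
    rw [← mem_zmultiples_iff hc hu, ← QuotientAddGroup.eq_zero_iff]
    exact Quotient.out_eq _
  have hlow : ∀ n : ℤ, n < 2 → s.hsum.coeff n = (s 0).coeff n := by
    intro n hn
    rw [HahnSeries.SummableFamily.coeff_hsum, finsum_eq_single _ 0]
    intro c hc0
    rw [hs]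
    exact monopoleTerm_coeff_of_lt _ _ (hn.trans_le (hzero c hc0))
  have hm1 : s.hsum.coeff (-1) = 0 := by
    rw [hlow _ (by norm_num), hs]
    exact monopoleTerm_coeff_of_lt _ _ (lt_of_lt_of_le (by norm_num) (hnn _))
  have h0 : s.hsum.coeff 0 = Fintype.card Q.Weyl := by
    rw [hlow _ (by norm_num), hs, monopoleTerm_coeff_dim_of_isConst _ hcst]
  have h1 : s.hsum.coeff 1 = 0 := by
    rw [hlow _ (by norm_num), hs]
    have := monopoleTerm_coeff_dim_add_one Q (Quotient.out
      (0 : Q.Charge ⧸ AddSubgroup.zmultiples (Q.shiftCharge u)))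
    rwa [conformalDim_of_isConst hcst, zero_add] at this
  have hW : (Fintype.card Q.Weyl : ℚ) ≠ 0 := by exact_mod_cast Fintype.card_ne_zero
  refine ⟨hc, Or.inl ⟨_, ⟨u, hu, s, hs, rfl⟩, ?_, ?_⟩⟩
  · rintro ⟨a, ha⟩
    -- If H were constant, the factor 1 - t² would make all coefficients of the sum at even orders
    -- equal to the one at order 0, namely |W|. But the trivial class alone contributes at least k +
    -- 1 at order 2k; k = |W| gives the contradiction.
    have hconst : ∀ k : ℕ, s.hsum.coeff (2 * k : ℕ) = Fintype.card Q.Weyl := by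
      intro k
      induction k with
      | zero => simpa using h0
      | succ k ih =>
        have := card_mul_coeff (Q := Q) rfl (R := s.hsum) ((2 * (k + 1) : ℕ) : ℤ)
        rw [ha, HahnSeries.C_apply, HahnSeries.coeff_single_of_ne (by push_cast; omega),
          mul_zero] at this
        rw [← ih]
        have e : ((2 * (k + 1) : ℕ) : ℤ) - 2 = (2 * k : ℕ) := by push_cast; ring
        rw [e] at this
        linarith
    have hle := single_le_finsum 0 (s.finite_co_support (2 * Fintype.card Q.Weyl : ℕ)) fun c => by
      rw [hs]; exact monopoleTerm_coeff_nonneg _ _ _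
    rw [← HahnSeries.SummableFamily.coeff_hsum, hconst, hs] at hle
    have := (le_monopoleTerm_coeff Q hcst h2 (Fintype.card Q.Weyl)).trans hle
    linarith
  · have := card_mul_coeff (Q := Q) rfl (R := s.hsum) 1
    rw [h1, show (1 : ℤ) - 2 = -1 by norm_num, hm1, sub_zero] at this
    exact (mul_eq_zero.1 this).resolve_left hW

end UnitaryQuiver


/-! ### The energy distance of two finite families of integers -/

section Energy

variable {ι κ : Type*} [Fintype ι] [Fintype κ]

/-- The distance of two integers counts the thresholds that separate them. Differences of indicators
are squared so that sums over families become quadratic, threshold by threshold. -/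
lemma Int.abs_sub_eq_sum_sq {lo hi x y : ℤ} (hx : lo ≤ x) (hx' : x ≤ hi) (hy : lo ≤ y)
    (hy' : y ≤ hi) : |x - y| = ∑ s ∈ Finset.Ico lo hi,
      ((if s < x then (1 : ℤ) else 0) - if s < y then 1 else 0) ^ 2 := by
  have hsum : ∀ z, lo ≤ z → z ≤ hi →
      ∑ s ∈ Finset.Ico lo hi, (if s < z then (1 : ℤ) else 0) = z - lo := by
    intro z h1 h2
    rw [Finset.sum_ite, Finset.sum_const_zero, add_zero, Finset.sum_const, nsmul_eq_mul, mul_one]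
    have : (Finset.Ico lo hi).filter (fun s => s < z) = Finset.Ico lo z := by
      ext s; simp only [Finset.mem_filter, Finset.mem_Ico]; omega
    rw [this, Int.card_Ico]
    omega
  rcases le_total x y with h | h
  · rw [abs_of_nonpos (by omega), Finset.sum_congr rfl (g := fun s =>
      (if s < y then (1 : ℤ) else 0) - if s < x then 1 else 0)]
    · rw [Finset.sum_sub_distrib, hsum _ hx hx', hsum _ hy hy']; ring
    · intro s _
      split_ifs <;> omega
  · rw [abs_of_nonneg (by omega), Finset.sum_congr rfl (g := fun s =>
      (if s < x then (1 : ℤ) else 0) - if s < y then 1 else 0)]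
    · rw [Finset.sum_sub_distrib, hsum _ hx hx', hsum _ hy hy']; ring
    · intro s _
      split_ifs <;> omega

lemma sum_sum_sub_sq (α : ι → ℤ) (β : κ → ℤ) : ∑ i, ∑ j, (α i - β j) ^ 2 =
    Fintype.card κ * ∑ i, α i ^ 2 + Fintype.card ι * ∑ j, β j ^ 2 - 2 * (∑ i, α i) * ∑ j, β j := by
  have : ∀ i j, (α i - β j) ^ 2 = α i ^ 2 + β j ^ 2 - 2 * (α i * β j) := fun i j => by ring
  simp only [this, Finset.sum_sub_distrib, Finset.sum_add_distrib, ← Finset.mul_sum,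
    Finset.sum_const, nsmul_eq_mul, Finset.card_univ, ← Finset.sum_mul]
  ring

/-- The number of elements of a family above a threshold. -/
def countAbove (a : ι → ℤ) (s : ℤ) : ℤ := ∑ i, if s < a i then 1 else 0

/-- At a fixed threshold, with indicators α, β of families of sizes n and k, expanding squares gives
2nk ∑∑ (αᵢ-βⱼ)² - k² ∑∑ (αᵢ-αⱼ)² - n² ∑∑ (βᵢ-βⱼ)² = 2 (k ∑ α - n ∑ β)². Summing over the thresholds
gives the identity; its defect is an energy distance of the two empirical distributions. -/
lemma exists_energy_identity (a : ι → ℤ) (b : κ → ℤ) : ∃ lo hi : ℤ,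
    (∀ i, lo ≤ a i ∧ a i ≤ hi) ∧ (∀ j, lo ≤ b j ∧ b j ≤ hi) ∧
    2 * (Fintype.card ι * Fintype.card κ) * ∑ i, ∑ j, |a i - b j| =
      (Fintype.card κ) ^ 2 * ∑ i, ∑ j, |a i - a j| + (Fintype.card ι) ^ 2 * ∑ i, ∑ j, |b i - b j| +
        2 * ∑ s ∈ Finset.Ico lo hi,
          (Fintype.card κ * countAbove a s - Fintype.card ι * countAbove b s) ^ 2 := by
  set M : ℤ := ∑ i, |a i| + ∑ j, |b j| with hM
  have ha : ∀ i, -M ≤ a i ∧ a i ≤ M := fun i => by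
    rw [← abs_le]
    have : |a i| ≤ ∑ i, |a i| := Finset.single_le_sum (f := fun i => |a i|) (fun i _ => abs_nonneg _)
      (Finset.mem_univ i)
    have h2 : 0 ≤ ∑ j, |b j| := Finset.sum_nonneg fun j _ => abs_nonneg _
    omega
  have hb : ∀ i, -M ≤ b i ∧ b i ≤ M := fun i => by
    rw [← abs_le]
    have : |b i| ≤ ∑ i, |b i| := Finset.single_le_sum (f := fun i => |b i|) (fun i _ => abs_nonneg _)
      (Finset.mem_univ i)
    have h2 : 0 ≤ ∑ j, |a j| := Finset.sum_nonneg fun j _ => abs_nonneg _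
    omega
  refine ⟨-M, M, ha, hb, ?_⟩
  have hab : ∀ i j, |a i - b j| = _ := fun i j =>
    Int.abs_sub_eq_sum_sq (ha i).1 (ha i).2 (hb j).1 (hb j).2
  have haa : ∀ i j, |a i - a j| = _ := fun i j =>
    Int.abs_sub_eq_sum_sq (ha i).1 (ha i).2 (ha j).1 (ha j).2
  have hbb : ∀ i j, |b i - b j| = _ := fun i j =>
    Int.abs_sub_eq_sum_sq (hb i).1 (hb i).2 (hb j).1 (hb j).2
  have h1 : ∑ i, ∑ j, |a i - b j| = ∑ s ∈ Finset.Ico (-M) M, ∑ i, ∑ j,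
      ((if s < a i then (1 : ℤ) else 0) - if s < b j then 1 else 0) ^ 2 := by
    simp only [hab]
    rw [Finset.sum_congr rfl fun i _ => Finset.sum_comm, Finset.sum_comm]
  have h2 : ∑ i, ∑ j, |a i - a j| = ∑ s ∈ Finset.Ico (-M) M, ∑ i, ∑ j,
      ((if s < a i then (1 : ℤ) else 0) - if s < a j then 1 else 0) ^ 2 := by
    simp only [haa]
    rw [Finset.sum_congr rfl fun i _ => Finset.sum_comm, Finset.sum_comm]
  have h3 : ∑ i, ∑ j, |b i - b j| = ∑ s ∈ Finset.Ico (-M) M, ∑ i, ∑ j,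
      ((if s < b i then (1 : ℤ) else 0) - if s < b j then 1 else 0) ^ 2 := by
    simp only [hbb]
    rw [Finset.sum_congr rfl fun i _ => Finset.sum_comm, Finset.sum_comm]
  rw [h1, h2, h3, Finset.mul_sum, Finset.mul_sum, Finset.mul_sum, Finset.mul_sum,
    ← Finset.sum_add_distrib, ← Finset.sum_add_distrib]
  refine Finset.sum_congr rfl fun s _ => ?_
  rw [sum_sum_sub_sq, sum_sum_sub_sq, sum_sum_sub_sq, countAbove, countAbove]
  ring

lemma energy_le (a : ι → ℤ) (b : κ → ℤ) :
    (Fintype.card κ) ^ 2 * ∑ i, ∑ j, |a i - a j| + (Fintype.card ι) ^ 2 * ∑ i, ∑ j, |b i - b j| ≤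
      2 * (Fintype.card ι * Fintype.card κ) * ∑ i, ∑ j, |a i - b j| := by
  obtain ⟨lo, hi, -, -, h⟩ := exists_energy_identity a b
  rw [h]
  have : 0 ≤ ∑ s ∈ Finset.Ico lo hi,
      (Fintype.card κ * countAbove a s - Fintype.card ι * countAbove b s) ^ 2 :=
    Finset.sum_nonneg fun _ _ => sq_nonneg _
  linarith

/-- Equality makes every square vanish, so both families have the same proportion of elements above
every threshold. If one is concentrated at c, so is the other. -/
lemma eq_const_of_energy_le (a : ι → ℤ) (b : κ → ℤ) [Nonempty ι] {c : ℤ} (ha : ∀ i, a i = c)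
    (h : 2 * (Fintype.card ι * Fintype.card κ) * ∑ i, ∑ j, |a i - b j| ≤
      (Fintype.card κ) ^ 2 * ∑ i, ∑ j, |a i - a j| +
        (Fintype.card ι) ^ 2 * ∑ i, ∑ j, |b i - b j|) (j : κ) : b j = c := by
  obtain ⟨lo, hi, hloa, hlob, he⟩ := exists_energy_identity a b
  rw [he] at h
  have hnn : ∀ s ∈ Finset.Ico lo hi,
      0 ≤ (Fintype.card κ * countAbove a s - Fintype.card ι * countAbove b s) ^ 2 :=
    fun _ _ => sq_nonneg _
  have h0 : ∑ s ∈ Finset.Ico lo hi,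
      (Fintype.card κ * countAbove a s - Fintype.card ι * countAbove b s) ^ 2 = 0 :=
    le_antisymm (by linarith) (Finset.sum_nonneg hnn)
  have hs : ∀ s, lo ≤ s → s < hi →
      (Fintype.card κ : ℤ) * countAbove a s = Fintype.card ι * countAbove b s := by
    intro s h1 h2
    have := (Finset.sum_eq_zero_iff_of_nonneg hnn).1 h0 s (Finset.mem_Ico.2 ⟨h1, h2⟩)
    exact sub_eq_zero.1 (pow_eq_zero_iff (two_ne_zero)|>.1 this)
  have hcard : (0 : ℤ) < Fintype.card ι := by exact_mod_cast Fintype.card_pos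
  obtain ⟨i0⟩ := ‹Nonempty ι›
  have hc := hloa i0
  rw [ha] at hc
  rcases lt_trichotomy (b j) c with hlt | heq | hgt
  · have h1 := hs (b j) (hlob j).1 (by omega)
    have h2 : countAbove a (b j) = Fintype.card ι := by simp [countAbove, ha, hlt]
    rw [h2, mul_comm] at h1
    have h3 := mul_left_cancel₀ hcard.ne' h1
    have h4 : countAbove b (b j) < ∑ _ : κ, (1 : ℤ) :=
      Finset.sum_lt_sum (fun i _ => by split_ifs <;> norm_num) ⟨j, Finset.mem_univ _, by simp⟩
    simp at h4
    omega
  · exact heq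
  · have h1 := hs c hc.1 (by have := (hlob j).2; omega)
    have h2 : countAbove a c = 0 := by simp [countAbove, ha]
    rw [h2, mul_zero, eq_comm, mul_eq_zero] at h1
    have h3 : countAbove b c = 0 := h1.resolve_left hcard.ne'
    have h4 := (Finset.sum_eq_zero_iff_of_nonneg (fun i _ => by split_ifs <;> norm_num)).1 h3 j
      (Finset.mem_univ _)
    rw [if_pos hgt] at h4
    exact absurd h4 one_ne_zero

end Energy

lemma two_dvd_sum_sum_of_symm {ι : Type*} [Fintype ι] (e : ι → ι → ℤ)
    (hs : ∀ p q, e p q = e q p) (hd : ∀ p, 2 ∣ e p p) : 2 ∣ ∑ p, ∑ q, e p q := by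
  classical
  rw [← Fintype.sum_prod_type' (f := e)]
  rw [← Nat.cast_ofNat (R := ℤ) (n := 2), ← ZMod.intCast_zmod_eq_zero_iff_dvd _ 2, Int.cast_sum]
  refine Finset.sum_ninvolution (fun a : ι × ι => (a.2, a.1)) ?_ ?_ ?_ ?_
  · rintro ⟨p, q⟩
    simp only [hs q p]
    exact CharTwo.add_self_eq_zero _
  · rintro ⟨p, q⟩ h he
    simp only [Prod.mk.injEq] at he
    apply h
    rw [ZMod.intCast_zmod_eq_zero_iff_dvd _ 2]
    simpa [he.1] using hd p
  · simp
  · simp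

/-! ### The balance criterion for the bound Δ ≥ 2 -/

namespace UnitaryQuiver

variable {V : Type*}

/-- The balance `∑_y A x y * K y` of a vertex. -/
def balance [Fintype V] (Q : UnitaryQuiver V) (x : V) : ℤ := ∑ y, Q.A x y * Q.K y

lemma sum_coord [Fintype V] (Q : UnitaryQuiver V) (f : Q.Coord → ℤ) :
    ∑ p, f p = ∑ x, ∑ i : Fin (Q.K x), f ⟨x, i⟩ := Fintype.sum_sigma _

/-- `Δ` has the parity of a linear form whose coefficients are the balances. -/
lemma two_dvd_conformalDim [Fintype V] (Q : UnitaryQuiver V) (h : ∀ x, 2 ∣ Q.balance x) (m : Q.Charge) :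
    2 ∣ Q.conformalDim m := by
  have hdiag : ∀ x, 2 ∣ Q.A x x := fun x => by
    obtain ⟨g, hg⟩ := Q.diag x
    exact ⟨-1 + g, by rw [hg]; ring⟩
  have hpar : ∀ p q : Q.Coord,
      2 ∣ Q.dimTerm m p q + (Q.A p.1 q.1 * m p + Q.A q.1 p.1 * m q) := by
    intro p q
    have h1 : ∀ X : ℤ, 2 ∣ |X| + X := fun X => by
      rcases abs_choice X with h | h <;> rw [h] <;> omega
    have h2 : Q.dimTerm m p q + (Q.A p.1 q.1 * m p + Q.A q.1 p.1 * m q) =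
        (Q.A p.1 q.1).sign * |Q.A p.1 q.1 * m p - Q.A q.1 p.1 * m q| +
          (Q.A p.1 q.1 * m p - Q.A q.1 p.1 * m q) + 2 * (Q.A q.1 p.1 * m q) := by
      rw [dimTerm]; ring
    rw [h2]
    refine dvd_add ?_ (dvd_mul_right _ _)
    generalize hX : Q.A p.1 q.1 * m p - Q.A q.1 p.1 * m q = X
    have := h1 X
    rcases lt_trichotomy (Q.A p.1 q.1) 0 with h0 | h0 | h0
    · rw [Int.sign_eq_neg_one_of_neg h0]; omega
    · have h3 : Q.A q.1 p.1 = 0 := by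
        by_cases e : p.1 = q.1
        · rw [← e] at h0 ⊢; exact h0
        · exact (Q.zero_iff _ _ e).1 h0
      rw [← hX, h0, h3]; simp
    · rw [Int.sign_eq_one_of_pos h0]; omega
  choose e he using hpar
  have hsymm : ∀ p q, e p q = e q p := by
    intro p q
    have h1 := he p q
    have h2 := he q p
    rw [dimTerm_comm] at h2
    omega
  have hd : ∀ p, 2 ∣ e p p := by
    intro p
    have h1 := he p p
    rw [dimTerm, sub_self, abs_zero, mul_zero, zero_add] at h1
    have : e p p = Q.A p.1 p.1 * m p := by omega
    rw [this]
    exact Dvd.dvd.mul_right (hdiag _) _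
  have hsum := Q.two_mul_conformalDim m
  have hlin : ∑ p : Q.Coord, ∑ q : Q.Coord, Q.A p.1 q.1 * m p =
      ∑ p : Q.Coord, m p * Q.balance p.1 := by
    refine Finset.sum_congr rfl fun p _ => ?_
    rw [sum_coord, balance, Finset.mul_sum]
    refine Finset.sum_congr rfl fun y _ => ?_
    simp
    ring
  have hlin' : ∑ p : Q.Coord, ∑ q : Q.Coord, Q.A q.1 p.1 * m q =
      ∑ p : Q.Coord, m p * Q.balance p.1 := by
    rw [Finset.sum_comm]; exact hlin
  -- With `hlin` and `hlin'` this reads 2 Δ + 2 ∑ m_p balance = 2 ∑ e. As e is symmetric with even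
  -- diagonal, ∑ e is even, so Δ is congruent modulo 2 to the linear form with the balances as
  -- coefficients.
  have htot : ∑ p : Q.Coord, ∑ q : Q.Coord,
      (Q.dimTerm m p q + (Q.A p.1 q.1 * m p + Q.A q.1 p.1 * m q)) =
      ∑ p : Q.Coord, ∑ q : Q.Coord, 2 * e p q := by
    simp only [he]
  simp only [Finset.sum_add_distrib, ← hsum, hlin, hlin', ← Finset.mul_sum] at htot
  have h1 := two_dvd_sum_sum_of_symm e hsymm hd
  have h2 : 2 ∣ ∑ p : Q.Coord, m p * Q.balance p.1 :=
    Finset.dvd_sum fun p _ => Dvd.dvd.mul_left (h _) _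
  omega

/-- The spread `∑_{i,j} |m_{x,i} - m_{x,j}|` of a charge at a vertex. -/
def spread (Q : UnitaryQuiver V) (m : Q.Charge) (x : V) : ℤ :=
  ∑ i : Fin (Q.K x), ∑ j : Fin (Q.K x), |m ⟨x, i⟩ - m ⟨x, j⟩|

/-- The contribution of a pair of vertices to `2 Δ`. -/
def pairDim (Q : UnitaryQuiver V) (m : Q.Charge) (x y : V) : ℤ :=
  ∑ i : Fin (Q.K x), ∑ j : Fin (Q.K y), Q.dimTerm m ⟨x, i⟩ ⟨y, j⟩

lemma two_mul_conformalDim_eq_sum_pairDim [Fintype V] (Q : UnitaryQuiver V) (m : Q.Charge) :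
    2 * Q.conformalDim m = ∑ x, ∑ y, Q.pairDim m x y := by
  rw [two_mul_conformalDim, sum_coord]
  refine Finset.sum_congr rfl fun x _ => ?_
  simp only [sum_coord, pairDim]
  exact Finset.sum_comm

lemma spread_nonneg (Q : UnitaryQuiver V) (m : Q.Charge) (x : V) : 0 ≤ Q.spread m x :=
  Finset.sum_nonneg fun _ _ => Finset.sum_nonneg fun _ _ => abs_nonneg _

lemma eq_of_spread_eq_zero {Q : UnitaryQuiver V} {m : Q.Charge} {x : V} (h : Q.spread m x = 0)
    (i j : Fin (Q.K x)) : m ⟨x, i⟩ = m ⟨x, j⟩ := by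
  have h1 := (Finset.sum_eq_zero_iff_of_nonneg
    fun _ _ => Finset.sum_nonneg fun _ _ => abs_nonneg _).1 h i (Finset.mem_univ _)
  have h2 := (Finset.sum_eq_zero_iff_of_nonneg fun _ _ => abs_nonneg _).1 h1 j (Finset.mem_univ _)
  exact sub_eq_zero.1 (abs_eq_zero.1 h2)

/-- The average of the spreads at two vertices, a lower bound for the contribution of the pair. -/
def pairBound (Q : UnitaryQuiver V) (m : Q.Charge) (x y : V) : ℚ :=
  (Q.A x y * Q.K y * (Q.spread m x / Q.K x) + Q.A y x * Q.K x * (Q.spread m y / Q.K y)) / 2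

lemma pairDim_eq_of_ne {Q : UnitaryQuiver V} (m : Q.Charge) {x y : V} (h : 0 < Q.A x y) :
    Q.pairDim m x y = ∑ i : Fin (Q.K x), ∑ j : Fin (Q.K y),
      |Q.A x y * m ⟨x, i⟩ - Q.A y x * m ⟨y, j⟩| := by
  simp only [pairDim, dimTerm, Int.sign_eq_one_of_pos h, one_mul]

lemma sum_abs_mul_sub {Q : UnitaryQuiver V} (m : Q.Charge) {a : ℤ} (ha : 0 ≤ a) (x : V) :
    ∑ i : Fin (Q.K x), ∑ j : Fin (Q.K x), |a * m ⟨x, i⟩ - a * m ⟨x, j⟩| = a * Q.spread m x := by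
  simp only [← mul_sub, abs_mul, abs_of_nonneg ha, spread, Finset.mul_sum]

/-- For distinct joined vertices this is `energy_le` for the families A x y * m_x and A y x * m_y,
divided by 2 K x K y. For x = y it is an equality, so the negative terms of Δ enter without loss. -/
lemma pairBound_le_pairDim (Q : UnitaryQuiver V) (m : Q.Charge) (x y : V) :
    Q.pairBound m x y ≤ Q.pairDim m x y := by
  have hx : (Q.K x : ℚ) ≠ 0 := by exact_mod_cast (Q.weight_pos x).ne'
  have hy : (Q.K y : ℚ) ≠ 0 := by exact_mod_cast (Q.weight_pos y).ne'
  by_cases hxy : x = y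
  · subst hxy
    have : Q.pairDim m x x = Q.A x x * Q.spread m x := by
      simp only [pairDim, dimTerm, ← mul_sub, abs_mul, spread, Finset.mul_sum, ← mul_assoc,
        Int.sign_mul_abs]
    rw [this, pairBound]
    push_cast
    apply le_of_eq
    field_simp
    ring
  · by_cases h0 : Q.A x y = 0
    · have h1 := (Q.zero_iff _ _ hxy).1 h0
      simp [pairBound, pairDim, dimTerm, h0, h1]
    · obtain ⟨h1, h2, -⟩ := Q.pos_and_dvd _ _ hxy h0
      have := energy_le (fun i : Fin (Q.K x) => Q.A x y * m ⟨x, i⟩)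
        (fun j : Fin (Q.K y) => Q.A y x * m ⟨y, j⟩)
      rw [sum_abs_mul_sub m h1.le, sum_abs_mul_sub m h2.le, ← pairDim_eq_of_ne m h1] at this
      simp only [Fintype.card_fin] at this
      have h3 : ((Q.K y : ℚ) ^ 2 * (Q.A x y * Q.spread m x) +
          (Q.K x : ℚ) ^ 2 * (Q.A y x * Q.spread m y)) ≤
          2 * (Q.K x * Q.K y) * Q.pairDim m x y := by exact_mod_cast this
      have hpos : (0 : ℚ) < 2 * (Q.K x * Q.K y) := by
        have := Q.weight_pos x
        have := Q.weight_pos y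
        positivity
      refine le_of_mul_le_mul_left ?_ hpos
      refine le_trans (le_of_eq ?_) h3
      rw [pairBound]
      field_simp

/-- The spread at each vertex collects its balance as coefficient, so 2 Δ is bounded below by a
combination of spreads that is non-negative as soon as the balances are. -/
lemma sum_pairBound [Fintype V] (Q : UnitaryQuiver V) (m : Q.Charge) :
    ∑ x, ∑ y, Q.pairBound m x y = ∑ x, (Q.spread m x / Q.K x : ℚ) * Q.balance x := by
  have h1 : ∑ x, ∑ y, (Q.A x y * Q.K y * (Q.spread m x / Q.K x) : ℚ) =
      ∑ x, (Q.spread m x / Q.K x : ℚ) * Q.balance x := by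
    refine Finset.sum_congr rfl fun x _ => ?_
    rw [balance, ← Finset.sum_mul, mul_comm]
    push_cast
    rfl
  have h2 : ∑ x, ∑ y, (Q.A y x * Q.K x * (Q.spread m y / Q.K y) : ℚ) =
      ∑ x, (Q.spread m x / Q.K x : ℚ) * Q.balance x := by
    rw [Finset.sum_comm]; exact h1
  simp only [pairBound, ← Finset.sum_div, Finset.sum_add_distrib, h1, h2]
  ring

/-- A connected quiver of non-negative even balances is good, if it has a vertex of weight one or of
positive balance. -/
theorem dimBound_of_balance [Fintype V] {Q : UnitaryQuiver V} (hc : Q.graph.Connected)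
    (hnn : ∀ x, 0 ≤ Q.balance x) (heven : ∀ x, 2 ∣ Q.balance x)
    (hz : ∃ z, Q.K z = 1 ∨ 0 < Q.balance z) : Q.DimBound := by
  intro m
  by_cases hlt : 2 ≤ Q.conformalDim m
  · exact Or.inr hlt
  refine Or.inl ?_
  have hle : Q.conformalDim m ≤ 0 := by
    have := Q.two_dvd_conformalDim heven m
    omega
  have hterm : ∀ x, (0 : ℚ) ≤ (Q.spread m x / Q.K x : ℚ) * Q.balance x := fun x =>
    mul_nonneg (div_nonneg (by exact_mod_cast Q.spread_nonneg m x) (by positivity))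
      (by exact_mod_cast hnn x)
  have hsum1 : ∑ x, ∑ y, (Q.pairDim m x y : ℚ) ≤ 0 := by
    have := Q.two_mul_conformalDim_eq_sum_pairDim m
    have h2 : ∑ x, ∑ y, Q.pairDim m x y ≤ 0 := by omega
    exact_mod_cast h2
  have hsum2 := Q.sum_pairBound m
  have hsum3 : 0 ≤ ∑ x, ∑ y, Q.pairBound m x y := by
    rw [hsum2]; exact Finset.sum_nonneg fun x _ => hterm x
  have hle2 : ∀ x, ∑ y, Q.pairBound m x y ≤ ∑ y, (Q.pairDim m x y : ℚ) := fun x =>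
    Finset.sum_le_sum fun y _ => Q.pairBound_le_pairDim m x y
  have hle3 : ∑ x, ∑ y, Q.pairBound m x y ≤ ∑ x, ∑ y, (Q.pairDim m x y : ℚ) :=
    Finset.sum_le_sum fun x _ => hle2 x
  -- The chain 0 ≤ ∑ pairBound ≤ ∑ pairDim = 2 Δ ≤ 0 collapses, so every pairwise estimate is sharp.
  have heq : ∀ x y, Q.pairBound m x y = Q.pairDim m x y := by
    intro x y
    have e1 := (Finset.sum_eq_sum_iff_of_le fun x _ => hle2 x).1
      (le_antisymm hle3 (hsum1.trans hsum3)) x (Finset.mem_univ _)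
    exact (Finset.sum_eq_sum_iff_of_le fun y _ => Q.pairBound_le_pairDim m x y).1 e1 y
      (Finset.mem_univ _)
  have hzero : ∀ x, (Q.spread m x / Q.K x : ℚ) * Q.balance x = 0 := by
    have : ∑ x, (Q.spread m x / Q.K x : ℚ) * Q.balance x = 0 :=
      le_antisymm (by rw [← hsum2]; exact hle3.trans hsum1)
        (Finset.sum_nonneg fun x _ => hterm x)
    intro x
    exact (Finset.sum_eq_zero_iff_of_nonneg fun x _ => hterm x).1 this x (Finset.mem_univ _)
  -- The equality case of the energy inequality carries constancy of the charge from a vertex to its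
  -- neighbours, together with the flatness relation on the edge.
  have hstep : ∀ x y, Q.graph.Adj x y → (∀ i j : Fin (Q.K x), m ⟨x, i⟩ = m ⟨x, j⟩) →
      ∀ (i : Fin (Q.K x)) (j : Fin (Q.K y)), Q.A y x * m ⟨y, j⟩ = Q.A x y * m ⟨x, i⟩ := by
    intro x y hxy hx i j
    obtain ⟨h1, h2, -⟩ := Q.pos_and_dvd _ _ hxy.1 hxy.2
    have : Nonempty (Fin (Q.K x)) := ⟨i⟩
    refine eq_const_of_energy_le (fun i : Fin (Q.K x) => Q.A x y * m ⟨x, i⟩)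
        (fun j : Fin (Q.K y) => Q.A y x * m ⟨y, j⟩) (fun i' => by rw [hx i' i]) ?_ j
    rw [sum_abs_mul_sub m h1.le, sum_abs_mul_sub m h2.le, ← pairDim_eq_of_ne m h1]
    simp only [Fintype.card_fin]
    have hx : (Q.K x : ℚ) ≠ 0 := by exact_mod_cast (Q.weight_pos x).ne'
    have hy : (Q.K y : ℚ) ≠ 0 := by exact_mod_cast (Q.weight_pos y).ne'
    have e := heq x y
    have e2 : 2 * (Q.K x * Q.K y) * (Q.pairDim m x y : ℚ) =
        (Q.K y : ℚ) ^ 2 * (Q.A x y * Q.spread m x) +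
          (Q.K x : ℚ) ^ 2 * (Q.A y x * Q.spread m y) := by
      rw [← e, pairBound]
      field_simp
    apply le_of_eq
    exact_mod_cast e2
  -- Propagation needs a starting vertex where the charge is constant: weight one makes this
  -- automatic, and a positive balance forces the spread to vanish.
  obtain ⟨z, hz⟩ := hz
  have hzc : ∀ i j : Fin (Q.K z), m ⟨z, i⟩ = m ⟨z, j⟩ := by
    rcases hz with h1 | h1
    · intro i j
      have : i = j := Fin.ext (by omega)
      rw [this]
    · refine eq_of_spread_eq_zero ?_
      have h2 : (Q.balance z : ℚ) ≠ 0 := by exact_mod_cast h1.ne'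
      have h3 := (mul_eq_zero.1 (hzero z)).resolve_right h2
      have hz' : (Q.K z : ℚ) ≠ 0 := by exact_mod_cast (Q.weight_pos z).ne'
      have h4 := (div_eq_zero_iff.1 h3).resolve_right hz'
      exact_mod_cast h4
  have hall : ∀ x, ∀ i j : Fin (Q.K x), m ⟨x, i⟩ = m ⟨x, j⟩ := by
    intro x
    obtain ⟨p⟩ := hc.preconnected z x
    clear hz
    induction p with
    | nil => exact hzc
    | @cons a b c hab _ ih =>
      refine ih fun i j => ?_
      obtain ⟨-, h2, -⟩ := Q.pos_and_dvd _ _ hab.1 hab.2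
      have i0 : Fin (Q.K a) := ⟨0, Q.weight_pos a⟩
      exact mul_left_cancel₀ h2.ne'
        ((hstep a b hab hzc i0 i).trans (hstep a b hab hzc i0 j).symm)
  refine ⟨?_, ?_⟩
  · rintro ⟨x, i⟩ ⟨y, j⟩ (rfl : x = y)
    exact hall x i j
  · rintro ⟨x, i⟩ ⟨y, j⟩
    by_cases hxy : x = y
    · subst hxy
      rw [hall x i j]
    · by_cases h0 : Q.A x y = 0
      · simp only [h0, (Q.zero_iff _ _ hxy).1 h0, zero_mul]
      · exact (hstep x y ⟨hxy, h0⟩ (hall x) i j).symm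

end UnitaryQuiver


namespace UnitaryQuiver

variable {V : Type*}

/-- The first coordinate of a vertex. -/
def coord0 (Q : UnitaryQuiver V) (x : V) : Q.Coord := ⟨x, ⟨0, Q.weight_pos x⟩⟩

lemma eq_coord0 {Q : UnitaryQuiver V} {p : Q.Coord} (h : Q.K p.1 = 1) : p = Q.coord0 p.1 := by
  obtain ⟨x, i⟩ := p
  simp only at h
  have : i = ⟨0, Q.weight_pos x⟩ := Fin.ext (by omega)
  rw [this]; rfl

/-! ### Charges which are flat except along one edge -/

lemma two_mul_conformalDim_of_single [Fintype V] {Q : UnitaryQuiver V} (m : Q.Charge)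
    {p q : Q.Coord} (hpq : p ≠ q) (h : ∀ p' q', ¬ (p' = p ∧ q' = q) → ¬ (p' = q ∧ q' = p) →
      Q.dimTerm m p' q' = 0) : Q.conformalDim m = Q.dimTerm m p q := by
  classical
  have h1 := Q.two_mul_conformalDim m
  rw [← Fintype.sum_prod_type' (f := fun p q => Q.dimTerm m p q),
    ← Finset.sum_subset (Finset.subset_univ {(p, q), (q, p)}), Finset.sum_pair] at h1
  · dsimp only at h1
    rw [Q.dimTerm_comm m q p] at h1
    omega
  · simp [hpq]
  · rintro ⟨p', q'⟩ - hn
    simp only [Finset.mem_insert, Finset.mem_singleton, Prod.mk.injEq, not_or] at hn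
    exact h p' q' hn.1 hn.2

/-- When all weights are one the negative diagonal terms vanish and Δ is a sum over edges of
non-negative integers. So Δ < 2 leaves at most one edge with a non-zero term, and this term is 1. -/
lemma isConst_or_single_edge [Fintype V] {Q : UnitaryQuiver V} (hK : ∀ x, Q.K x = 1)
    (m : Q.Charge) : Q.IsConst m ∨ 2 ≤ Q.conformalDim m ∨ ∃ x y, Q.graph.Adj x y ∧
      |Q.A x y * m (Q.coord0 x) - Q.A y x * m (Q.coord0 y)| = 1 ∧
      ∀ x' y', ¬ (x' = x ∧ y' = y) → ¬ (x' = y ∧ y' = x) →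
        Q.A x' y' * m (Q.coord0 x') = Q.A y' x' * m (Q.coord0 y') := by
  classical
  by_cases hflat : ∀ x y, Q.A x y * m (Q.coord0 x) = Q.A y x * m (Q.coord0 y)
  · left
    refine ⟨fun p q e => ?_, fun p q => ?_⟩
    · rw [eq_coord0 (hK p.1), eq_coord0 (hK q.1), e]
    · rw [eq_coord0 (hK p.1), eq_coord0 (hK q.1)]
      exact hflat _ _
  right
  push Not at hflat
  obtain ⟨x, y, hxy⟩ := hflat
  have hne : x ≠ y := fun e => hxy (by rw [e])
  have hadj : Q.graph.Adj x y := ⟨hne, fun h0 => hxy (by rw [h0, (Q.zero_iff _ _ hne).1 h0]; simp)⟩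
  by_cases hΔ : 2 ≤ Q.conformalDim m
  · exact Or.inl hΔ
  right
  let F : V × V → ℤ := fun a => Q.dimTerm m (Q.coord0 a.1) (Q.coord0 a.2)
  have hsum : 2 * Q.conformalDim m = ∑ a : V × V, F a := by
    rw [two_mul_conformalDim_eq_sum_pairDim, Fintype.sum_prod_type]
    refine Finset.sum_congr rfl fun x _ => Finset.sum_congr rfl fun y _ => ?_
    have h1 : Unique (Fin (Q.K x)) := by rw [hK x]; infer_instance
    have h2 : Unique (Fin (Q.K y)) := by rw [hK y]; infer_instance
    rw [pairDim, Fintype.sum_unique, Fintype.sum_unique]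
    simp only [F]
    rw [← eq_coord0 (p := ⟨x, default⟩) (hK x), ← eq_coord0 (p := ⟨y, default⟩) (hK y)]
  have hF : ∀ a b, F (a, b) = |Q.A a b * m (Q.coord0 a) - Q.A b a * m (Q.coord0 b)| := by
    intro a b
    simp only [F, dimTerm, coord0]
    by_cases hab : a = b
    · subst hab; simp
    · by_cases h0 : Q.A a b = 0
      · simp [h0, (Q.zero_iff _ _ hab).1 h0]
      · rw [Int.sign_eq_one_of_pos (Q.pos_and_dvd _ _ hab h0).1, one_mul]
  have hFnn : ∀ a, 0 ≤ F a := fun a => by rw [hF]; exact abs_nonneg _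
  have hFc : ∀ a b, F (a, b) = F (b, a) := fun a b => Q.dimTerm_comm _ _ _
  have hpos : ∀ a b, Q.A a b * m (Q.coord0 a) ≠ Q.A b a * m (Q.coord0 b) → 1 ≤ F (a, b) := by
    intro a b hab
    rw [hF]
    exact Int.one_le_abs (sub_ne_zero.2 hab)
  refine ⟨x, y, hadj, ?_, fun x' y' h1 h2 => ?_⟩
  · rw [← hF]
    have h1 : ∑ a ∈ {(x, y), (y, x)}, F a ≤ ∑ a, F a :=
      Finset.sum_le_sum_of_subset_of_nonneg (Finset.subset_univ _) fun a _ _ => hFnn a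
    rw [Finset.sum_pair (by simp [hne]), hFc y x] at h1
    have := hpos x y hxy
    omega
  · by_contra hcon
    have hne' : x' ≠ y' := fun e => hcon (by rw [e])
    have h3 : ∑ a ∈ {(x, y), (y, x), (x', y'), (y', x')}, F a ≤ ∑ a, F a :=
      Finset.sum_le_sum_of_subset_of_nonneg (Finset.subset_univ _) fun a _ _ => hFnn a
    rw [Finset.sum_insert (by simp; tauto), Finset.sum_insert (by simp; tauto),
      Finset.sum_pair (by simp [hne']), hFc y x, hFc y' x'] at h3
    have := hpos x y hxy
    have := hpos x' y' hcon
    omega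

/-! ### Stars with centre of weight two -/

/-- If a, b are the two coordinates at the centre, then Δ = ∑ T x - 2 |a - b|, and the triangle
inequality gives T x ≥ A z x * |a - b|. If a ≠ b, total outgoing multiplicity at least 4 gives Δ ≥
2; if a = b, every T x is even and one of them is non-zero unless the charge is constant. No parity
of the balance at the centre is involved, unlike in `dimBound_of_balance`. -/
theorem dimBound_of_star [Fintype V] {Q : UnitaryQuiver V} {z : V} (hz : Q.K z = 2)
    (hzz : Q.A z z = -2) (hK : ∀ x, x ≠ z → Q.K x = 1)
    (hA : ∀ x y, x ≠ z → y ≠ z → x ≠ y → Q.A x y = 0) (h4 : 2 ≤ ∑ x, Q.A z x) : Q.DimBound := by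
  classical
  intro m
  let i0 : Fin (Q.K z) := ⟨0, by omega⟩
  let i1 : Fin (Q.K z) := ⟨1, by omega⟩
  have hsumz : ∀ f : Fin (Q.K z) → ℤ, ∑ i, f i = f i0 + f i1 := by
    intro f
    rw [← Equiv.sum_comp (finCongr hz.symm), Fin.sum_univ_two]
    rfl
  have hcases : ∀ i : Fin (Q.K z), i = i0 ∨ i = i1 := by
    intro i
    rcases (show i.1 = 0 ∨ i.1 = 1 by omega) with h | h
    · exact Or.inl (Fin.ext h)
    · exact Or.inr (Fin.ext h)
  set a := m ⟨z, i0⟩ with ha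
  set b := m ⟨z, i1⟩ with hb
  let c : V → ℤ := fun x => m (Q.coord0 x)
  let T : V → ℤ := fun x => |Q.A z x * a - Q.A x z * c x| + |Q.A z x * b - Q.A x z * c x|
  have hAnn : ∀ x, x ≠ z → 0 ≤ Q.A z x := by
    intro x hx
    by_cases h0 : Q.A z x = 0
    · rw [h0]
    · exact (Q.pos_and_dvd _ _ hx.symm h0).1.le
  have hzx : ∀ x, x ≠ z → Q.pairDim m z x = T x := by
    intro x hx
    have h2 : Unique (Fin (Q.K x)) := by rw [hK x hx]; infer_instance
    rw [pairDim, hsumz, Fintype.sum_unique, Fintype.sum_unique,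
      eq_coord0 (p := ⟨x, default⟩) (hK x hx)]
    simp only [dimTerm, coord0, T, c]
    by_cases h0 : Q.A z x = 0
    · simp [h0, (Q.zero_iff _ _ hx.symm).1 h0]
    · rw [Int.sign_eq_one_of_pos (Q.pos_and_dvd _ _ hx.symm h0).1, one_mul, one_mul]
  have hxz : ∀ x, x ≠ z → Q.pairDim m x z = T x := by
    intro x hx
    rw [← hzx x hx, pairDim, pairDim, Finset.sum_comm]
    exact Finset.sum_congr rfl fun i _ => Finset.sum_congr rfl fun j _ => Q.dimTerm_comm _ _ _
  have hzz' : Q.pairDim m z z = -4 * |a - b| := by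
    simp only [pairDim, hsumz, dimTerm, hzz, sub_self, abs_zero, mul_zero, ← ha, ← hb, ← mul_sub,
      abs_mul]
    rw [abs_sub_comm b a, show Int.sign (-2) = -1 from rfl, show |(-2 : ℤ)| = 2 from rfl]
    ring
  have hxy : ∀ x y, x ≠ z → y ≠ z → Q.pairDim m x y = 0 := by
    intro x y hx hy
    refine Finset.sum_eq_zero fun i _ => Finset.sum_eq_zero fun j _ => ?_
    by_cases e : x = y
    · subst e
      have : i = j := Fin.ext (by have := hK x hx; omega)
      rw [this, dimTerm, sub_self, abs_zero, mul_zero]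
    · rw [dimTerm, hA x y hx hy e, Int.sign_zero, zero_mul]
  have htot : Q.conformalDim m = ∑ x ∈ Finset.univ.erase z, T x - 2 * |a - b| := by
    have hrow : ∀ x ∈ Finset.univ.erase z, ∑ y, Q.pairDim m x y = T x := by
      intro x hx
      have hx := Finset.ne_of_mem_erase hx
      rw [← Finset.add_sum_erase _ _ (Finset.mem_univ z), hxz x hx,
        Finset.sum_eq_zero fun y hy => hxy x y hx (Finset.ne_of_mem_erase hy), add_zero]
    have h1 := Q.two_mul_conformalDim_eq_sum_pairDim m
    rw [← Finset.add_sum_erase _ _ (Finset.mem_univ z), Finset.sum_congr rfl hrow,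
      ← Finset.add_sum_erase _ _ (Finset.mem_univ z), hzz',
      Finset.sum_congr rfl fun x hx => hzx x (Finset.ne_of_mem_erase hx)] at h1
    have h2 : ∑ x ∈ Finset.univ.erase z, T x = (Finset.univ.erase z).sum T := rfl
    rw [h2] at h1 ⊢
    linarith
  have hT : ∀ x, x ≠ z → Q.A z x * |a - b| ≤ T x := by
    intro x hx
    have : Q.A z x * |a - b| = |Q.A z x * (a - b)| := by rw [abs_mul, abs_of_nonneg (hAnn x hx)]
    rw [this]
    have h2 := abs_sub_le (Q.A z x * a) (Q.A x z * c x) (Q.A z x * b)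
    rw [abs_sub_comm (Q.A x z * c x), ← mul_sub] at h2
    exact h2
  -- The sum in the hypothesis contains the diagonal entry -2.
  have hsumA : 4 ≤ ∑ x ∈ Finset.univ.erase z, Q.A z x := by
    rw [← Finset.add_sum_erase _ _ (Finset.mem_univ z), hzz] at h4
    omega
  by_cases hab : a = b
  · have hT2 : ∀ x, T x = 2 * |Q.A z x * a - Q.A x z * c x| := fun x => by
      simp only [T, ← hab]; ring
    have hTnn : ∀ x, 0 ≤ T x := fun x => by rw [hT2]; positivity
    by_cases hflat : ∀ x, x ≠ z → Q.A z x * a = Q.A x z * c x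
    · left
      have hza : ∀ i : Fin (Q.K z), m ⟨z, i⟩ = a := fun i => by
        rcases hcases i with h | h <;> rw [h]
        exact hab.symm
      refine ⟨?_, ?_⟩
      · rintro ⟨x, i⟩ ⟨y, j⟩ (rfl : x = y)
        by_cases hx : x = z
        · subst hx; rw [hza, hza]
        · have : i = j := Fin.ext (by have := hK x hx; omega)
          rw [this]
      · rintro ⟨x, i⟩ ⟨y, j⟩
        by_cases hx : x = z
        · subst hx
          rw [hza]
          by_cases hy : y = x
          · subst hy; rw [hza]
          · rw [eq_coord0 (p := ⟨y, j⟩) (hK y hy)]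
            exact hflat y hy
        · by_cases hy : y = z
          · subst hy
            rw [hza, eq_coord0 (p := ⟨x, i⟩) (hK x hx)]
            exact (hflat x hx).symm
          · by_cases e : x = y
            · subst e
              have : i = j := Fin.ext (by have := hK x hx; omega)
              rw [this]
            · rw [hA x y hx hy e, hA y x hy hx (Ne.symm e)]; simp
    · right
      push Not at hflat
      obtain ⟨x, hx, hne⟩ := hflat
      have h1 : T x ≤ ∑ x ∈ Finset.univ.erase z, T x :=
        Finset.single_le_sum (fun x _ => hTnn x) (Finset.mem_erase.2 ⟨hx, Finset.mem_univ x⟩)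
      have h2 := Int.one_le_abs (sub_ne_zero.2 hne)
      rw [hT2] at h1
      rw [htot, hab, sub_self, abs_zero]
      omega
  · right
    have h1 : (∑ x ∈ Finset.univ.erase z, Q.A z x) * |a - b| ≤ ∑ x ∈ Finset.univ.erase z, T x := by
      rw [Finset.sum_mul]
      exact Finset.sum_le_sum fun x hx => hT x (Finset.ne_of_mem_erase hx)
    have h2 := Int.one_le_abs (sub_ne_zero.2 hab)
    rw [htot]
    nlinarith

/-! ### Abelian quivers -/

/-- An Abelian quiver with one edge. -/
theorem dimBound_of_edge_dvd [Fintype V] {Q : UnitaryQuiver V} (hK : ∀ x, Q.K x = 1) {N : ℤ}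
    (hN : 2 ≤ N) (hA : ∀ x y, Q.graph.Adj x y → N ∣ Q.A x y) : Q.DimBound := by
  intro m
  rcases isConst_or_single_edge hK m with h | h | ⟨x, y, hxy, h1, -⟩
  · exact Or.inl h
  · exact Or.inr h
  · exfalso
    have h2 : N ∣ Q.A x y * m (Q.coord0 x) - Q.A y x * m (Q.coord0 y) :=
      dvd_sub (Dvd.dvd.mul_right (hA _ _ hxy) _) (Dvd.dvd.mul_right (hA _ _ hxy.symm) _)
    rw [← dvd_abs, h1] at h2
    have := Int.le_of_dvd one_pos h2
    omega

/-- An Abelian quiver without bridge is good. -/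
theorem dimBound_of_no_bridge [Fintype V] {Q : UnitaryQuiver V} (hc : Q.graph.Connected)
    (hK : ∀ x, Q.K x = 1)
    (hbridge : ∀ x y, Q.graph.Adj x y → (Q.graph.deleteEdges {s(x, y)}).Reachable x y) :
    Q.DimBound := by
  intro m
  rcases isConst_or_single_edge hK m with h | h | ⟨x, y, hxy, h1, hflat⟩
  · exact Or.inl h
  · exact Or.inr h
  · exfalso
    have := hc.nonempty
    obtain ⟨u, hu⟩ := Q.exists_isShift
    -- Flatness holds on every edge but one. Along a detour avoiding that edge it makes m
    -- proportional to the shift vector at both of its ends, which forces flatness there too.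
    have key : ∀ a b, (Q.graph.deleteEdges {s(x, y)}).Reachable a b →
        m (Q.coord0 a) * u b = m (Q.coord0 b) * u a := by
      rintro a b ⟨p⟩
      induction p with
      | nil => rfl
      | @cons a b c hab _ ih =>
        have hb : (u b : ℤ) ≠ 0 := by exact_mod_cast (hu.1 b).ne'
        rw [SimpleGraph.deleteEdges_adj] at hab
        have e := hflat a b (fun h => hab.2 (by simp [h.1, h.2])) (fun h => hab.2 (by
          simp [h.1, h.2, Sym2.eq_swap]))
        have e2 := hu.2.2 a b
        apply mul_left_cancel₀ (mul_ne_zero hb hab.1.2)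
        linear_combination (Q.A a b * u a) * ih + (u b * u c : ℤ) * e - m (Q.coord0 b) * u c * e2
    have e := key x y (hbridge x y hxy)
    have e2 := hu.2.2 x y
    have hy : (u y : ℤ) ≠ 0 := by exact_mod_cast (hu.1 y).ne'
    have : Q.A x y * m (Q.coord0 x) - Q.A y x * m (Q.coord0 y) = 0 := by
      apply mul_left_cancel₀ hy
      linear_combination (Q.A x y) * e + m (Q.coord0 y) * e2
    rw [this] at h1
    simp at h1

end UnitaryQuiver


/-! ### Balances of tree-shaped quivers -/

namespace QuiverShape

/-- The balance of vertex `i` in the shape `tree n p d u k`. -/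
def treeBalance (n : ℕ) (p d u k : ℕ → ℕ) (i : ℕ) : ℤ :=
  (if i ≠ 0 then (u i : ℤ) * k (p i) else 0) +
    (∑ j ∈ Finset.range (n + 1), if j ≠ 0 ∧ p j = i then (d j : ℤ) * k j else 0) - 2 * k i

lemma tree_sum {n : ℕ} {p : ℕ → ℕ} (hp : ∀ j, 1 ≤ j → j ≤ n → p j < j) (d u k : ℕ → ℕ)
    (i : Fin (n + 1)) :
    ∑ j : Fin (n + 1), (tree n p d u k).A i j * k j = treeBalance n p d u k i := by
  have hi := i.2
  have h : ∀ j : Fin (n + 1), (tree n p d u k).A i j * k j =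
      (fun j : ℕ => (if j = i then -2 * (k i : ℤ) else 0) +
        (if j ≠ 0 ∧ p j = i then (d j : ℤ) * k j else 0) +
        (if (i : ℕ) ≠ 0 ∧ j = p i then (u i : ℤ) * k (p i) else 0)) j := by
    intro j
    have hj := j.2
    have hpi : (i : ℕ) ≠ 0 → p i < i := fun h => hp _ (by omega) (by omega)
    have hpj : (j : ℕ) ≠ 0 → p j < j := fun h => hp _ (by omega) (by omega)
    simp only [tree]
    by_cases hij : i = j
    · subst hij
      rw [if_pos rfl, if_pos rfl, if_neg (by omega), if_neg (by omega)]
      simp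
    · have hne : ¬ (j : ℕ) = i := fun h => hij (Fin.ext h.symm)
      rw [if_neg hij, if_neg hne]
      by_cases h1 : (j : ℕ) ≠ 0 ∧ p j = i
      · rw [if_pos h1, if_pos h1, if_neg (by omega)]
        simp
      · rw [if_neg h1, if_neg h1]
        by_cases h2 : (i : ℕ) ≠ 0 ∧ p i = j
        · rw [if_pos h2, if_pos ⟨h2.1, h2.2.symm⟩, h2.2]
          simp
        · rw [if_neg h2, if_neg (fun h => h2 ⟨h.1, h.2.symm⟩)]
          simp
  rw [Finset.sum_congr rfl fun j _ => h j, Fin.sum_univ_eq_sum_range (f := fun j : ℕ =>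
    (if j = i then -2 * (k i : ℤ) else 0) +
        (if j ≠ 0 ∧ p j = i then (d j : ℤ) * k j else 0) +
        (if (i : ℕ) ≠ 0 ∧ j = p i then (u i : ℤ) * k (p i) else 0)),
    Finset.sum_add_distrib, Finset.sum_add_distrib, Finset.sum_ite_eq',
    if_pos (Finset.mem_range.2 hi), treeBalance]
  have : ∑ j ∈ Finset.range (n + 1), (if (i : ℕ) ≠ 0 ∧ j = p i then (u i : ℤ) * k (p i) else 0) =
      if (i : ℕ) ≠ 0 then (u i : ℤ) * k (p i) else 0 := by
    by_cases h0 : (i : ℕ) ≠ 0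
    · have := hp i (by omega) (by omega)
      simp only [h0, ne_eq, not_false_eq_true, true_and, if_true]
      rw [Finset.sum_ite_eq', if_pos (Finset.mem_range.2 (by omega))]
    · simp [h0]
  rw [this]
  ring

lemma linear_balance (n : ℕ) (d u k : ℕ → ℕ) (i : ℕ) :
    treeBalance n (fun j => j - 1) d u k i = (if i ≠ 0 then (u i : ℤ) * k (i - 1) else 0) +
      (if i + 1 ≤ n then (d (i + 1) : ℤ) * k (i + 1) else 0) - 2 * k i := by
  rw [treeBalance]
  congr 2
  have : ∀ j ∈ Finset.range (n + 1), (if j ≠ 0 ∧ j - 1 = i then (d j : ℤ) * k j else 0) =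
      if j = i + 1 then (d j : ℤ) * k j else 0 := by
    intro j _
    split_ifs <;> first | rfl | omega
  rw [Finset.sum_congr rfl this, Finset.sum_ite_eq']
  simp only [Finset.mem_range, Nat.add_lt_add_iff_right, Nat.succ_le_iff]

lemma forked_balance {n : ℕ} (hn : 2 ≤ n) (d u k : ℕ → ℕ) (i : ℕ) :
    treeBalance n (fun j => if j = n then n - 2 else j - 1) d u k i =
      (if i ≠ 0 then (u i : ℤ) * k (if i = n then n - 2 else i - 1) else 0) +
      ((if i + 1 < n then (d (i + 1) : ℤ) * k (i + 1) else 0) +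
        (if i = n - 2 then (d n : ℤ) * k n else 0)) - 2 * k i := by
  rw [treeBalance]
  congr 2
  have : ∀ j ∈ Finset.range (n + 1),
      (if j ≠ 0 ∧ (if j = n then n - 2 else j - 1) = i then (d j : ℤ) * k j else 0) =
      (if j = i + 1 then (if i + 1 < n then (d (i + 1) : ℤ) * k (i + 1) else 0) else 0) +
        (if j = n then (if i = n - 2 then (d n : ℤ) * k n else 0) else 0) := by
    intro j hj
    rw [Finset.mem_range] at hj
    by_cases h1 : j = n
    · subst h1
      split_ifs <;> omega
    · by_cases h2 : j = i + 1
      · subst h2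
        split_ifs <;> omega
      · split_ifs <;> omega
  rw [Finset.sum_congr rfl this, Finset.sum_add_distrib, Finset.sum_ite_eq', Finset.sum_ite_eq',
    if_pos (Finset.mem_range.2 (Nat.lt_succ_self n))]
  congr 1
  simp only [Finset.mem_range]
  split_ifs <;> first | rfl | omega

lemma affD_balance {n : ℕ} (hn : 4 ≤ n) (d u k : ℕ → ℕ) (i : ℕ) :
    treeBalance n (fun j => if j = n then 1 else if j = n - 1 then n - 3 else j - 1) d u k i =
      (if i ≠ 0 then (u i : ℤ) * k (if i = n then 1 else if i = n - 1 then n - 3 else i - 1)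
        else 0) +
      ((if i + 1 < n - 1 then (d (i + 1) : ℤ) * k (i + 1) else 0) +
        (if i = n - 3 then (d (n - 1) : ℤ) * k (n - 1) else 0) +
        (if i = 1 then (d n : ℤ) * k n else 0)) - 2 * k i := by
  rw [treeBalance]
  congr 2
  have : ∀ j ∈ Finset.range (n + 1),
      (if j ≠ 0 ∧ (if j = n then 1 else if j = n - 1 then n - 3 else j - 1) = i
        then (d j : ℤ) * k j else 0) =
      (if j = i + 1 then (if i + 1 < n - 1 then (d (i + 1) : ℤ) * k (i + 1) else 0) else 0) +
        (if j = n - 1 then (if i = n - 3 then (d (n - 1) : ℤ) * k (n - 1) else 0) else 0) +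
        (if j = n then (if i = 1 then (d n : ℤ) * k n else 0) else 0) := by
    intro j hj
    rw [Finset.mem_range] at hj
    by_cases h1 : j = n
    · subst h1
      split_ifs <;> omega
    · by_cases h3 : j = n - 1
      · subst h3
        split_ifs <;> omega
      · by_cases h2 : j = i + 1
        · subst h2
          split_ifs <;> omega
        · split_ifs <;> omega
  rw [Finset.sum_congr rfl this, Finset.sum_add_distrib, Finset.sum_add_distrib,
    Finset.sum_ite_eq', Finset.sum_ite_eq', Finset.sum_ite_eq',
    if_pos (Finset.mem_range.2 (Nat.lt_succ_self n)),
    if_pos (Finset.mem_range.2 (show n - 1 < n + 1 by omega))]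
  congr 2
  simp only [Finset.mem_range]
  split_ifs <;> first | rfl | omega

end QuiverShape

namespace UnitaryQuiver

open QuiverShape

variable {V : Type*}

lemma balance_eq_of_equiv [Fintype V] {R : UnitaryQuiver V} {s : QuiverShape}
    (e : V ≃ Fin s.size) (hA : ∀ x y, R.A x y = s.A (e x) (e y)) (hK : ∀ x, R.K x = s.K (e x))
    (x : V) : R.balance x = ∑ j, s.A (e x) j * s.K j := by
  rw [balance, ← Equiv.sum_comp e]
  exact Finset.sum_congr rfl fun y _ => by rw [hA, hK]

lemma tree_adj {n : ℕ} {p d u k : ℕ → ℕ} {R : UnitaryQuiver V} (e : V ≃ Fin (n + 1))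
    (hA : ∀ x y, R.A x y = (tree n p d u k).A (e x) (e y))
    (hp : ∀ j, 1 ≤ j → j ≤ n → p j < j) (hd : ∀ j, 1 ≤ j → j ≤ n → 1 ≤ d j) {j : ℕ}
    (hj1 : 1 ≤ j) (hj : j ≤ n) :
    R.graph.Adj (e.symm ⟨p j, by have := hp j hj1 hj; omega⟩) (e.symm ⟨j, by omega⟩) := by
  have := hp j hj1 hj
  have hne : (⟨p j, by omega⟩ : Fin (n + 1)) ≠ ⟨j, by omega⟩ := by
    intro h
    have := congrArg Fin.val h
    simp at this
    omega
  refine ⟨fun h => hne (e.symm.injective h), ?_⟩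
  rw [hA, Equiv.apply_symm_apply, Equiv.apply_symm_apply]
  simp only [tree]
  rw [if_neg hne, if_pos ⟨by simp; omega, trivial⟩]
  have := hd j hj1 hj
  simp
  omega

lemma connected_of_isoShape_tree {n : ℕ} {p d u k : ℕ → ℕ} {R : UnitaryQuiver V}
    (e : V ≃ Fin (n + 1)) (hA : ∀ x y, R.A x y = (tree n p d u k).A (e x) (e y))
    (hp : ∀ j, 1 ≤ j → j ≤ n → p j < j) (hd : ∀ j, 1 ≤ j → j ≤ n → 1 ≤ d j) :
    R.graph.Connected := by
  have hreach : ∀ j (hj : j ≤ n), R.graph.Reachable (e.symm 0) (e.symm ⟨j, by omega⟩) := by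
    intro j
    induction j using Nat.strong_induction_on with
    | _ j ih =>
      intro hj
      rcases Nat.eq_zero_or_pos j with h | h
      · subst h; exact SimpleGraph.Reachable.refl _
      · have h1 := hp j h hj
        exact (ih (p j) h1 (by omega)).trans (tree_adj e hA hp hd h hj).reachable
  have hr : ∀ x, R.graph.Reachable (e.symm 0) x := by
    intro x
    have := hreach (e x) (by have := (e x).2; omega)
    simpa using this
  exact { preconnected := fun x y => (hr x).symm.trans (hr y), nonempty := ⟨e.symm 0⟩ }

lemma two_le_card_coord_of_nontrivial [Fintype V] (R : UnitaryQuiver V) {x y : V} (h : x ≠ y) :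
    2 ≤ Fintype.card R.Coord := by
  have : Nontrivial R.Coord := ⟨R.coord0 x, R.coord0 y, fun e => h (congrArg Sigma.fst e)⟩
  exact Fintype.one_lt_card

theorem isGoodConnected_of_tree [Fintype V] {n : ℕ} {p d u k : ℕ → ℕ} {R : UnitaryQuiver V}
    (hR : R.IsoShape (tree n p d u k)) (hn : 1 ≤ n)
    (hp : ∀ j, 1 ≤ j → j ≤ n → p j < j) (hd : ∀ j, 1 ≤ j → j ≤ n → 1 ≤ d j)
    (hb : ∀ i, i ≤ n → 0 ≤ treeBalance n p d u k i ∧ 2 ∣ treeBalance n p d u k i)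
    (hz : ∃ z, z ≤ n ∧ (k z = 1 ∨ 0 < treeBalance n p d u k z)) : R.IsGoodConnected := by
  obtain ⟨e, hA, hK⟩ := hR
  change V ≃ Fin (n + 1) at e
  have hc := connected_of_isoShape_tree e hA hp hd
  have hbal : ∀ x, R.balance x = treeBalance n p d u k (e x) := fun x => by
    rw [balance_eq_of_equiv (s := tree n p d u k) e hA hK x]; exact tree_sum hp d u k (e x)
  refine isGoodConnected_of_dimBound hc (two_le_card_coord_of_nontrivial R
    (x := e.symm ⟨0, by omega⟩) (y := e.symm ⟨1, by omega⟩) (by simp)) ?_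
  refine dimBound_of_balance hc (fun x => ?_) (fun x => ?_) ?_
  · rw [hbal]; exact (hb _ (by have := (e x).2; omega)).1
  · rw [hbal]; exact (hb _ (by have := (e x).2; omega)).2
  · obtain ⟨z, hz, h⟩ := hz
    have hK2 : ∀ x, R.K x = k (e x) := hK
    have hK' : R.K (e.symm ⟨z, by omega⟩) = k z := by rw [hK2, Equiv.apply_symm_apply]
    have hb' : R.balance (e.symm ⟨z, by omega⟩) = treeBalance n p d u k z := by
      rw [hbal, Equiv.apply_symm_apply]
    exact ⟨_, by rwa [hK', hb']⟩

end UnitaryQuiver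


/-! ### Listed quivers that are good by their balances -/

namespace UnitaryQuiver

open QuiverShape

variable {V : Type*} [Fintype V] {R : UnitaryQuiver V}

/-- There is no vertex of weight one here; the criterion starts from vertex 0, whose balance is 3 ·
2 - 4 = 2. -/
lemma isGoodConnected_gc {n : ℕ} (hn : 2 ≤ n) (hR : R.IsoShape (gc n)) : R.IsGoodConnected := by
  refine isGoodConnected_of_tree hR (by omega) (fun j _ _ => by omega)
    (fun j _ _ => by split_ifs <;> omega) (fun i hi => ?_) ⟨0, by omega, Or.inr ?_⟩
  · rw [linear_balance]
    push_cast
    constructor <;> split_ifs <;> omega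
  · rw [linear_balance]
    push_cast
    split_ifs <;> omega

lemma isGoodConnected_gb {n : ℕ} (hn : 2 ≤ n) (hR : R.IsoShape (gb n)) : R.IsGoodConnected := by
  refine isGoodConnected_of_tree hR (by omega) (fun j _ _ => by omega)
    (fun j _ _ => by split_ifs <;> omega) (fun i hi => ?_) ⟨n, by omega, Or.inl (if_pos rfl)⟩
  rw [linear_balance]
  push_cast
  constructor <;> split_ifs <;> omega

/-- Serves `gd`, `affA2odd` and `affB` at once, which differ only in the edge 0 — 1 and the weight
of vertex 0. A final leaf with lacedness ℓ has balance 2ℓ - 2, and vertex 0 has balance 2 (d 1 - k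
0). -/
lemma forked_balance_values {n : ℕ} (hn : 3 ≤ n) {d u k : ℕ → ℕ} (hd1 : k 0 ≤ d 1)
    (hd : ∀ j, 2 ≤ j → d j = 1) (hu1 : u 1 * k 0 = 2) (hu : ∀ j, 2 ≤ j → j + 2 ≤ n → u j = 1)
    (hu' : ∀ j, n ≤ j + 1 → 1 ≤ u j) (hk : ∀ j, 1 ≤ j → j + 2 ≤ n → k j = 2)
    (hk' : ∀ j, n ≤ j + 1 → k j = 1) (i : ℕ) (hi : i ≤ n) :
    0 ≤ treeBalance n (fun j => if j = n then n - 2 else j - 1) d u k i ∧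
    2 ∣ treeBalance n (fun j => if j = n then n - 2 else j - 1) d u k i := by
  rw [forked_balance (by omega)]
  rcases (show i = 0 ∨ i = n ∨ i = n - 1 ∨ (1 ≤ i ∧ i + 2 ≤ n) by omega) with h | h | h | h
  · rw [if_neg (by omega), if_pos (by omega), if_neg (by omega), h, hk 1 le_rfl (by omega)]
    constructor <;> push_cast <;> omega
  · have := hu' i (by omega)
    rw [if_pos (by omega), if_pos h, if_neg (by omega), if_neg (by omega),
      hk (n - 2) (by omega) (by omega), hk' i (by omega)]
    constructor <;> push_cast <;> omega
  · have := hu' i (by omega)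
    rw [if_pos (by omega), if_neg (by omega), if_neg (by omega), if_neg (by omega),
      hk (i - 1) (by omega) (by omega), hk' i (by omega)]
    constructor <;> push_cast <;> omega
  · rw [if_pos (by omega), if_neg (by omega), if_pos (by omega), hd _ (by omega),
      hd _ (by omega), hk i h.1 h.2, hk' n (by omega)]
    have h1 : (u i : ℤ) * k (i - 1) = 2 := by
      by_cases h1 : i = 1
      · subst h1; exact_mod_cast hu1
      · rw [hu i (by omega) h.2, hk _ (by omega) (by omega)]; norm_num
    have h2 : k (i + 1) = if i = n - 2 then 1 else 2 := by
      split_ifs with h1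
      · exact hk' _ (by omega)
      · exact hk _ (by omega) (by omega)
    rw [h1, h2]
    constructor <;> split_ifs <;> omega

lemma isGoodConnected_gd {n ℓ₁ ℓ₂ : ℕ} (hn : 3 ≤ n) (h₁ : 1 ≤ ℓ₁) (h₂ : 1 ≤ ℓ₂)
    (hR : R.IsoShape (gd n ℓ₁ ℓ₂)) : R.IsGoodConnected := by
  refine isGoodConnected_of_tree hR (by omega) (fun j _ _ => by split_ifs <;> omega)
    (fun j _ _ => by split_ifs <;> omega) (forked_balance_values hn ?_ ?_ ?_ ?_ ?_ ?_ ?_)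
    ⟨n, by omega, Or.inl (if_pos (by omega))⟩
  all_goals intros
  all_goals split_ifs <;> omega

lemma isGoodConnected_affA2even {n : ℕ} (hn : 2 ≤ n) (hR : R.IsoShape (affA2even n)) :
    R.IsGoodConnected := by
  refine isGoodConnected_of_tree hR (by omega) (fun j _ _ => by omega)
    (fun j _ _ => by split_ifs <;> omega) (fun i hi => ?_) ⟨n, by omega, Or.inl (if_pos rfl)⟩
  rw [linear_balance]
  push_cast
  constructor <;> split_ifs <;> omega

lemma isGoodConnected_affA2odd {n ℓ₁ ℓ₂ : ℕ} (hn : 3 ≤ n) (h₁ : 1 ≤ ℓ₁) (h₂ : 1 ≤ ℓ₂)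
    (hR : R.IsoShape (affA2odd n ℓ₁ ℓ₂)) : R.IsGoodConnected := by
  refine isGoodConnected_of_tree hR (by omega) (fun j _ _ => by split_ifs <;> omega)
    (fun j _ _ => by split_ifs <;> omega) (forked_balance_values hn ?_ ?_ ?_ ?_ ?_ ?_ ?_)
    ⟨n, by omega, Or.inl (if_pos (by omega))⟩
  all_goals intros
  all_goals split_ifs <;> omega

lemma isGoodConnected_affB {n ℓ₁ ℓ₂ : ℕ} (hn : 3 ≤ n) (h₁ : 1 ≤ ℓ₁) (h₂ : 1 ≤ ℓ₂)
    (hR : R.IsoShape (affB n ℓ₁ ℓ₂)) : R.IsGoodConnected := by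
  refine isGoodConnected_of_tree hR (by omega) (fun j _ _ => by split_ifs <;> omega)
    (fun j _ _ => le_rfl) (forked_balance_values hn ?_ (fun _ _ => rfl) ?_ ?_ ?_ ?_ ?_)
    ⟨n, by omega, Or.inl (if_pos (by omega))⟩
  all_goals intros
  all_goals split_ifs <;> omega

lemma affD_balance_values {n : ℕ} (hn : 4 ≤ n) {d u k : ℕ → ℕ} (hd1 : 1 ≤ d 1)
    (hd : ∀ j, 2 ≤ j → d j = 1) (hu : ∀ j, 1 ≤ j → j + 3 ≤ n → u j = 1)
    (hu' : ∀ j, n ≤ j + 2 → 1 ≤ u j) (hk0 : k 0 = 1) (hk : ∀ j, 1 ≤ j → j + 3 ≤ n → k j = 2)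
    (hk' : ∀ j, n ≤ j + 2 → k j = 1) (i : ℕ) (hi : i ≤ n) :
    0 ≤ treeBalance n (fun j => if j = n then 1 else if j = n - 1 then n - 3 else j - 1) d u k i ∧
    2 ∣ treeBalance n (fun j => if j = n then 1 else if j = n - 1 then n - 3 else j - 1) d u k i := by
  rw [affD_balance hn]
  rcases (show i = 0 ∨ i = n ∨ i = n - 1 ∨ i = n - 2 ∨ (1 ≤ i ∧ i + 3 ≤ n) by omega) with
    h | h | h | h | h
  · rw [if_neg (by omega), if_pos (by omega), if_neg (by omega), if_neg (by omega), h, hk0,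
      hk 1 le_rfl (by omega)]
    constructor <;> push_cast <;> omega
  · have := hu' i (by omega)
    rw [if_pos (by omega), if_pos h, if_neg (by omega), if_neg (by omega), if_neg (by omega),
      hk 1 le_rfl (by omega), hk' i (by omega)]
    constructor <;> push_cast <;> omega
  · have := hu' i (by omega)
    rw [if_pos (by omega), if_neg (by omega), if_pos h, if_neg (by omega), if_neg (by omega),
      if_neg (by omega), hk (n - 3) (by omega) (by omega), hk' i (by omega)]
    constructor <;> push_cast <;> omega
  · have := hu' i (by omega)
    rw [if_pos (by omega), if_neg (by omega), if_neg (by omega), if_neg (by omega),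
      if_neg (by omega), if_neg (by omega), hk (i - 1) (by omega) (by omega), hk' i (by omega)]
    constructor <;> push_cast <;> omega
  · rw [if_pos (by omega), if_neg (by omega), if_neg (by omega), if_pos (by omega),
      hu i h.1 h.2, hd _ (by omega), hd _ (by omega), hd _ (by omega), hk i h.1 h.2,
      hk' (n - 1) (by omega), hk' n (by omega)]
    have h1 : k (i - 1) = if i = 1 then 1 else 2 := by
      split_ifs with h1
      · rw [h1]; exact hk0
      · exact hk _ (by omega) (by omega)
    have h2 : k (i + 1) = if i = n - 3 then 1 else 2 := by
      split_ifs with h1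
      · exact hk' _ (by omega)
      · exact hk _ (by omega) (by omega)
    rw [h1, h2]
    constructor <;> split_ifs <;> omega

lemma isGoodConnected_affD {n ℓ₁ ℓ₂ ℓ₃ ℓ₄ : ℕ} (hn : 4 ≤ n) (h₁ : 1 ≤ ℓ₁) (h₂ : 1 ≤ ℓ₂)
    (h₃ : 1 ≤ ℓ₃) (h₄ : 1 ≤ ℓ₄) (hR : R.IsoShape (affD n ℓ₁ ℓ₂ ℓ₃ ℓ₄)) : R.IsGoodConnected := by
  refine isGoodConnected_of_tree hR (by omega) (fun j _ _ => by split_ifs <;> omega)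
    (fun j _ _ => by split_ifs <;> omega) (affD_balance_values hn ?_ ?_ ?_ ?_ ?_ ?_ ?_)
    ⟨n, by omega, Or.inl (if_pos (by omega))⟩
  all_goals intros
  all_goals split_ifs <;> omega

lemma isGoodConnected_affD2 {n : ℕ} (hn : 2 ≤ n) (hR : R.IsoShape (affD2 n)) :
    R.IsGoodConnected := by
  refine isGoodConnected_of_tree hR (by omega) (fun j _ _ => by omega)
    (fun j _ _ => by split_ifs <;> omega) (fun i hi => ?_)
    ⟨n, by omega, Or.inl (if_pos (Or.inr rfl))⟩
  rw [linear_balance]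
  push_cast
  simp only [false_or]
  constructor <;> split_ifs <;> omega

lemma isGoodConnected_affD43 {ℓ₁ : ℕ} (h₁ : 1 ≤ ℓ₁) (hR : R.IsoShape (affD43 ℓ₁)) :
    R.IsGoodConnected := by
  refine isGoodConnected_of_tree hR (by omega) (fun j _ _ => by omega)
    (fun j _ _ => by split_ifs <;> omega) (fun i hi => ?_) ⟨0, by omega, Or.inl rfl⟩
  rw [linear_balance]
  interval_cases i <;> simp <;> omega

lemma isGoodConnected_affE6 {ℓ₁ ℓ₂ ℓ₃ : ℕ} (h₁ : 1 ≤ ℓ₁) (h₂ : 1 ≤ ℓ₂) (h₃ : 1 ≤ ℓ₃)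
    (hR : R.IsoShape (affE6 ℓ₁ ℓ₂ ℓ₃)) : R.IsGoodConnected := by
  refine isGoodConnected_of_tree hR (by omega) (fun j _ _ => by split_ifs <;> omega)
    (fun j _ _ => by split_ifs <;> omega) (fun i hi => ?_) ⟨0, by omega, Or.inl rfl⟩
  rw [treeBalance]
  interval_cases i <;> simp [Finset.sum_range_succ] <;> omega

lemma isGoodConnected_affE62 {ℓ₁ : ℕ} (h₁ : 1 ≤ ℓ₁) (hR : R.IsoShape (affE62 ℓ₁)) :
    R.IsGoodConnected := by
  refine isGoodConnected_of_tree hR (by omega) (fun j _ _ => by omega)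
    (fun j _ _ => by split_ifs <;> omega) (fun i hi => ?_) ⟨4, by omega, Or.inl rfl⟩
  rw [linear_balance]
  interval_cases i <;> simp <;> omega

lemma isGoodConnected_affE7 {ℓ₁ ℓ₂ : ℕ} (h₁ : 1 ≤ ℓ₁) (h₂ : 1 ≤ ℓ₂)
    (hR : R.IsoShape (affE7 ℓ₁ ℓ₂)) : R.IsGoodConnected := by
  refine isGoodConnected_of_tree hR (by omega) (fun j _ _ => by split_ifs <;> omega)
    (fun j _ _ => by split_ifs <;> omega) (fun i hi => ?_) ⟨0, by omega, Or.inl rfl⟩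
  rw [treeBalance]
  interval_cases i <;> simp [Finset.sum_range_succ] <;> omega

lemma isGoodConnected_affE8 {ℓ : ℕ} (h₁ : 1 ≤ ℓ) (hR : R.IsoShape (affE8 ℓ)) :
    R.IsGoodConnected := by
  refine isGoodConnected_of_tree hR (by omega) (fun j _ _ => by split_ifs <;> omega)
    (fun j _ _ => by split_ifs <;> omega) (fun i hi => ?_) ⟨0, by omega, Or.inl rfl⟩
  rw [treeBalance]
  interval_cases i <;> simp [Finset.sum_range_succ] <;> omega

lemma isGoodConnected_affF4 {ℓ₁ ℓ₂ : ℕ} (h₁ : 1 ≤ ℓ₁) (h₂ : 1 ≤ ℓ₂)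
    (hR : R.IsoShape (affF4 ℓ₁ ℓ₂)) : R.IsGoodConnected := by
  refine isGoodConnected_of_tree hR (by omega) (fun j _ _ => by omega)
    (fun j _ _ => by split_ifs <;> omega) (fun i hi => ?_) ⟨0, by omega, Or.inl rfl⟩
  rw [linear_balance]
  interval_cases i <;> simp <;> omega

lemma isGoodConnected_affG2 {ℓ₁ : ℕ} (h₁ : 1 ≤ ℓ₁) (hR : R.IsoShape (affG2 ℓ₁)) :
    R.IsGoodConnected := by
  refine isGoodConnected_of_tree hR (by omega) (fun j _ _ => by omega)
    (fun j _ _ => by split_ifs <;> omega) (fun i hi => ?_) ⟨0, by omega, Or.inl rfl⟩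
  rw [linear_balance]
  interval_cases i <;> simp <;> omega

end UnitaryQuiver


/-! ### The Abelian quivers of the list are good -/

namespace QuiverShape

lemma linear_A (n : ℕ) (d u k : ℕ → ℕ) (i j : Fin (n + 1)) : (linear n d u k).A i j =
    if (i : ℕ) = j then -2 else if (j : ℕ) = i + 1 then (d j : ℤ) else
      if (i : ℕ) = j + 1 then (u i : ℤ) else 0 := by
  simp only [linear, tree, Fin.ext_iff]
  split_ifs <;> first | rfl | omega

end QuiverShape

namespace UnitaryQuiver

open QuiverShape

variable {V : Type*} [Fintype V] {R : UnitaryQuiver V}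

/-- If only one edge is not flat, both terms ℓ_b f(b-1) and k_b f(b) of its argument are divisible
by δ = gcd(ℓ₁, k_n) > 1, so their difference cannot be ±1. -/
lemma isGoodConnected_h {n : ℕ} {ℓ k : ℕ → ℕ} (hn : 2 ≤ n) (hpos : ∀ i, 1 ≤ ℓ i ∧ 1 ≤ k i)
    (hgcd : 1 < Nat.gcd (ℓ 1) (k n))
    (hcop : ∀ i j, 1 ≤ i → i ≤ j → j ≤ n → ¬ (i = 1 ∧ j = n) → Nat.Coprime (ℓ i) (k j))
    (hR : R.IsoShape (linear n ℓ k (fun _ => 1))) : R.IsGoodConnected := by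
  obtain ⟨e, hA, hK⟩ := hR
  change V ≃ Fin (n + 1) at e
  have hK1 : ∀ x, R.K x = 1 := hK
  have hc : R.graph.Connected := connected_of_isoShape_tree e hA (fun j _ _ => by omega)
    (fun j _ _ => (hpos j).1)
  refine isGoodConnected_of_dimBound hc (two_le_card_coord_of_nontrivial R
    (x := e.symm ⟨0, by omega⟩) (y := e.symm ⟨1, by omega⟩) (by simp)) fun m => ?_
  have hA' : ∀ x y, R.A x y = if (e x : ℕ) = e y then -2 else
      if (e y : ℕ) = e x + 1 then (ℓ (e y) : ℤ) else
      if (e x : ℕ) = e y + 1 then (k (e x) : ℤ) else 0 := fun x y => by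
    rw [hA]; exact linear_A n ℓ k (fun _ => 1) (e x) (e y)
  rcases isConst_or_single_edge hK1 m with h | h | ⟨x, y, hxy, h1, hflat⟩
  · exact Or.inl h
  · exact Or.inr h
  exfalso
  wlog hlt : (e x : ℕ) < e y generalizing x y
  · refine this y x hxy.symm (by rw [abs_sub_comm]; exact h1) (fun x' y' h2 h3 =>
      hflat x' y' h3 h2) ?_
    have : (e x : ℕ) ≠ e y := fun h => hxy.1 (e.injective (Fin.ext h))
    omega
  have hb : (e y : ℕ) = e x + 1 := by
    by_contra hne
    apply hxy.2
    rw [hA', if_neg (by omega), if_neg hne, if_neg (by omega)]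
  let f : ℕ → ℤ := fun i => if hi : i ≤ n then m (R.coord0 (e.symm ⟨i, by omega⟩)) else 0
  have hf : ∀ x, m (R.coord0 x) = f (e x) := fun x => by
    have : (e x : ℕ) ≤ n := by have := (e x).2; omega
    simp [f, this]
  obtain ⟨b, hb2⟩ : ∃ b, b = (e y : ℕ) := ⟨_, rfl⟩
  have hbn : b ≤ n := by have := (e y).2; omega
  have hstep : ∀ j, 1 ≤ j → j ≤ n → j ≠ b → (ℓ j : ℤ) * f (j - 1) = k j * f j := by
    intro j hj1 hj hjb
    have h2 := hflat (e.symm ⟨j - 1, by omega⟩) (e.symm ⟨j, by omega⟩)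
      (fun h => hjb (by rw [hb2, ← h.2]; simp))
      (fun h => by
        have e1 : j - 1 = e y := by rw [← h.1]; simp
        have e2 : j = e x := by rw [← h.2]; simp
        omega)
    rw [hf, hf, hA', hA'] at h2
    simp only [Equiv.apply_symm_apply] at h2
    rw [if_neg (by omega), if_pos (by omega), if_neg (by omega), if_neg (by omega),
      if_pos (by omega)] at h2
    exact h2
  have hedge : |(ℓ b : ℤ) * f (b - 1) - k b * f b| = 1 := by
    rw [hf, hf, hA', hA', if_neg (by omega), if_pos hb, if_neg (by omega), if_neg (by omega),
      if_pos hb] at h1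
    have e1 : (e x : ℕ) = b - 1 := by omega
    rw [e1, ← hb2] at h1
    exact h1
  set δ := Nat.gcd (ℓ 1) (k n) with hδ
  have hcop1 : ∀ j, 1 ≤ j → j < n → IsCoprime (δ : ℤ) (k j) := fun j h1 h2 =>
    Nat.isCoprime_iff_coprime.2
      (Nat.Coprime.coprime_dvd_left (Nat.gcd_dvd_left _ _) (hcop 1 j le_rfl h1 h2.le (by omega)))
  have hcop2 : ∀ j, 2 ≤ j → j ≤ n → IsCoprime (δ : ℤ) (ℓ j) := fun j h1 h2 =>
    Nat.isCoprime_iff_coprime.2 (Nat.Coprime.coprime_dvd_left (Nat.gcd_dvd_right _ _)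
      (hcop j n (by omega) h2 le_rfl (by omega)).symm)
  -- Divisibility enters at the left end through ℓ₁ and crosses a flat edge j because δ is coprime
  -- to k_j for j < n. In `hdown` it enters at the right end through k_n and crosses because δ is
  -- coprime to ℓ_j for j ≥ 2.
  have hup : ∀ i, i < b → (δ : ℤ) ∣ ℓ (i + 1) * f i := by
    intro i
    induction i with
    | zero =>
      intro _
      exact Dvd.dvd.mul_right (Int.natCast_dvd_natCast.2 (Nat.gcd_dvd_left _ _)) _
    | succ i ih =>
      intro hi
      have h2 := ih (by omega)
      have h3 := hstep (i + 1) (by omega) (by omega) (by omega)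
      rw [Nat.add_sub_cancel] at h3
      rw [h3] at h2
      exact Dvd.dvd.mul_left ((hcop1 (i + 1) (by omega) (by omega)).dvd_of_dvd_mul_left h2) _
  have hdown : ∀ i, b + i ≤ n → (δ : ℤ) ∣ k (n - i) * f (n - i) := by
    intro i
    induction i with
    | zero =>
      intro _
      exact Dvd.dvd.mul_right (Int.natCast_dvd_natCast.2 (Nat.gcd_dvd_right _ _)) _
    | succ i ih =>
      intro hi
      have h2 := ih (by omega)
      have h3 := hstep (n - i) (by omega) (by omega) (by omega)
      rw [← h3, show n - i - 1 = n - (i + 1) by omega] at h2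
      exact Dvd.dvd.mul_left ((hcop2 (n - i) (by omega) (by omega)).dvd_of_dvd_mul_left h2) _
  have h2 := hup (b - 1) (by omega)
  have h3 := hdown (n - b) (by omega)
  rw [show n - (n - b) = b by omega] at h3
  rw [show b - 1 + 1 = b by omega] at h2
  have h4 := dvd_sub h2 h3
  rw [← dvd_abs, hedge] at h4
  have := Int.le_of_dvd one_pos h4
  omega

lemma isGoodConnected_typeA {N ℓ : ℕ} (hN : 2 ≤ N) (hl : 1 ≤ ℓ) (hR : R.IsoShape (typeA N ℓ)) :
    R.IsGoodConnected := by
  obtain ⟨e, hA, hK⟩ := hR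
  change V ≃ Fin (1 + 1) at e
  have hK1 : ∀ x, R.K x = 1 := hK
  have hA2 : ∀ x y, R.A x y = (tree 1 (fun j => j - 1) (fun _ => N * ℓ) (fun _ => N)
    (fun _ => 1)).A (e x) (e y) := hA
  have hc : R.graph.Connected := connected_of_isoShape_tree e hA2 (fun j _ _ => by omega)
    (fun j _ _ => Nat.mul_pos (by omega) hl)
  refine isGoodConnected_of_dimBound hc (two_le_card_coord_of_nontrivial R
    (x := e.symm ⟨0, by omega⟩) (y := e.symm ⟨1, by omega⟩) (by simp)) ?_
  refine dimBound_of_edge_dvd hK1 (N := N) (by omega) fun x y hxy => ?_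
  have h : R.A x y = _ :=
    (hA x y).trans (linear_A 1 (fun _ => N * ℓ) (fun _ => N) (fun _ => 1) (e x) (e y))
  rw [h, if_neg (fun h => hxy.1 (e.injective (Fin.ext h)))]
  split_ifs
  · push_cast; exact dvd_mul_right _ _
  · exact dvd_rfl
  · exact dvd_zero _

open Fin.CommRing in
-- No edge of a cycle is a bridge: the other n edges still join its ends.
lemma isGoodConnected_hbar {n : ℕ} {ℓ k : Fin (n + 1) → ℕ} (hn : 2 ≤ n)
    (hpos : ∀ i, 1 ≤ ℓ i ∧ 1 ≤ k i) (hR : R.IsoShape (cycle n ℓ k)) : R.IsGoodConnected := by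
  obtain ⟨e, hA, hK⟩ := hR
  change V ≃ Fin (n + 1) at e
  have hK1 : ∀ x, R.K x = 1 := hK
  have hA' : ∀ x y, R.A x y = if e x = e y then -2 else if e y = e x + 1 then (ℓ (e x) : ℤ) else
    if e x = e y + 1 then (k (e y) : ℤ) else 0 := hA
  have hcast : ∀ a : ℕ, a < n + 1 → (a : Fin (n + 1)) = 0 → a = 0 := by
    intro a ha h0
    have := congrArg Fin.val h0
    rwa [Fin.val_natCast, Nat.mod_eq_of_lt ha] at this
  have hsucc : ∀ i : Fin (n + 1), i ≠ i + 1 := fun i h => by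
    have := hcast 1 (by omega) (by push_cast; linear_combination -h)
    omega
  have hadj : ∀ i : Fin (n + 1), R.graph.Adj (e.symm i) (e.symm (i + 1)) := by
    intro i
    refine ⟨fun h => hsucc i (e.symm.injective h), ?_⟩
    rw [hA', Equiv.apply_symm_apply, Equiv.apply_symm_apply, if_neg (hsucc i), if_pos rfl]
    have := (hpos i).1
    omega
  have hedge : ∀ x y, R.graph.Adj x y → e y = e x + 1 ∨ e x = e y + 1 := by
    intro x y hxy
    by_contra! hne
    apply hxy.2
    rw [hA', if_neg (fun h => hxy.1 (e.injective h)), if_neg hne.1, if_neg hne.2]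
  have hreach : ∀ (i : Fin (n + 1)) (t : ℕ), t ≤ n →
      (R.graph.deleteEdges {s(e.symm i, e.symm (i + 1))}).Reachable
        (e.symm (i + 1)) (e.symm (i + 1 + (t : Fin (n + 1)))) := by
    intro i t
    induction t with
    | zero => intro _; simp
    | succ t ih =>
      intro ht
      refine (ih (by omega)).trans (SimpleGraph.Adj.reachable ?_)
      rw [SimpleGraph.deleteEdges_adj]
      have e1 : i + 1 + ((t + 1 : ℕ) : Fin (n + 1)) = i + 1 + (t : Fin (n + 1)) + 1 := by
        push_cast; ring
      rw [e1]
      refine ⟨hadj _, fun h => ?_⟩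
      simp only [Set.mem_singleton_iff, Sym2.eq_iff, EmbeddingLike.apply_eq_iff_eq] at h
      rcases h with ⟨h, -⟩ | ⟨h3, h⟩
      · have := hcast (t + 1) (by omega) (by push_cast; linear_combination h)
        omega
      · have := hcast 2 (by omega) (by push_cast; linear_combination h - h3)
        omega
  have hcyc : ∀ i : Fin (n + 1), (R.graph.deleteEdges {s(e.symm i, e.symm (i + 1))}).Reachable
      (e.symm (i + 1)) (e.symm i) := by
    intro i
    have h := hreach i n le_rfl
    have h2 : ((n + 1 : ℕ) : Fin (n + 1)) = 0 := by simp
    have h3 : i + 1 + (n : Fin (n + 1)) = i := by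
      push_cast at h2
      linear_combination h2
    rwa [h3] at h
  have hc : R.graph.Connected := by
    have h0 : ∀ t : ℕ, R.graph.Reachable (e.symm 0) (e.symm (t : Fin (n + 1))) := by
      intro t
      induction t with
      | zero => simp
      | succ t ih =>
        push_cast
        exact ih.trans (hadj _).reachable
    have h1 : ∀ x, R.graph.Reachable (e.symm 0) x := fun x => by
      have := h0 (e x)
      rwa [Fin.cast_val_eq_self, Equiv.symm_apply_apply] at this
    exact (SimpleGraph.connected_iff _).2 ⟨fun x y => (h1 x).symm.trans (h1 y), ⟨e.symm 0⟩⟩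
  refine isGoodConnected_of_dimBound hc (two_le_card_coord_of_nontrivial R (hadj 0).1) ?_
  refine dimBound_of_no_bridge hc hK1 fun x y hxy => ?_
  rcases hedge x y hxy with h | h
  · have h2 := hcyc (e x)
    rw [← h, Equiv.symm_apply_apply, Equiv.symm_apply_apply] at h2
    exact h2.symm
  · have h2 := hcyc (e y)
    rw [← h, Equiv.symm_apply_apply, Equiv.symm_apply_apply, Sym2.eq_swap] at h2
    exact h2

end UnitaryQuiver


/-! ### Listed stars and loops; every listed quiver is good -/

namespace UnitaryQuiver

open QuiverShape

variable {V : Type*} [Fintype V] {R : UnitaryQuiver V}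

lemma isGoodConnected_of_tree_star {n : ℕ} {p d u k : ℕ → ℕ}
    (hR : R.IsoShape (tree n p d u k)) (hn : 1 ≤ n)
    (hp : ∀ j, 1 ≤ j → j ≤ n → p j < j) (hd : ∀ j, 1 ≤ j → j ≤ n → 1 ≤ d j) (c : Fin (n + 1))
    (hkc : k c = 2) (hk : ∀ i : Fin (n + 1), i ≠ c → k i = 1)
    (hA0 : ∀ i j : Fin (n + 1), i ≠ c → j ≠ c → i ≠ j → (tree n p d u k).A i j = 0)
    (h4 : 2 ≤ ∑ j : Fin (n + 1), (tree n p d u k).A c j) : R.IsGoodConnected := by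
  obtain ⟨e, hA, hK⟩ := hR
  change V ≃ Fin (n + 1) at e
  have hA' : ∀ x y, R.A x y = (tree n p d u k).A (show Fin (n + 1) from e x)
    (show Fin (n + 1) from e y) := hA
  have hK' : ∀ x, R.K x = k (e x) := hK
  refine isGoodConnected_of_dimBound (connected_of_isoShape_tree e hA hp hd)
    (two_le_card_coord_of_nontrivial R
    (x := e.symm ⟨0, by omega⟩) (y := e.symm ⟨1, by omega⟩) (by simp)) ?_
  have hne : ∀ x, x ≠ e.symm c → e x ≠ c := fun x hx h => hx (by rw [← h, e.symm_apply_apply])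
  refine dimBound_of_star (z := e.symm c) ?_ ?_ (fun x hx => ?_) (fun x y hx hy hxy => ?_) ?_
  · rw [hK', e.apply_symm_apply, hkc]
  · rw [hA', e.apply_symm_apply]; exact if_pos rfl
  · rw [hK', hk _ (hne x hx)]
  · rw [hA']; exact hA0 _ _ (hne x hx) (hne y hy) (fun h => hxy (e.injective h))
  · rw [← Equiv.sum_comp e.symm]
    refine h4.trans_eq (Finset.sum_congr rfl fun j _ => ?_)
    rw [hA', e.apply_symm_apply, e.apply_symm_apply]

lemma isGoodConnected_typeY {ℓ : ℕ} (hl : 4 ≤ ℓ) (hR : R.IsoShape (typeY ℓ)) :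
    R.IsGoodConnected := by
  refine isGoodConnected_of_tree_star hR le_rfl (fun j _ _ => by omega) (fun j _ _ => by omega)
    0 rfl (fun i hi => ?_) (fun i j hi hj hij => ?_) ?_
  · exact if_neg (fun h => hi (Fin.ext h))
  · omega
  · refine le_trans ?_ (Fin.sum_univ_two _).ge
    simp [tree]
    omega

lemma isGoodConnected_typeJ {a b : ℕ} (hb : 1 ≤ b) (hab : 4 ≤ a + b)
    (hR : R.IsoShape (typeJ a b)) : R.IsGoodConnected := by
  refine isGoodConnected_of_tree_star hR (by omega) (fun j _ _ => by omega)
    (fun j _ _ => by split_ifs <;> omega) 1 rfl (fun i hi => ?_) (fun i j hi hj hij => ?_) ?_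
  · exact if_neg (fun h => hi (Fin.ext h))
  · fin_cases i <;> fin_cases j <;> simp [tree] at hi hj hij ⊢
  · refine le_trans ?_ (Fin.sum_univ_three _).ge
    simp [tree]
    omega

lemma isGoodConnected_loops {g : ℕ} (hg : 1 ≤ g) (hR : R.IsoShape (oneVertex g 2)) :
    R.IsGoodConnected := by
  obtain ⟨e, hA, hK⟩ := hR
  change V ≃ Fin 1 at e
  have hA' : ∀ x y, R.A x y = -2 + 2 * (g : ℤ) := hA
  have hK' : ∀ x, R.K x = 2 := hK
  have : Nonempty V := ⟨e.symm 0⟩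
  have : Subsingleton V := e.subsingleton
  have hc : R.graph.Connected := (SimpleGraph.connected_iff _).2
    ⟨SimpleGraph.Preconnected.of_subsingleton, inferInstance⟩
  -- With one loop Δ vanishes identically and the monopole formula diverges; this quiver is 2 ·
  -- A₀⁽¹⁾, good by convention. With more loops the balance 4 (g - 1) is positive.
  rcases hg.eq_or_lt with rfl | hg
  · exact ⟨hc, Or.inr (Or.inl ⟨2, le_rfl, e, hA, hK⟩)⟩
  have hb : ∀ x, R.balance x = 2 * (2 * (g - 1)) := fun x => by
    rw [balance, Fintype.sum_subsingleton _ x, hA', hK']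
    push_cast
    ring
  refine isGoodConnected_of_dimBound hc ?_ (dimBound_of_balance hc (fun x => ?_) (fun x => ?_)
    ⟨e.symm 0, Or.inr ?_⟩)
  · have hcard : Fintype.card R.Coord = ∑ x, R.K x := by simp
    rw [hcard, Fintype.sum_subsingleton _ (e.symm 0), hK']
  · rw [hb]; omega
  · rw [hb]; exact dvd_mul_right _ _
  · rw [hb]; omega

theorem isGoodConnected_of_isListed {s : QuiverShape} (hs : s.IsListed) (hR : R.IsoShape s) :
    R.IsGoodConnected := by
  cases hs with
  | typeA N ℓ hN hl => exact isGoodConnected_typeA hN hl hR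
  | h n ℓ k hn hpos _ hgcd hcop => exact isGoodConnected_h hn hpos hgcd hcop hR
  | hbar n ℓ k hn hpos => exact isGoodConnected_hbar hn hpos hR
  | loops g hg => exact isGoodConnected_loops hg hR
  | typeY ℓ hl => exact isGoodConnected_typeY hl hR
  | gc n hn => exact isGoodConnected_gc hn hR
  | gb n hn => exact isGoodConnected_gb hn hR
  | gd n ℓ₁ ℓ₂ hn h₁ h₂ => exact isGoodConnected_gd hn h₁ h₂ hR
  | J23 => exact isGoodConnected_typeJ (by omega) (by omega) hR
  | J33 => exact isGoodConnected_typeJ (by omega) (by omega) hR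
  | affA2even n hn => exact isGoodConnected_affA2even hn hR
  | affA2odd n ℓ₁ ℓ₂ hn h₁ h₂ => exact isGoodConnected_affA2odd hn h₁.pos h₂.pos hR
  | affB n ℓ₁ ℓ₂ hn h₁ h₂ => exact isGoodConnected_affB hn h₁ h₂ hR
  | affD n ℓ₁ ℓ₂ ℓ₃ ℓ₄ hn h₁ h₂ h₃ h₄ => exact isGoodConnected_affD hn h₁ h₂ h₃ h₄ hR
  | affD2 n hn => exact isGoodConnected_affD2 hn hR
  | affD43 ℓ₁ h₁ => exact isGoodConnected_affD43 h₁ hR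
  | affE6 ℓ₁ ℓ₂ ℓ₃ h₁ h₂ h₃ => exact isGoodConnected_affE6 h₁ h₂ h₃ hR
  | affE62 ℓ₁ h₁ => exact isGoodConnected_affE62 h₁.pos hR
  | affE7 ℓ₁ ℓ₂ h₁ h₂ => exact isGoodConnected_affE7 h₁ h₂ hR
  | affE8 ℓ hl => exact isGoodConnected_affE8 hl hR
  | affF4 ℓ₁ ℓ₂ h₁ h₂ => exact isGoodConnected_affF4 h₁ h₂.pos hR
  | affG2 ℓ₁ h₁ => exact isGoodConnected_affG2 h₁ hR

end UnitaryQuiver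

/-! ### Embeddings of shapes and decay products -/

namespace QuiverShape

/-- `s.Embeds Q`: the shape `s` is isomorphic to a subquiver of `Q`. -/
def Embeds {V : Type*} (s : QuiverShape) (Q : UnitaryQuiver V) : Prop :=
  ∃ φ : Fin s.size ↪ V, (∀ i j, i ≠ j → Q.A (φ i) (φ j) = s.A i j) ∧
    (∀ i, 0 < s.K i ∧ s.K i ≤ Q.K (φ i)) ∧
    ∀ i, s.A i i = if s.K i = 1 then -2 else Q.A (φ i) (φ i)

end QuiverShape

namespace UnitaryQuiver

open QuiverShape

lemma exists_subquiver_of_embeds {V : Type*} {Q : UnitaryQuiver V} {s : QuiverShape}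
    (h : s.Embeds Q) : ∃ S : Q.Subquiver, S.toQuiver.IsoShape s := by
  obtain ⟨φ, hA, hK, hd⟩ := h
  have hext : ∀ i, Function.extend φ s.K (fun _ => 0) (φ i) = s.K i :=
    fun i => φ.injective.extend_apply _ _ i
  have hext' : ∀ x, (¬ ∃ i, φ i = x) → Function.extend φ s.K (fun _ => 0) x = 0 :=
    fun x hx => Function.extend_apply' _ _ _ hx
  let S : Q.Subquiver := ⟨Function.extend φ s.K (fun _ => 0), fun x => by
    by_cases hx : ∃ i, φ i = x
    · obtain ⟨i, rfl⟩ := hx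
      rw [hext]; exact (hK i).2
    · rw [hext' x hx]; exact Nat.zero_le _⟩
  have hS : ∀ i, S.K (φ i) = s.K i := hext
  let f : Fin s.size → {x : V // 0 < S.K x} := fun i => ⟨φ i, by rw [hS]; exact (hK i).1⟩
  have hf : Function.Bijective f := by
    refine ⟨fun i j hij => φ.injective (congrArg Subtype.val hij), fun x => ?_⟩
    by_cases hx : ∃ i, φ i = x
    · obtain ⟨i, hi⟩ := hx
      exact ⟨i, Subtype.ext hi⟩
    · have := x.2
      rw [show S.K x = 0 from hext' x hx] at this
      omega
  let E := Equiv.ofBijective f hf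
  have hE : ∀ i, ((E i : {x : V // 0 < S.K x}) : V) = φ i := fun i => rfl
  refine ⟨S, E.symm, fun x y => ?_, fun x => ?_⟩
  · obtain ⟨i, rfl⟩ := E.surjective x
    obtain ⟨j, rfl⟩ := E.surjective y
    rw [E.symm_apply_apply, E.symm_apply_apply]
    simp only [Subquiver.toQuiver, hE, hS, EmbeddingLike.apply_eq_iff_eq]
    by_cases hij : i = j
    · subst hij
      rw [hd]
      simp
    · rw [if_neg (by tauto), hA i j hij]
  · obtain ⟨i, rfl⟩ := E.surjective x
    rw [E.symm_apply_apply]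
    exact hS i

/-- An embedding into a subquiver is an embedding into the quiver. -/
lemma embeds_of_subquiver {V : Type*} {Q : UnitaryQuiver V} {S : Q.Subquiver} {s : QuiverShape}
    (h : s.Embeds S.toQuiver) : s.Embeds Q := by
  obtain ⟨φ, hA, hK, hd⟩ := h
  refine ⟨φ.trans (Function.Embedding.subtype _), fun i j hij => ?_, fun i => ?_, fun i => ?_⟩
  · rw [← hA i j hij]
    have : φ i ≠ φ j := fun h => hij (φ.injective h)
    simp [Subquiver.toQuiver, this]
  · exact ⟨(hK i).1, (hK i).2.trans (S.le _)⟩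
  · rw [hd]
    have hk := hK i
    simp only [Subquiver.toQuiver] at hk ⊢
    by_cases h1 : s.K i = 1
    · simp [h1]
    · have h2 : S.K (φ i) ≠ 1 := by omega
      simp [h1, h2]

theorem exists_isDecayProduct_of_embeds {V : Type*} [Fintype V] {Q : UnitaryQuiver V}
    {s : QuiverShape} (hs : s.IsListed) (h : s.Embeds Q) :
    ∃ S : Q.Subquiver, Q.IsDecayProduct S ∧
      ∃ s : QuiverShape, s.IsListed ∧ S.toQuiver.IsoShape s := by
  obtain ⟨S, hS⟩ := exists_subquiver_of_embeds h
  refine ⟨S, ⟨?_, fun x => ?_⟩, s, hs, hS⟩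
  · intro T hT
    obtain rfl := Multiset.mem_singleton.1 hT
    exact isGoodConnected_of_isListed hs hS
  · rw [Multiset.map_singleton, Multiset.sum_singleton]
    exact S.le x

end UnitaryQuiver


/-! ### Exhibiting trees as subquivers -/

namespace UnitaryQuiver

open QuiverShape

variable {V : Type*} {Q : UnitaryQuiver V}

lemma A_pos_of_adj {x y : V} (h : Q.graph.Adj x y) : 0 < Q.A x y := (Q.pos_and_dvd x y h.1 h.2).1

lemma A_eq_zero_of_not_adj {x y : V} (hxy : x ≠ y) (h : ¬ Q.graph.Adj x y) : Q.A x y = 0 := by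
  by_contra h0
  exact h ⟨hxy, h0⟩

lemma embeds_of_isoShape_smul {N : ℕ} {s : QuiverShape} (hN : 1 ≤ N) (hd : ∀ i, s.A i i = -2)
    (hK : ∀ i, 0 < s.K i) (h : Q.IsoShape (smul N s)) : s.Embeds Q := by
  obtain ⟨e, hA, hK'⟩ := h
  change V ≃ Fin s.size at e
  have hA2 : ∀ i j : Fin s.size, Q.A (e.symm i) (e.symm j) = s.A i j := fun i j => by
    refine (hA _ _).trans ?_
    change s.A (e (e.symm i)) (e (e.symm j)) = s.A i j
    rw [e.apply_symm_apply, e.apply_symm_apply]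
  have hK2 : ∀ i : Fin s.size, Q.K (e.symm i) = N * s.K i := fun i => by
    refine (hK' _).trans ?_
    change N * s.K (e (e.symm i)) = N * s.K i
    rw [e.apply_symm_apply]
  refine ⟨e.symm.toEmbedding, fun i j _ => hA2 i j, fun i => ⟨hK i, ?_⟩, fun i => ?_⟩
  · exact (Nat.le_mul_of_pos_left _ hN).trans_eq (hK2 i).symm
  · split_ifs with h
    · exact hd i
    · exact (hA2 i i).symm

lemma exists_listed_of_isSimplyLacedAffine {N : ℕ} {s : QuiverShape} (hN : 1 ≤ N)
    (hs : s.IsSimplyLacedAffine) (h : Q.IsoShape (smul N s)) :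
    ∃ s : QuiverShape, s.IsListed ∧ s.Embeds Q := by
  cases hs with
  | A1 =>
    exact ⟨_, .typeA 2 1 le_rfl le_rfl, embeds_of_isoShape_smul hN (fun i => if_pos rfl)
      (fun i => one_pos) h⟩
  | A n hn =>
    exact ⟨_, .hbar n (fun _ => 1) (fun _ => 1) hn (fun _ => ⟨le_rfl, le_rfl⟩) (fun _ => Or.inl rfl)
      rfl (fun _ _ _ _ => Nat.coprime_one_left _),
      embeds_of_isoShape_smul hN (fun i => if_pos rfl) (fun i => one_pos) h⟩
  | D n hn =>
    refine ⟨_, .affD n 1 1 1 1 hn le_rfl le_rfl le_rfl le_rfl (by simp),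
      embeds_of_isoShape_smul hN (fun i => if_pos rfl) (fun i => ?_) h⟩
    simp only [affD, tree]
    split_ifs <;> omega
  | E6 =>
    refine ⟨_, .affE6 1 1 1 le_rfl le_rfl le_rfl (by simp),
      embeds_of_isoShape_smul hN (fun i => if_pos rfl) (fun i => ?_) h⟩
    change Fin 7 at i
    fin_cases i <;> simp [affE6, tree]
  | E7 =>
    refine ⟨_, .affE7 1 1 le_rfl le_rfl (by simp),
      embeds_of_isoShape_smul hN (fun i => if_pos rfl) (fun i => ?_) h⟩
    change Fin 8 at i
    fin_cases i <;> simp [affE7, tree]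
  | E8 =>
    refine ⟨_, .affE8 1 le_rfl,
      embeds_of_isoShape_smul hN (fun i => if_pos rfl) (fun i => ?_) h⟩
    change Fin 9 at i
    fin_cases i <;> simp [affE8, tree]

lemma exists_listed_of_oneVertex {g N : ℕ} (hg : 1 ≤ g) (hN : 2 ≤ N) {x : V} (hK : N ≤ Q.K x)
    (hA : Q.A x x = -2 + 2 * (g : ℤ)) : ∃ s : QuiverShape, s.IsListed ∧ s.Embeds Q :=
  ⟨_, .loops g hg, ⟨fun _ => x, fun i j _ => @Subsingleton.elim (Fin 1) _ i j⟩,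
    fun i j h => absurd (@Subsingleton.elim (Fin 1) _ i j) h,
    fun _ => ⟨two_pos, hN.trans hK⟩, fun _ => hA.symm⟩

theorem embeds_tree_of_injOn {n : ℕ} {p d u k : ℕ → ℕ} (v : ℕ → V)
    (hinj : ∀ i j, i < j → j ≤ n → v i ≠ v j)
    (hd : ∀ j, 1 ≤ j → j ≤ n → Q.A (v (p j)) (v j) = d j)
    (hu : ∀ j, 1 ≤ j → j ≤ n → Q.A (v j) (v (p j)) = u j)
    (hne : ∀ i j, i < j → j ≤ n → i ≠ p j → ¬ Q.graph.Adj (v i) (v j))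
    (hk : ∀ j, j ≤ n → 0 < k j ∧ k j ≤ Q.K (v j))
    (hdiag : ∀ j, j ≤ n → k j ≠ 1 → Q.A (v j) (v j) = -2) : (tree n p d u k).Embeds Q := by
  have hinj' : ∀ i j, i ≤ n → j ≤ n → v i = v j → i = j := fun i j hi hj h => by
    rcases lt_trichotomy i j with h1 | h1 | h1
    · exact absurd h (hinj i j h1 hj)
    · exact h1
    · exact absurd h.symm (hinj j i h1 hi)
  have hle : ∀ i : Fin (n + 1), (i : ℕ) ≤ n := fun i => Nat.lt_succ_iff.1 i.2
  refine ⟨⟨fun i : Fin (n + 1) => v i, fun i j h => Fin.ext (hinj' _ _ (hle i) (hle j) h)⟩,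
    fun (i j : Fin (n + 1)) hij => ?_, fun i => hk _ (hle i), fun i => ?_⟩
  · have hij' : (i : ℕ) ≠ j := fun h => hij (Fin.ext h)
    refine Eq.trans ?_ (if_neg hij).symm
    change Q.A (v i) (v j) = if (j : ℕ) ≠ 0 ∧ p j = i then (d j : ℤ) else
      if (i : ℕ) ≠ 0 ∧ p i = j then (u i : ℤ) else 0
    split_ifs with h1 h2
    · rw [← h1.2, hd j (by omega) (hle j)]
    · rw [← h2.2, hu i (by omega) (hle i)]
    · refine A_eq_zero_of_not_adj (fun h => hij' (hinj' _ _ (hle i) (hle j) h)) ?_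
      rcases lt_or_gt_of_ne hij' with h | h
      · exact hne _ _ h (hle j) (fun h3 => h1 ⟨by omega, h3.symm⟩)
      · exact fun ha => hne _ _ h (hle i) (fun h3 => h2 ⟨by omega, h3.symm⟩) ha.symm
  · refine (if_pos rfl).trans ?_
    split_ifs with h
    · rfl
    · exact (hdiag _ (hle i) h).symm

/-- In an acyclic graph, vertices attached one by one to previous ones without backtracking are
distinct, and are joined by no further edges. -/
lemma injOn_and_not_adj_of_isAcyclic {G : SimpleGraph V} (hac : G.IsAcyclic) {n : ℕ} {p : ℕ → ℕ}
    (v : ℕ → V) (hp : ∀ j, 1 ≤ j → j ≤ n → p j < j)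
    (hadj : ∀ j, 1 ≤ j → j ≤ n → G.Adj (v (p j)) (v j))
    (hsib : ∀ i j, 1 ≤ i → i < j → j ≤ n → p i = p j → v i ≠ v j)
    (hgp : ∀ j, 1 ≤ j → j ≤ n → p j ≠ 0 → v j ≠ v (p (p j))) :
    (∀ i j, i < j → j ≤ n → v i ≠ v j) ∧
      ∀ i j, i < j → j ≤ n → i ≠ p j → ¬ G.Adj (v i) (v j) := by
  -- An extra edge between two placed vertices would not be a bridge, since the edges from each
  -- vertex to its parent already connect everything to v 0.
  have key : ∀ m, m ≤ n → (∀ i j, i < j → j ≤ m → v i ≠ v j) →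
      ∀ i j, i < j → j ≤ m → i ≠ p j → ¬ G.Adj (v i) (v j) := by
    intro m hm hinj i j hij hj hip hadj'
    have hinj' : ∀ a b, a ≤ m → b ≤ m → v a = v b → a = b := fun a b ha hb h => by
      rcases lt_trichotomy a b with h1 | h1 | h1
      · exact absurd h (hinj a b h1 hb)
      · exact h1
      · exact absurd h.symm (hinj b a h1 ha)
    have hbr := SimpleGraph.isAcyclic_iff_forall_adj_isBridge.1 hac hadj'
    rw [SimpleGraph.isBridge_iff] at hbr
    have hreach : ∀ a, a ≤ m → (G.deleteEdges {s(v i, v j)}).Reachable (v 0) (v a) := by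
      intro a
      induction a using Nat.strong_induction_on with
      | _ a ih =>
        intro ha
        rcases Nat.eq_zero_or_pos a with rfl | ha0
        · exact SimpleGraph.Reachable.refl _
        · have hpa := hp a ha0 (ha.trans hm)
          refine (ih (p a) hpa (by omega)).trans (SimpleGraph.Adj.reachable ?_)
          rw [SimpleGraph.deleteEdges_adj]
          refine ⟨hadj a ha0 (ha.trans hm), fun h => ?_⟩
          simp only [Set.mem_singleton_iff, Sym2.eq_iff] at h
          rcases h with ⟨h1, h2⟩ | ⟨h1, h2⟩
          · have e1 := hinj' _ _ (by omega) (by omega) h1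
            have e2 := hinj' _ _ (by omega) (by omega) h2
            subst e2
            exact hip e1.symm
          · have e1 := hinj' _ _ (by omega) (by omega) h1
            have e2 := hinj' _ _ (by omega) (by omega) h2
            omega
    exact hbr ((hreach i (by omega)).symm.trans (hreach j hj))
  -- If the new vertex v (m+1) equals an old v i, its parent is adjacent to v i. By `key` this is an
  -- old tree edge, so the parent is either the parent of i (a repeated sibling) or a child of i
  -- (backtracking); both are excluded.
  have hinj : ∀ m, m ≤ n → ∀ i j, i < j → j ≤ m → v i ≠ v j := by
    intro m
    induction m with
    | zero => intro _ i j h1 h2; omega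
    | succ m ih =>
      intro hm i j hij hj
      rcases Nat.lt_or_ge j (m + 1) with hjm | hjm
      · exact ih (by omega) i j hij (by omega)
      obtain rfl : j = m + 1 := by omega
      intro heq
      have hpj := hp (m + 1) (by omega) hm
      have ha := hadj (m + 1) (by omega) hm
      rw [← heq] at ha
      have hk := key m (by omega) (ih (by omega))
      rcases lt_trichotomy (p (m + 1)) i with h | h | h
      · by_cases h2 : p (m + 1) = p i
        · exact hsib i (m + 1) (by omega) (by omega) hm h2.symm heq
        · exact hk _ _ h (by omega) h2 ha
      · rw [h] at ha
        exact ha.ne rfl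
      · by_cases h2 : i = p (p (m + 1))
        · exact hgp (m + 1) (by omega) hm (by omega) (by rw [← h2]; exact heq.symm)
        · exact hk _ _ h (by omega) h2 ha.symm
  exact ⟨hinj n le_rfl, key n le_rfl (hinj n le_rfl)⟩

theorem embeds_tree {n : ℕ} {p d u k : ℕ → ℕ} (hac : Q.graph.IsAcyclic) (hl : ∀ x, Q.A x x = -2)
    (v : ℕ → V) (hp : ∀ j, 1 ≤ j → j ≤ n → p j < j)
    (hd0 : ∀ j, 1 ≤ j → j ≤ n → 1 ≤ d j)
    (hd : ∀ j, 1 ≤ j → j ≤ n → Q.A (v (p j)) (v j) = d j)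
    (hu : ∀ j, 1 ≤ j → j ≤ n → Q.A (v j) (v (p j)) = u j)
    (hsib : ∀ i j, 1 ≤ i → i < j → j ≤ n → p i = p j → v i ≠ v j)
    (hgp : ∀ j, 1 ≤ j → j ≤ n → p j ≠ 0 → v j ≠ v (p (p j)))
    (hk : ∀ j, j ≤ n → 0 < k j ∧ k j ≤ Q.K (v j)) : (tree n p d u k).Embeds Q := by
  have hadj : ∀ j, 1 ≤ j → j ≤ n → Q.graph.Adj (v (p j)) (v j) := fun j h1 h2 => by
    have h3 := hd j h1 h2
    have h4 := hd0 j h1 h2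
    refine ⟨fun h => ?_, by omega⟩
    rw [h, hl] at h3
    omega
  obtain ⟨h1, h2⟩ := injOn_and_not_adj_of_isAcyclic hac v hp hadj hsib hgp
  exact embeds_tree_of_injOn v h1 hd hu h2 hk fun j _ _ => hl _

end UnitaryQuiver

/-- On a shortest walk the vertices in positions i ≤ j are at distance j - i, so there are neither
repetitions nor chords. -/
lemma SimpleGraph.Reachable.exists_geodesic {V : Type*} {G : SimpleGraph V} {x y : V}
    (h : G.Reachable x y) : ∃ (n : ℕ) (v : ℕ → V), v 0 = x ∧ v n = y ∧
      (∀ i, i < n → G.Adj (v i) (v (i + 1))) ∧ (∀ i j, i < j → j ≤ n → v i ≠ v j) ∧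
      ∀ i j, i + 1 < j → j ≤ n → ¬ G.Adj (v i) (v j) := by
  obtain ⟨p, hp⟩ := h.exists_walk_length_eq_dist
  have key : ∀ i j, i ≤ j → j ≤ p.length → j ≤ i + G.dist (p.getVert i) (p.getVert j) := by
    intro i j hij hj
    obtain ⟨w, hw⟩ := SimpleGraph.Reachable.exists_walk_length_eq_dist
      (G := G) (u := p.getVert i) (v := p.getVert j)
      ((p.take i).reverse.append (p.take j)).reachable
    have := SimpleGraph.dist_le (((p.take i).append w).append (p.drop j))
    simp only [SimpleGraph.Walk.length_append, SimpleGraph.Walk.take_length,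
      SimpleGraph.Walk.drop_length] at this
    omega
  refine ⟨p.length, p.getVert, p.getVert_zero, p.getVert_length,
    fun i hi => p.adj_getVert_succ hi, fun i j hij hj he => ?_, fun i j hij hj ha => ?_⟩
  · have := key i j hij.le hj
    rw [he, SimpleGraph.dist_self] at this
    omega
  · have := key i j (by omega) hj
    rw [SimpleGraph.dist_eq_one_iff_adj.2 ha] at this
    omega


/-! ### Quivers without listed subquiver: thin trees with coprime path ends -/

namespace UnitaryQuiver

open QuiverShape

variable {V : Type*} {Q : UnitaryQuiver V}

/-- No quiver of the classification list is a subquiver of `Q`. -/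
def NoListed (Q : UnitaryQuiver V) : Prop := ∀ s : QuiverShape, s.IsListed → ¬ s.Embeds Q

namespace NoListed

lemma loopless (h : Q.NoListed) (x : V) : Q.A x x = -2 := by
  by_cases hK : Q.K x = 1
  · exact Q.diag_of_weight_one x hK
  obtain ⟨g, hg⟩ := Q.diag x
  rcases Nat.eq_zero_or_pos g with rfl | hg0
  · simpa using hg
  · have := Q.weight_pos x
    obtain ⟨s, hs, he⟩ := exists_listed_of_oneVertex hg0 le_rfl (show 2 ≤ Q.K x by omega) hg
    exact absurd he (h s hs)

/-- Of two multiplicities greater than 1 one divides the other, say N divides N ℓ; this is A_{N-1}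
on two vertices of weight one. -/
lemma thin (h : Q.NoListed) {x y : V} (hxy : Q.graph.Adj x y) : Q.A x y = 1 ∨ Q.A y x = 1 := by
  wlog hd : Q.A y x ∣ Q.A x y generalizing x y
  · exact (this hxy.symm ((Q.pos_and_dvd x y hxy.1 hxy.2).2.2.resolve_right hd)).symm
  by_contra! hne
  have h1 := A_pos_of_adj hxy
  have h2 := A_pos_of_adj hxy.symm
  obtain ⟨c, hc⟩ := hd
  have hc0 : 0 < c := by
    by_contra! h0
    have := mul_nonpos_of_nonneg_of_nonpos h2.le h0
    omega
  refine h _ (.typeA (Q.A y x).toNat c.toNat (by omega) (by omega)) ?_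
  refine embeds_tree_of_injOn (fun i => if i = 0 then x else y) ?_ ?_ ?_ ?_ ?_ ?_
  · intro i j hij hj
    obtain rfl : i = 0 := by omega
    obtain rfl : j = 1 := by omega
    simpa using hxy.1
  · intro j h1 h2
    obtain rfl : j = 1 := by omega
    push_cast
    rw [Int.toNat_of_nonneg (by omega), Int.toNat_of_nonneg (by omega)]
    simpa using hc
  · intro j h1 h2
    obtain rfl : j = 1 := by omega
    rw [Int.toNat_of_nonneg (by omega)]
    simp
  · intro i j hij hj hne
    omega
  · exact fun j _ => ⟨one_pos, Q.weight_pos _⟩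
  · exact fun j _ h => absurd rfl h

lemma coprime_of_adj (h : Q.NoListed) {x y : V} (hxy : Q.graph.Adj x y) :
    IsCoprime (Q.A x y) (Q.A y x) := by
  rcases h.thin hxy with h1 | h1 <;> rw [h1]
  · exact isCoprime_one_left
  · exact isCoprime_one_right

/-- A shortest counterexample is an h_{n,δ,σ}: induction gives the coprimality of the ends of all
proper subpaths, which are the other conditions of that family, while δ > 1 is the failure itself.
-/
lemma coprime_of_induced_path (h : Q.NoListed) {n : ℕ} (hn : 1 ≤ n) (v : ℕ → V)
    (hadj : ∀ i, i < n → Q.graph.Adj (v i) (v (i + 1)))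
    (hinj : ∀ i j, i < j → j ≤ n → v i ≠ v j)
    (hind : ∀ i j, i + 1 < j → j ≤ n → ¬ Q.graph.Adj (v i) (v j)) :
    IsCoprime (Q.A (v 0) (v 1)) (Q.A (v n) (v (n - 1))) := by
  induction n using Nat.strong_induction_on generalizing v with
  | _ n ih =>
    rcases hn.eq_or_lt with rfl | hn
    · exact h.coprime_of_adj (hadj 0 (by omega))
    by_contra hcop
    have hadj' : ∀ j, 1 ≤ j → j ≤ n → Q.graph.Adj (v (j - 1)) (v j) := fun j h1 h2 => by
      have := hadj (j - 1) (by omega)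
      rwa [Nat.sub_add_cancel h1] at this
    have hsub : ∀ i j, 1 ≤ i → i ≤ j → j ≤ n → ¬ (i = 1 ∧ j = n) →
        IsCoprime (Q.A (v (i - 1)) (v i)) (Q.A (v j) (v (j - 1))) := by
      intro i j h1 h2 h3 h4
      have := ih (j + 1 - i) (by omega) (by omega) (fun s => v (i - 1 + s))
        (fun s hs => hadj _ (by omega)) (fun s t hst ht => hinj _ _ (by omega) (by omega))
        (fun s t hst ht => hind _ _ (by omega) (by omega))
      rwa [add_zero, Nat.sub_add_cancel h1, show i - 1 + (j + 1 - i) = j by omega,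
        show i - 1 + (j + 1 - i - 1) = j - 1 by omega] at this
    -- The value 1 outside 1, …, n keeps the conditions of the family that are imposed at all
    -- indices.
    let ℓ : ℕ → ℕ := fun i => if 1 ≤ i ∧ i ≤ n then (Q.A (v (i - 1)) (v i)).toNat else 1
    let k : ℕ → ℕ := fun i => if 1 ≤ i ∧ i ≤ n then (Q.A (v i) (v (i - 1))).toNat else 1
    have hℓ : ∀ j, 1 ≤ j → j ≤ n → (ℓ j : ℤ) = Q.A (v (j - 1)) (v j) := fun j h1 h2 => by
      simp only [ℓ, if_pos (And.intro h1 h2)]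
      exact Int.toNat_of_nonneg (A_pos_of_adj (hadj' j h1 h2)).le
    have hk : ∀ j, 1 ≤ j → j ≤ n → (k j : ℤ) = Q.A (v j) (v (j - 1)) := fun j h1 h2 => by
      simp only [k, if_pos (And.intro h1 h2)]
      exact Int.toNat_of_nonneg (A_pos_of_adj (hadj' j h1 h2).symm).le
    refine h _ (.h n ℓ k (by omega) (fun i => ?_) (fun i => ?_) ?_ ?_)
      (embeds_tree_of_injOn v hinj (fun j h1 h2 => (hℓ j h1 h2).symm)
      (fun j h1 h2 => (hk j h1 h2).symm) (fun i j hij hj hne => hind i j (by omega) hj)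
      (fun j _ => ⟨one_pos, Q.weight_pos _⟩) fun j _ h => absurd rfl h)
    · by_cases hi : 1 ≤ i ∧ i ≤ n
      · have h1 := A_pos_of_adj (hadj' i hi.1 hi.2)
        have h2 := A_pos_of_adj (hadj' i hi.1 hi.2).symm
        rw [← hℓ i hi.1 hi.2] at h1
        rw [← hk i hi.1 hi.2] at h2
        omega
      · simp [ℓ, k, hi]
    · by_cases hi : 1 ≤ i ∧ i ≤ n
      · have := h.thin (hadj' i hi.1 hi.2)
        rw [← hℓ i hi.1 hi.2, ← hk i hi.1 hi.2] at this
        omega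
      · simp [ℓ, hi]
    · by_contra hle
      have h1 := hℓ 1 le_rfl (by omega)
      have h2 := hk n (by omega) le_rfl
      rw [Nat.sub_self] at h1
      rw [← h1, ← h2, Nat.isCoprime_iff_coprime] at hcop
      have h3 : (ℓ 1).gcd (k n) ≠ 0 := fun h0 => by
        have h4 := (Nat.gcd_eq_zero_iff.1 h0).1
        have := A_pos_of_adj (hadj 0 (by omega))
        rw [zero_add] at this
        omega
      apply hcop
      rw [Nat.Coprime]
      omega
    · intro i j h1 h2 h3 h4
      have := hsub i j h1 h2 h3 h4
      rwa [← hℓ i h1 (by omega), ← hk j (by omega) h3, Nat.isCoprime_iff_coprime] at this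

open Fin.CommRing in
-- Such a cycle is an h̄_{n,σ}. The equality of the products of multiplicities telescopes from the
-- length function, and the coprimality conditions come from proper induced subpaths of the cycle.
lemma not_induced_cycle (h : Q.NoListed) {n : ℕ} (hn : 2 ≤ n) (φ : Fin (n + 1) ↪ V)
    (hadj : ∀ i, Q.graph.Adj (φ i) (φ (i + 1)))
    (hind : ∀ i j, Q.graph.Adj (φ i) (φ j) → j = i + 1 ∨ i = j + 1) : False := by
  have hcast : ∀ a : ℕ, a < n + 1 → (a : Fin (n + 1)) = 0 → a = 0 := by
    intro a ha h0
    have := congrArg Fin.val h0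
    rwa [Fin.val_natCast, Nat.mod_eq_of_lt ha] at this
  let ℓ : Fin (n + 1) → ℕ := fun i => (Q.A (φ i) (φ (i + 1))).toNat
  let k : Fin (n + 1) → ℕ := fun i => (Q.A (φ (i + 1)) (φ i)).toNat
  have hℓ : ∀ i, (ℓ i : ℤ) = Q.A (φ i) (φ (i + 1)) := fun i =>
    Int.toNat_of_nonneg (A_pos_of_adj (hadj i)).le
  have hk : ∀ i, (k i : ℤ) = Q.A (φ (i + 1)) (φ i) := fun i =>
    Int.toNat_of_nonneg (A_pos_of_adj (hadj i).symm).le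
  refine h _ (.hbar n ℓ k hn (fun i => ?_) (fun i => ?_) ?_ ?_)
    ⟨φ, fun (i j : Fin (n + 1)) hij => ?_, fun i => ⟨one_pos, Q.weight_pos _⟩, fun i => ?_⟩
  · have h1 := A_pos_of_adj (hadj i)
    have h2 := A_pos_of_adj (hadj i).symm
    rw [← hℓ] at h1
    rw [← hk] at h2
    omega
  · have := h.thin (hadj i)
    rw [← hℓ, ← hk] at this
    omega
  · obtain ⟨L, hL, hA⟩ := Q.length_function
    have h1 : ∏ i, ((k i : ℤ) * L (φ i)) = ∏ i, ((ℓ i : ℤ) * L (φ (i + 1))) :=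
      Finset.prod_congr rfl fun i _ => by rw [hk, hℓ]; exact hA _ _
    have h3 : ∏ i, (L (φ (i + 1)) : ℤ) = ∏ i, (L (φ i) : ℤ) :=
      Equiv.prod_comp (Equiv.addRight (1 : Fin (n + 1))) (fun i => (L (φ i) : ℤ))
    rw [Finset.prod_mul_distrib, Finset.prod_mul_distrib, h3] at h1
    have h2 := mul_right_cancel₀ (Finset.prod_ne_zero_iff.2 fun i _ => by
      have := hL (φ i); omega) h1
    exact_mod_cast h2
  · intro i j hij hij2
    -- The path from i to j + 1 in the positive direction has t + 1 edges. The two excluded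
    -- differences say t ≠ n and t ≠ n - 1, so it omits at least one vertex of the cycle and is
    -- induced.
    obtain ⟨t, ht⟩ : ∃ t : ℕ, t = ((j - i : Fin (n + 1)) : ℕ) := ⟨_, rfl⟩
    have hj : j = i + (t : Fin (n + 1)) := by
      rw [ht, Fin.cast_val_eq_self]; ring
    have htn : t < n + 1 := ht ▸ (j - i).2
    have hnn : (n : Fin (n + 1)) + 1 = 0 := by
      have : ((n + 1 : ℕ) : Fin (n + 1)) = 0 := by simp
      push_cast at this
      exact this
    have ht1 : t ≠ n := fun h0 => hij (by rw [hj, h0]; linear_combination -hnn)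
    have ht2 : t + 1 ≠ n := fun h0 => hij2 (by
      have h1 := congrArg (Nat.cast : ℕ → Fin (n + 1)) h0
      push_cast at h1
      rw [hj]; linear_combination -hnn - h1)
    have hdiff : ∀ s s' : ℕ, s ≤ s' → s' < s + (n + 1) →
        ((s : ℕ) : Fin (n + 1)) = s' → s = s' := by
      intro s s' h1 h2 h3
      have := hcast (s' - s) (by omega) (by rw [Nat.cast_sub h1, h3, sub_self])
      omega
    have := h.coprime_of_induced_path (n := t + 1) (by omega)
      (fun s => φ (i + (s : Fin (n + 1)))) (fun s _ => by
        have := hadj (i + (s : Fin (n + 1)))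
        push_cast
        rwa [← add_assoc]) (fun s s' hs hs' he => by
        have := hdiff s s' hs.le (by omega) (add_left_cancel (φ.injective he))
        omega) (fun s s' hs hs' ha => by
        rcases hind _ _ ha with h1 | h1
        · have := hdiff (s + 1) s' hs.le (by omega) (by push_cast; linear_combination -h1)
          omega
        · have := hdiff s (s' + 1) (by omega) (by omega) (by push_cast; linear_combination h1)
          omega)
    simp only [Nat.cast_zero, add_zero, Nat.cast_one, Nat.add_sub_cancel] at this
    rw [Nat.cast_add, Nat.cast_one, ← add_assoc, ← hj, ← hℓ, ← hk,
      Nat.isCoprime_iff_coprime] at this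
    exact this
  · refine Eq.trans ?_ (if_neg hij).symm
    change Q.A (φ i) (φ j) = if j = i + 1 then (ℓ i : ℤ) else if i = j + 1 then (k j : ℤ) else 0
    split_ifs with h1 h2
    · rw [hℓ, h1]
    · rw [hk, h2]
    · refine A_eq_zero_of_not_adj (fun h => hij (φ.injective h)) fun ha => ?_
      rcases hind _ _ ha with h3 | h3
      · exact h1 h3
      · exact h2 h3
  · exact if_pos rfl

/-- If an edge is not a bridge, a geodesic between its ends in the graph without it closes up to a
chordless cycle of length at least 3. -/
theorem isAcyclic (h : Q.NoListed) : Q.graph.IsAcyclic := by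
  rw [SimpleGraph.isAcyclic_iff_forall_adj_isBridge]
  intro x y hxy
  rw [SimpleGraph.isBridge_iff]
  intro hr
  obtain ⟨n, v, h0, hn, hadj, hinj, hind⟩ := hr.exists_geodesic
  simp only [SimpleGraph.deleteEdges_adj, Set.mem_singleton_iff] at hadj hind
  have hinj' : ∀ i j, i ≤ n → j ≤ n → v i = v j → i = j := fun i j hi hj h => by
    rcases lt_trichotomy i j with h1 | h1 | h1
    · exact absurd h (hinj i j h1 hj)
    · exact h1
    · exact absurd h.symm (hinj j i h1 hi)
  have hn2 : 2 ≤ n := by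
    by_contra! hlt
    interval_cases n
    · exact hxy.1 (h0.symm.trans hn)
    · exact (hadj 0 (by omega)).2 (by rw [h0, zero_add, hn])
  have hle : ∀ i : Fin (n + 1), (i : ℕ) ≤ n := fun i => Nat.lt_succ_iff.1 i.2
  have key : ∀ i j : Fin (n + 1), (i : ℕ) < j → Q.graph.Adj (v i) (v j) →
      j = i + 1 ∨ i = j + 1 := by
    intro i j hij ha
    by_cases h1 : (i : ℕ) + 1 = j
    · left
      ext
      rw [Fin.val_add_one_of_lt (by rw [Fin.lt_def, Fin.val_last]; have := hle j; omega)]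
      exact h1.symm
    · right
      have h2 := hind i j (by omega) (hle j)
      rw [not_and_not_right] at h2
      have h3 := h2 ha
      rw [← h0, ← hn, Sym2.eq_iff] at h3
      rcases h3 with ⟨h3, h4⟩ | ⟨h3, h4⟩
      · have e1 := hinj' _ _ (hle i) (by omega) h3
        have e2 := hinj' _ _ (hle j) le_rfl h4
        have e3 : j = Fin.last n := Fin.ext e2
        rw [e3, Fin.last_add_one]
        exact Fin.ext e1
      · have e1 := hinj' _ _ (hle i) le_rfl h3
        have := hle j
        omega
  refine h.not_induced_cycle hn2
    ⟨fun i : Fin (n + 1) => v i, fun i j he => Fin.ext (hinj' _ _ (hle i) (hle j) he)⟩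
    (fun i => ?_) (fun i j ha => ?_)
  · change Q.graph.Adj (v i) (v (i + 1 : Fin (n + 1)))
    rcases Nat.lt_or_ge i n with hi | hi
    · rw [Fin.val_add_one_of_lt (by rw [Fin.lt_def, Fin.val_last]; exact hi)]
      exact (hadj i hi).1
    · have e3 : i = Fin.last n := Fin.ext (le_antisymm (hle i) hi)
      rw [e3, Fin.last_add_one, Fin.val_last]
      rw [hn, Fin.val_zero, h0]
      exact hxy.symm
  · change Q.graph.Adj (v i) (v j) at ha
    rcases lt_trichotomy (i : ℕ) j with h1 | h1 | h1
    · exact key i j h1 ha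
    · rw [h1] at ha
      exact absurd rfl ha.1
    · exact (key j i h1 ha.symm).symm

/-- In an acyclic graph every non-backtracking path is induced. -/
theorem coprime_of_path (h : Q.NoListed) {n : ℕ} (hn : 1 ≤ n) (v : ℕ → V)
    (hadj : ∀ i, i < n → Q.graph.Adj (v i) (v (i + 1)))
    (hnb : ∀ i, i + 2 ≤ n → v (i + 2) ≠ v i) :
    IsCoprime (Q.A (v 0) (v 1)) (Q.A (v n) (v (n - 1))) := by
  obtain ⟨h1, h2⟩ := injOn_and_not_adj_of_isAcyclic h.isAcyclic (n := n) (p := fun j => j - 1) v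
    (fun j h1 _ => by omega) (fun j h1 h2 => by
      have := hadj (j - 1) (by omega)
      rwa [Nat.sub_add_cancel h1] at this) (fun i j h1 h2 h3 h4 => by omega)
    (fun j h1 h2 h3 => by
      have := hnb (j - 2) (by omega)
      rwa [show j - 2 + 2 = j by omega] at this)
  exact h.coprime_of_induced_path hn v hadj h1 fun i j h3 h4 => h2 i j (by omega) h4 (by omega)

end NoListed

end UnitaryQuiver


/-! ### Consequences of the bound: weight-one edges and balances -/

namespace UnitaryQuiver

open QuiverShape

variable {V : Type*} {Q : UnitaryQuiver V}

/-- One side of an edge `x — y`: a vector compatible with the edges on the side of `x`, such that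
any prime dividing `A x y * g x` is explained by a path starting along the edge. -/
lemma NoListed.exists_side [Fintype V] (h : Q.NoListed) {x y : V} (hxy : Q.graph.Adj x y) :
    ∃ g : V → ℤ, (∀ z z', (Q.graph.deleteEdges {s(x, y)}).Reachable x z →
        (Q.graph.deleteEdges {s(x, y)}).Reachable x z' → Q.A z z' * g z = Q.A z' z * g z') ∧
      ∀ q : ℕ, q.Prime → (q : ℤ) ∣ Q.A x y * g x → ∃ (n : ℕ) (a : ℕ → V), 1 ≤ n ∧ a 0 = y ∧
        a 1 = x ∧ (∀ i, i < n → Q.graph.Adj (a i) (a (i + 1))) ∧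
        (∀ i, i + 2 ≤ n → a (i + 2) ≠ a i) ∧ (q : ℤ) ∣ Q.A (a n) (a (n - 1)) := by
  classical
  have : Nonempty V := ⟨x⟩
  have hac := h.isAcyclic
  have hbr := SimpleGraph.isBridge_iff.1 (SimpleGraph.isAcyclic_iff_forall_adj_isBridge.1 hac hxy)
  obtain ⟨u, hu, -, hAu⟩ := Q.exists_isShift
  set G' := Q.graph.deleteEdges {s(x, y)} with hG'
  let T : Finset V := Finset.univ.filter fun z => G'.Reachable x z
  have hT : ∀ z, z ∈ T ↔ G'.Reachable x z := fun z => by simp [T]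
  obtain ⟨g, hg, hg1⟩ := T.extract_gcd (fun z => (u z : ℤ)) ⟨x, (hT x).2 (.refl _)⟩
  have hd0 : T.gcd (fun z => (u z : ℤ)) ≠ 0 := fun h0 => by
    have h1 := hg x ((hT x).2 (.refl _))
    rw [h0, zero_mul] at h1
    have := hu x
    omega
  have hAg : ∀ z z', G'.Reachable x z → G'.Reachable x z' → Q.A z z' * g z = Q.A z' z * g z' := by
    intro z z' hz hz'
    have h1 := hAu z z'
    rw [hg z ((hT z).2 hz), hg z' ((hT z').2 hz')] at h1
    exact mul_left_cancel₀ hd0 (by linear_combination h1)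
  refine ⟨g, hAg, fun q hq hdvd => ?_⟩
  have hqZ : Prime (q : ℤ) := Nat.prime_iff_prime_int.1 hq
  by_cases hx : (q : ℤ) ∣ g x
  -- The entries of g on the side of x are coprime, so q fails to divide some g w. On the way from x
  -- to w, at the first vertex z' where divisibility fails, with predecessor z, the relation A z z'
  -- * g z = A z' z * g z' forces q to divide A z' z: the path ends there.
  · obtain ⟨w, hw, hqw⟩ : ∃ w ∈ T, ¬ (q : ℤ) ∣ g w := by
      by_contra! hall
      have := Finset.dvd_gcd hall
      rw [hg1] at this
      exact hqZ.not_isUnit (isUnit_of_dvd_one this)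
    obtain ⟨m, v, hv0, hvm, hvadj, hvinj, -⟩ := ((hT w).1 hw).exists_geodesic
    have hreach : ∀ i, i ≤ m → G'.Reachable x (v i) := by
      intro i
      induction i with
      | zero => intro _; rw [hv0]
      | succ i ih => exact fun hi => (ih (by omega)).trans (hvadj i (by omega)).reachable
    have hex : ∃ i, i ≤ m ∧ ¬ (q : ℤ) ∣ g (v i) := ⟨m, le_rfl, by rwa [hvm]⟩
    obtain ⟨hi, hqi⟩ := Nat.find_spec hex
    set i := Nat.find hex with hidef
    have hi0 : i ≠ 0 := fun h0 => hqi (by rw [h0, hv0]; exact hx)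
    have hprev : (q : ℤ) ∣ g (v (i - 1)) := by
      have := Nat.find_min hex (m := i - 1) (by omega)
      by_contra hn
      exact this ⟨by omega, hn⟩
    refine ⟨i + 1, fun j => if j = 0 then y else v (j - 1), by omega, if_pos rfl, by simpa using hv0,
      fun j hj => ?_, fun j hj => ?_, ?_⟩
    · rcases Nat.eq_zero_or_pos j with rfl | hj0
      · simpa [hv0] using hxy.symm
      · beta_reduce
        rw [if_neg (by omega), if_neg (by omega)]
        have := hvadj (j - 1) (by omega)
        rw [Nat.sub_add_cancel hj0] at this
        rw [Nat.add_sub_cancel]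
        exact (SimpleGraph.deleteEdges_adj.1 this).1
    · beta_reduce
      rw [if_neg (by omega)]
      rcases Nat.eq_zero_or_pos j with rfl | hj0
      · rw [if_pos rfl]
        intro he
        exact hbr (he ▸ hreach _ (by omega))
      · rw [if_neg (by omega)]
        exact (hvinj _ _ (by omega) (by omega)).symm
    · beta_reduce
      rw [if_neg (by omega), Nat.add_sub_cancel, if_neg hi0]
      have h1 := hAg _ _ (hreach (i - 1) (by omega)) (hreach i hi)
      exact (hqZ.dvd_or_dvd (h1 ▸ Dvd.dvd.mul_left hprev _)).resolve_right hqi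
  · refine ⟨1, fun j => if j = 0 then y else x, le_rfl, if_pos rfl, by simp, fun j hj => ?_,
      fun j hj => by omega, ?_⟩
    · obtain rfl : j = 0 := by omega
      simpa using hxy.symm
    · simpa using (hqZ.dvd_or_dvd hdvd).resolve_right hx

/-- Two weight-one vertices of a quiver without listed subquiver and satisfying the bound are not
adjacent. -/
theorem NoListed.not_adj_of_weight_one [Fintype V] (h : Q.NoListed) (hD : Q.DimBound) {x y : V}
    (hx : Q.K x = 1) (hy : Q.K y = 1) : ¬ Q.graph.Adj x y := by
  classical
  intro hxy
  have hbr := SimpleGraph.isBridge_iff.1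
    (SimpleGraph.isAcyclic_iff_forall_adj_isBridge.1 h.isAcyclic hxy)
  obtain ⟨g, hg, hgq⟩ := h.exists_side hxy
  obtain ⟨g', hg', hgq'⟩ := h.exists_side hxy.symm
  rw [Sym2.eq_swap] at hg'
  set G' := Q.graph.deleteEdges {s(x, y)} with hG'
  -- A common prime would give two paths leaving the edge x — y on opposite sides, both with last
  -- multiplicity divisible by it. Glued along the edge they form a non-backtracking path violating
  -- `coprime_of_path`.
  have hcop : IsCoprime (Q.A x y * g x) (Q.A y x * g' y) := by
    rw [Int.isCoprime_iff_gcd_eq_one]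
    by_contra hne
    obtain ⟨q, hq, hqd⟩ := Nat.exists_prime_and_dvd hne
    have hqd' := Int.natCast_dvd_natCast.2 hqd
    obtain ⟨n, a, hn, ha0, ha1, haadj, hanb, haq⟩ := hgq q hq (hqd'.trans (Int.gcd_dvd_left _ _))
    obtain ⟨m, b, hm, hb0, hb1, hbadj, hbnb, hbq⟩ := hgq' q hq (hqd'.trans (Int.gcd_dvd_right _ _))
    have hc := h.coprime_of_path (n := n + m - 1) (by omega)
      (fun i => if i < n then a (n - i) else b (i - n + 1)) (fun i hi => ?_) (fun i hi => ?_)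
    · have h0 : (if 1 < n then a (n - 1) else b (1 - n + 1)) = a (n - 1) := by
        split_ifs with h1
        · rfl
        · obtain rfl : n = 1 := by omega
          rw [Nat.sub_self, ha0, zero_add, hb1]
      have h1 : (if n + m - 1 < n then a (n - (n + m - 1)) else b (n + m - 1 - n + 1)) = b m := by
        rw [if_neg (by omega)]
        congr 1
        omega
      have h2 : (if n + m - 1 - 1 < n then a (n - (n + m - 1 - 1))
          else b (n + m - 1 - 1 - n + 1)) = b (m - 1) := by
        split_ifs with h2
        · obtain rfl : m = 1 := by omega
          rw [show n - (n + 1 - 1 - 1) = 1 by omega, ha1, Nat.sub_self, hb0]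
        · congr 1
          omega
      simp only [h0, h1, h2, if_pos (show 0 < n by omega), Nat.sub_zero] at hc
      exact (Nat.prime_iff_prime_int.1 hq).not_isUnit (hc.isUnit_of_dvd' haq hbq)
    · rcases lt_trichotomy (i + 1) n with h1 | h1 | h1
      · rw [if_pos (by omega), if_pos h1]
        have := haadj (n - (i + 1)) (by omega)
        rw [show n - (i + 1) + 1 = n - i by omega] at this
        exact this.symm
      · rw [if_pos (by omega), if_neg (by omega), show n - i = 1 by omega,
          show i + 1 - n + 1 = 1 by omega, ha1, hb1]
        exact hxy
      · rw [if_neg (by omega), if_neg (by omega), show i + 1 - n + 1 = i - n + 1 + 1 by omega]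
        exact hbadj _ (by omega)
    · rcases Nat.lt_or_ge (i + 2) n with h1 | h1
      · rw [if_pos h1, if_pos (by omega)]
        have := hanb (n - (i + 2)) (by omega)
        rw [show n - (i + 2) + 2 = n - i by omega] at this
        exact this.symm
      · rw [if_neg (by omega)]
        rcases Nat.lt_or_ge i n with h2 | h2
        · rw [if_pos h2]
          rcases Nat.lt_or_ge (i + 1) n with h3 | h3
          · rw [show i + 2 - n + 1 = 1 by omega, hb1, ← ha0, show n - i = 0 + 2 by omega]
            exact (hanb 0 (by omega)).symm
          · rw [show n - i = 1 by omega, ha1, ← hb0, show i + 2 - n + 1 = 0 + 2 by omega]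
            exact hbnb 0 (by omega)
        · rw [if_neg (by omega), show i + 2 - n + 1 = i - n + 1 + 2 by omega]
          exact hbnb _ (by omega)
  -- Bézout coefficients scale the two sides so that the charge is flat on all other edges and the
  -- argument on x — y is exactly 1. Both ends having weight one, this argument occurs once, so Δ =
  -- 1.
  obtain ⟨α, β, hαβ⟩ := hcop
  let m : Q.Charge := fun p => if G'.Reachable x p.1 then α * g p.1 else
    if G'.Reachable y p.1 then -(β * g' p.1) else 0
  have hmx : m (Q.coord0 x) = α * g x := if_pos (.refl _)
  have hmy : m (Q.coord0 y) = -(β * g' y) := (if_neg hbr).trans (if_pos (.refl _))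
  have hterm : Q.A x y * m (Q.coord0 x) - Q.A y x * m (Q.coord0 y) = 1 := by
    rw [hmx, hmy]
    linear_combination hαβ
  have hflat : ∀ p q : Q.Coord, ¬ (p = Q.coord0 x ∧ q = Q.coord0 y) →
      ¬ (p = Q.coord0 y ∧ q = Q.coord0 x) → Q.dimTerm m p q = 0 := by
    intro p q h1 h2
    have key : Q.A p.1 q.1 * m p = Q.A q.1 p.1 * m q := by
      by_cases hpq : p.1 = q.1
      · simp only [m, hpq]
      by_cases hadj : Q.graph.Adj p.1 q.1
      · have hadj' : G'.Adj p.1 q.1 := by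
          rw [hG', SimpleGraph.deleteEdges_adj]
          refine ⟨hadj, fun he => ?_⟩
          rw [Set.mem_singleton_iff, Sym2.eq_iff] at he
          rcases he with ⟨e1, e2⟩ | ⟨e1, e2⟩
          · exact h1 ⟨by rw [eq_coord0 (p := p) (by rw [e1, hx]), e1],
              by rw [eq_coord0 (p := q) (by rw [e2, hy]), e2]⟩
          · exact h2 ⟨by rw [eq_coord0 (p := p) (by rw [e1, hy]), e1],
              by rw [eq_coord0 (p := q) (by rw [e2, hx]), e2]⟩
        have hiff : ∀ z, G'.Reachable z p.1 ↔ G'.Reachable z q.1 := fun z =>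
          ⟨fun h => h.trans hadj'.reachable, fun h => h.trans hadj'.symm.reachable⟩
        simp only [m]
        by_cases hxp : G'.Reachable x p.1
        · rw [if_pos hxp, if_pos ((hiff x).1 hxp)]
          linear_combination α * hg _ _ hxp ((hiff x).1 hxp)
        · rw [if_neg hxp, if_neg (mt (hiff x).2 hxp)]
          by_cases hyp : G'.Reachable y p.1
          · rw [if_pos hyp, if_pos ((hiff y).1 hyp)]
            linear_combination -β * hg' _ _ hyp ((hiff y).1 hyp)
          · rw [if_neg hyp, if_neg (mt (hiff y).2 hyp)]
            ring
      · rw [A_eq_zero_of_not_adj hpq hadj,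
          A_eq_zero_of_not_adj (Ne.symm hpq) (fun h => hadj h.symm)]
        ring
    rw [dimTerm, key, sub_self, abs_zero, mul_zero]
  have hne : Q.coord0 x ≠ Q.coord0 y := fun he => hxy.1 (congrArg Sigma.fst he)
  have hdim := two_mul_conformalDim_of_single m hne hflat
  have h1 : Q.dimTerm m (Q.coord0 x) (Q.coord0 y) = 1 := by
    change (Q.A x y).sign * |Q.A x y * m (Q.coord0 x) - Q.A y x * m (Q.coord0 y)| = 1
    rw [hterm, Int.sign_eq_one_of_pos (A_pos_of_adj hxy)]
    rfl
  rcases hD m with hc | hc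
  · have h2 : Q.A x y * m (Q.coord0 x) = Q.A y x * m (Q.coord0 y) :=
      hc.2 (Q.coord0 x) (Q.coord0 y)
    omega
  · omega

/-- The charge with a single non-zero coordinate, equal to 1 at x, has Δ = balance x + 2: the
coordinate does not interact with itself, which removes one diagonal entry -2. It is not constant
because x has another coordinate. -/
lemma DimBound.balance_nonneg [Fintype V] (hD : Q.DimBound) (hl : ∀ x, Q.A x x = -2) {x : V}
    (hx : 2 ≤ Q.K x) : 0 ≤ Q.balance x := by
  classical
  let p0 : Q.Coord := ⟨x, ⟨0, by omega⟩⟩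
  let m : Q.Charge := Pi.single p0 1
  have hm0 : m p0 = 1 := Pi.single_eq_same _ _
  have hm : ∀ p, p ≠ p0 → m p = 0 := fun p hp => Pi.single_eq_of_ne hp _
  have h1 : ∀ q, Q.dimTerm m p0 q = Q.A x q.1 - if q = p0 then -2 else 0 := by
    intro q
    split_ifs with hq
    · rw [hq, dimTerm, sub_self, abs_zero, mul_zero, hl]; rfl
    · rw [dimTerm, hm0, hm q hq, mul_one, mul_zero, sub_zero, Int.sign_mul_abs]
  have h2 : ∀ p q, Q.dimTerm m p q =
      (if p = p0 then Q.dimTerm m p0 q else 0) + if q = p0 then Q.dimTerm m p p0 else 0 := by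
    intro p q
    have h3 : Q.dimTerm m p0 p0 = 0 := by rw [dimTerm, sub_self, abs_zero, mul_zero]
    by_cases hp : p = p0 <;> by_cases hq : q = p0
    · simp [hp, hq, h3]
    · simp [hp, hq]
    · simp [hp, hq]
    · simp [hp, hq, dimTerm, hm p hp, hm q hq]
  have h5 : ∀ p, ∑ q, Q.dimTerm m p q =
      (if p = p0 then ∑ q, Q.dimTerm m p0 q else 0) + Q.dimTerm m p0 p := by
    intro p
    rw [Finset.sum_congr rfl fun q _ => h2 p q, Finset.sum_add_distrib,
      Finset.sum_ite_eq' Finset.univ p0, if_pos (Finset.mem_univ _), Q.dimTerm_comm m p p0]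
    split_ifs <;> simp
  have h6 : ∑ q, Q.dimTerm m p0 q = (∑ q : Q.Coord, Q.A x q.1) + 2 := by
    rw [Finset.sum_congr rfl fun q _ => h1 q, Finset.sum_sub_distrib,
      Finset.sum_ite_eq' Finset.univ p0, if_pos (Finset.mem_univ _)]
    ring
  have h3 := Q.two_mul_conformalDim m
  rw [Finset.sum_congr rfl fun p _ => h5 p, Finset.sum_add_distrib,
    Finset.sum_ite_eq' Finset.univ p0, if_pos (Finset.mem_univ _), h6] at h3
  have h4 : ∑ q : Q.Coord, Q.A x q.1 = Q.balance x := by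
    rw [balance, Fintype.sum_sigma]
    refine Finset.sum_congr rfl fun y _ => ?_
    simp [mul_comm]
  rw [h4] at h3
  rcases hD m with hc | hc
  · have := hc.1 p0 ⟨x, ⟨1, hx⟩⟩ rfl
    rw [hm0, hm _ (fun h => by simp [p0] at h)] at this
    omega
  · omega

lemma DimBound.two_mul_weight_le [Fintype V] (hD : Q.DimBound) (hl : ∀ x, Q.A x x = -2) {x : V}
    (hx : 2 ≤ Q.K x) {S : Finset V} (hS : ∀ y, Q.graph.Adj x y → y ∈ S) (hxS : x ∉ S) :
    2 * (Q.K x : ℤ) ≤ ∑ y ∈ S, Q.A x y * Q.K y := by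
  classical
  have h1 := hD.balance_nonneg hl hx
  rw [balance, ← Finset.sum_subset (Finset.subset_univ (insert x S)), Finset.sum_insert hxS,
    hl] at h1
  · omega
  · intro y _ hy
    rw [Finset.mem_insert, not_or] at hy
    rw [A_eq_zero_of_not_adj (Ne.symm hy.1) (fun h => hy.2 (hS y h)), zero_mul]

end UnitaryQuiver


/-! ### Shapes excluded around a vertex of weight at least two -/

namespace UnitaryQuiver

open QuiverShape

variable {V : Type*} {Q : UnitaryQuiver V}

namespace NoListed

lemma toNat_A {x y : V} (h : Q.graph.Adj x y) : ((Q.A x y).toNat : ℤ) = Q.A x y :=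
  Int.toNat_of_nonneg (A_pos_of_adj h).le

lemma one_le_toNat_A {x y : V} (h : Q.graph.Adj x y) : 1 ≤ (Q.A x y).toNat := by
  have := A_pos_of_adj h
  omega

lemma eq_one_of_two_le (h : Q.NoListed) {x y : V} (hxy : Q.graph.Adj x y) (h2 : 2 ≤ Q.A x y) :
    Q.A y x = 1 := by
  rcases h.thin hxy with h1 | h1
  · omega
  · exact h1

/-- Two edges with the same target have coprime multiplicities. -/
lemma coprime_of_two (h : Q.NoListed) {x y z : V} (hy : Q.graph.Adj x y) (hz : Q.graph.Adj x z)
    (hyz : y ≠ z) : IsCoprime (Q.A y x) (Q.A z x) := by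
  refine h.coprime_of_path (n := 2) (by omega) (fun i => [y, x, z].getD i x) (fun i hi => ?_)
    fun i hi => ?_
  · interval_cases i
    · exact hy.symm
    · exact hz
  · obtain rfl : i = 0 := by omega
    exact hyz.symm

lemma coprime_toNat {x y z w : V} (h1 : Q.graph.Adj x y) (h2 : Q.graph.Adj z w)
    (h : IsCoprime (Q.A x y) (Q.A z w)) : Nat.Coprime (Q.A x y).toNat (Q.A z w).toNat := by
  rwa [← Nat.isCoprime_iff_coprime, toNat_A h1, toNat_A h2]

theorem embeds_linear (h : Q.NoListed) {n : ℕ} {d u k : ℕ → ℕ} (v : ℕ → V)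
    (hd0 : ∀ j, 1 ≤ j → j ≤ n → 1 ≤ d j)
    (hd : ∀ j, 1 ≤ j → j ≤ n → Q.A (v (j - 1)) (v j) = d j)
    (hu : ∀ j, 1 ≤ j → j ≤ n → Q.A (v j) (v (j - 1)) = u j)
    (hnb : ∀ i, i + 2 ≤ n → v (i + 2) ≠ v i)
    (hk : ∀ j, j ≤ n → 0 < k j ∧ k j ≤ Q.K (v j)) : (linear n d u k).Embeds Q :=
  embeds_tree h.isAcyclic h.loopless v (fun j h1 _ => by omega) hd0 hd hu
    (fun i j h1 h2 h3 h4 => by omega) (fun j h1 h2 h3 => by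
      have := hnb (j - 2) (by omega)
      rwa [show j - 2 + 2 = j by omega] at this) hk

/-- The shapes with a path `0, …, n` whose last vertex but one carries another leaf `n + 1`. -/
theorem embeds_forked (h : Q.NoListed) {n : ℕ} (hn : 2 ≤ n) {d u k : ℕ → ℕ} (v : ℕ → V)
    (w : V) (hw : Q.graph.Adj (v (n - 1)) w) (hwn : w ≠ v n) (hwn' : w ≠ v (n - 2))
    (hd0 : ∀ j, 1 ≤ j → j ≤ n → 1 ≤ d j)
    (hd : ∀ j, 1 ≤ j → j ≤ n → Q.A (v (j - 1)) (v j) = d j)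
    (hu : ∀ j, 1 ≤ j → j ≤ n → Q.A (v j) (v (j - 1)) = u j)
    (hdw : Q.A (v (n - 1)) w = d (n + 1)) (huw : Q.A w (v (n - 1)) = u (n + 1))
    (hnb : ∀ i, i + 2 ≤ n → v (i + 2) ≠ v i)
    (hk : ∀ j, j ≤ n → 0 < k j ∧ k j ≤ Q.K (v j)) (hkw : 0 < k (n + 1) ∧ k (n + 1) ≤ Q.K w) :
    (forked (n + 1) d u k).Embeds Q := by
  have hlt : ∀ j, j ≤ n → (if j = n + 1 then w else v j) = v j := fun j hj => if_neg (by omega)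
  have hdw0 : 1 ≤ d (n + 1) := by
    have := A_pos_of_adj hw
    omega
  have hsplit : ∀ j, j ≤ n + 1 → j ≤ n ∨ j = n + 1 := fun j hj => by omega
  refine embeds_tree h.isAcyclic h.loopless (fun j => if j = n + 1 then w else v j) ?_ ?_ ?_ ?_
    ?_ ?_ ?_
  · intro j h1 h2
    split_ifs <;> omega
  · intro j h1 h2
    rcases hsplit j h2 with h3 | rfl
    · exact hd0 j h1 h3
    · exact hdw0
  · intro j h1 h2
    rcases hsplit j h2 with h3 | rfl
    · simp only [hlt j h3, if_neg (show j ≠ n + 1 by omega), hlt (j - 1) (by omega)]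
      exact hd j h1 h3
    · simp only [if_true, show n + 1 - 2 = n - 1 by omega, hlt (n - 1) (by omega)]
      exact hdw
  · intro j h1 h2
    rcases hsplit j h2 with h3 | rfl
    · simp only [hlt j h3, if_neg (show j ≠ n + 1 by omega), hlt (j - 1) (by omega)]
      exact hu j h1 h3
    · simp only [if_true, show n + 1 - 2 = n - 1 by omega, hlt (n - 1) (by omega)]
      exact huw
  · intro i j h1 h2 h3 h4
    rw [if_neg (show i ≠ n + 1 by omega)] at h4
    split_ifs at h4 with h5
    · obtain rfl : i = n := by omega
      simp only [hlt i le_rfl, if_pos h5]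
      exact hwn.symm
    · omega
  · intro j h1 h2
    rcases hsplit j h2 with h3 | rfl
    · simp only [hlt j h3, if_neg (show j ≠ n + 1 by omega)]
      intro h5
      simp only [if_neg (show j - 1 ≠ n + 1 by omega), hlt (j - 1 - 1) (by omega)]
      have := hnb (j - 2) (by omega)
      rwa [show j - 2 + 2 = j by omega] at this
    · intro _
      simp only [if_true, if_neg (show n + 1 - 2 ≠ n + 1 by omega),
        show n + 1 - 2 - 1 = n - 2 by omega, hlt (n - 2) (by omega)]
      exact hwn'
  · intro j h2
    rcases hsplit j h2 with h3 | rfl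
    · simp only [hlt j h3]
      exact hk j h3
    · simpa using hkw

lemma A_le_three (h : Q.NoListed) {x y : V} (hx : 2 ≤ Q.K x) (hy : Q.graph.Adj x y) :
    Q.A x y ≤ 3 := by
  by_contra! hlt
  refine h _ (.typeY (Q.A x y).toNat (by omega)) (h.embeds_linear (fun i => [x, y].getD i x)
    ?_ ?_ ?_ ?_ ?_)
  · intro j h1 h2
    exact one_le_toNat_A hy
  · intro j h1 h2
    obtain rfl : j = 1 := by omega
    exact (toNat_A hy).symm
  · intro j h1 h2
    obtain rfl : j = 1 := by omega
    have := h.eq_one_of_two_le hy (by omega)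
    exact this
  · intro i hi
    omega
  · intro j hj
    interval_cases j
    · exact ⟨two_pos, hx⟩
    · exact ⟨one_pos, Q.weight_pos y⟩

/-- The pairs of multiplicities at most 3 with sum at least 4 are all listed: (1,3) is G₂⁽¹⁾, (2,2)
is D₃⁽²⁾, (2,3) and (3,3) are 𝒥_{2,3} and 𝒥_{3,3}. -/
lemma A_add_A_le (h : Q.NoListed) {x y z : V} (hx : 2 ≤ Q.K x) (hy : Q.graph.Adj x y)
    (hz : Q.graph.Adj x z) (hyz : y ≠ z) : Q.A x y + Q.A x z ≤ 3 := by
  wlog hle : Q.A x y ≤ Q.A x z generalizing y z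
  · rw [add_comm]
    exact this hz hy hyz.symm (by omega)
  by_contra! hlt
  have hy0 := A_pos_of_adj hy
  have hz3 := h.A_le_three hx hz
  have hz1 := h.eq_one_of_two_le hz (by omega)
  have hnb : ∀ i, i + 2 ≤ 2 → [y, x, z].getD (i + 2) x ≠ [y, x, z].getD i x := fun i hi => by
    obtain rfl : i = 0 := by omega
    exact hyz.symm
  rcases (show Q.A x y = 1 ∧ Q.A x z = 3 ∨ 2 ≤ Q.A x y by omega) with ⟨hy1, hz3⟩ | hy2
  · refine h _ (.affG2 (Q.A y x).toNat (one_le_toNat_A hy.symm))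
      (h.embeds_linear (fun i => [y, x, z].getD i x) ?_ ?_ ?_ hnb ?_)
    · intro j h1 h2
      have := one_le_toNat_A hy.symm
      split_ifs <;> omega
    · intro j h1 h2
      interval_cases j
      · exact (toNat_A hy.symm).symm
      · exact hz3
    · intro j h1 h2
      interval_cases j
      · exact hy1
      · exact hz1
    · intro j hj
      interval_cases j
      · exact ⟨one_pos, Q.weight_pos y⟩
      · exact ⟨two_pos, hx⟩
      · exact ⟨one_pos, Q.weight_pos z⟩
  have hy1 := h.eq_one_of_two_le hy hy2
  have hk : ∀ j, j ≤ 2 → 0 < (if j = 1 then 2 else 1) ∧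
      (if j = 1 then 2 else 1) ≤ Q.K ([y, x, z].getD j x) := by
    intro j hj
    interval_cases j
    · exact ⟨one_pos, Q.weight_pos y⟩
    · exact ⟨two_pos, hx⟩
    · exact ⟨one_pos, Q.weight_pos z⟩
  have hJ : ∀ a b : ℕ, 1 ≤ b → Q.A x y = a → Q.A x z = b → (typeJ a b).Embeds Q := by
    intro a b hb hya hzb
    refine h.embeds_linear (fun i => [y, x, z].getD i x) ?_ ?_ ?_ hnb hk
    · intro j h1 h2
      split_ifs <;> omega
    · intro j h1 h2
      interval_cases j
      · exact hy1
      · exact hzb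
    · intro j h1 h2
      interval_cases j
      · exact hya
      · exact hz1
  rcases (show Q.A x y = 2 ∧ Q.A x z = 2 ∨ Q.A x y = 2 ∧ Q.A x z = 3 ∨
    Q.A x y = 3 ∧ Q.A x z = 3 by omega) with ⟨h1, h2⟩ | ⟨h1, h2⟩ | ⟨h1, h2⟩
  · refine h _ (.affD2 2 le_rfl) (h.embeds_linear (fun i => [y, x, z].getD i x) ?_ ?_ ?_ hnb ?_)
    · intro j h1 h2
      split_ifs <;> omega
    · intro j h3 h4
      interval_cases j
      · exact hy1
      · exact h2
    · intro j h3 h4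
      interval_cases j
      · exact h1
      · exact hz1
    · intro j hj
      interval_cases j
      · exact ⟨one_pos, Q.weight_pos y⟩
      · exact ⟨two_pos, hx⟩
      · exact ⟨one_pos, Q.weight_pos z⟩
  · exact h _ .J23 (hJ 2 3 (by omega) h1 h2)
  · exact h _ .J33 (hJ 3 3 (by omega) h1 h2)

/-- Otherwise `A_add_A_le` leaves multiplicities 2, 1, 1, and this is B₃⁽¹⁾. -/
lemma A_eq_one_of_three (h : Q.NoListed) {x y z w : V} (hx : 2 ≤ Q.K x) (hy : Q.graph.Adj x y)
    (hz : Q.graph.Adj x z) (hw : Q.graph.Adj x w) (hyz : y ≠ z) (hyw : y ≠ w) (hzw : z ≠ w) :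
    Q.A x y = 1 := by
  by_contra hne
  have hy0 := A_pos_of_adj hy
  have hz0 := A_pos_of_adj hz
  have hw0 := A_pos_of_adj hw
  have h1 := h.A_add_A_le hx hy hz hyz
  have h2 := h.A_add_A_le hx hy hw hyw
  have hy1 := h.eq_one_of_two_le hy (by omega)
  refine h _ (.affB 3 (Q.A z x).toNat (Q.A w x).toNat le_rfl (one_le_toNat_A hz.symm)
    (one_le_toNat_A hw.symm) (coprime_toNat hz.symm hw.symm (h.coprime_of_two hz hw hzw)))
    (h.embeds_forked (n := 2) le_rfl (fun i => [y, x, z].getD i x) w hw hzw.symm hyw.symm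
      (fun _ _ _ => le_rfl) ?_ ?_ ?_ ?_ ?_ ?_ ⟨one_pos, Q.weight_pos w⟩)
  · intro j h3 h4
    interval_cases j
    · exact hy1
    · exact show Q.A x z = 1 by omega
  · intro j h3 h4
    interval_cases j
    · exact show Q.A x y = 2 by omega
    · exact (toNat_A hz.symm).symm
  · exact show Q.A x w = 1 by omega
  · exact (toNat_A hw.symm).symm
  · intro i hi
    obtain rfl : i = 0 := by omega
    exact hyz.symm
  · intro j hj
    interval_cases j
    · exact ⟨one_pos, Q.weight_pos y⟩
    · exact ⟨two_pos, hx⟩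
    · exact ⟨one_pos, Q.weight_pos z⟩

/-- The ends of a path may be replaced by other neighbours. -/
lemma coprime_ends (h : Q.NoListed) {n : ℕ} (hn : 2 ≤ n) (v : ℕ → V)
    (hadj : ∀ i, i < n → Q.graph.Adj (v i) (v (i + 1)))
    (hnb : ∀ i, i + 2 ≤ n → v (i + 2) ≠ v i) {a b : V} (ha : Q.graph.Adj (v 1) a)
    (hb : Q.graph.Adj (v (n - 1)) b) (ha2 : a ≠ v 2 ∨ n = 2) (hb2 : b ≠ v (n - 2) ∨ n = 2)
    (hab : n = 2 → a ≠ b) : IsCoprime (Q.A a (v 1)) (Q.A b (v (n - 1))) := by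
  have h1 := h.coprime_of_path (n := n) (by omega)
    (fun i => if i = 0 then a else if i = n then b else v i) (fun i hi => ?_) (fun i hi => ?_)
  · simpa only [if_true, if_neg (show ¬ 1 = 0 by omega), if_neg (show ¬ 1 = n by omega),
      if_neg (show n ≠ 0 by omega), if_neg (show n - 1 ≠ 0 by omega),
      if_neg (show n - 1 ≠ n by omega)] using h1
  · rcases Nat.eq_zero_or_pos i with rfl | hi0
    · simpa [show 1 ≠ n by omega] using ha.symm
    · rw [if_neg (by omega), if_neg (by omega), if_neg (by omega)]
      split_ifs with h2
      · rw [show i = n - 1 by omega]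
        exact hb
      · exact hadj i hi
  · rcases Nat.eq_zero_or_pos i with rfl | hi0
    · simp only [if_true, if_neg (show ¬ 0 + 2 = 0 by omega)]
      split_ifs with h2
      · exact (hab h2.symm).symm
      · exact (ha2.resolve_right (by omega)).symm
    · rw [if_neg (by omega), if_neg (show i ≠ 0 by omega), if_neg (show i ≠ n by omega)]
      split_ifs with h2
      · rw [show i = n - 2 by omega]
        exact hb2.resolve_right (by omega)
      · exact hnb i hi

/-- There are no two branchings. -/
theorem false_of_affD (h : Q.NoListed) {n : ℕ} (hn : 2 ≤ n) (v : ℕ → V) (w w' : V)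
    (hadj : ∀ i, i < n → Q.graph.Adj (v i) (v (i + 1)))
    (hnb : ∀ i, i + 2 ≤ n → v (i + 2) ≠ v i)
    (hK : ∀ i, 1 ≤ i → i < n → 2 ≤ Q.K (v i))
    (hs : ∀ i, 1 ≤ i → i + 2 ≤ n → Q.A (v i) (v (i + 1)) = 1 ∧ Q.A (v (i + 1)) (v i) = 1)
    (h0 : Q.A (v 1) (v 0) = 1) (hw : Q.graph.Adj (v 1) w) (hw1 : Q.A (v 1) w = 1)
    (hw0 : w ≠ v 0) (hw2 : w ≠ v 2)
    (hn1 : Q.A (v (n - 1)) (v n) = 1) (hw' : Q.graph.Adj (v (n - 1)) w')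
    (hw'1 : Q.A (v (n - 1)) w' = 1) (hw'n : w' ≠ v n) (hw'n2 : w' ≠ v (n - 2))
    (hww' : n = 2 → w ≠ w') : False := by
  have hadj0 : Q.graph.Adj (v 1) (v 0) := (hadj 0 (by omega)).symm
  have hadjn : Q.graph.Adj (v (n - 1)) (v n) := by
    have := hadj (n - 1) (by omega)
    rwa [show n - 1 + 1 = n by omega] at this
  have h20 : v 0 ≠ v 2 := (hnb 0 (by omega)).symm
  have hn2 : v n ≠ v (n - 2) := by
    have := hnb (n - 2) (by omega)
    rwa [show n - 2 + 2 = n by omega] at this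
  have hlt : ∀ j, j ≤ n → (if j = n + 2 then w else if j = n + 1 then w' else v j) = v j :=
    fun j hj => by rw [if_neg (by omega), if_neg (by omega)]
  have hsplit : ∀ j, j ≤ n + 2 → j ≤ n ∨ j = n + 1 ∨ j = n + 2 := fun j hj => by omega
  have hcop : [(Q.A (v 0) (v 1)).toNat, (Q.A w (v 1)).toNat, (Q.A (v n) (v (n - 1))).toNat,
      (Q.A w' (v (n - 1))).toNat].Pairwise Nat.Coprime := by
    simp only [List.pairwise_cons, List.mem_cons, List.not_mem_nil, or_false, forall_eq_or_imp,
      forall_eq, IsEmpty.forall_iff, implies_true, List.Pairwise.nil, and_true]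
    refine ⟨⟨coprime_toNat hadj0.symm hw.symm (h.coprime_of_two hadj0 hw hw0.symm),
      coprime_toNat hadj0.symm hadjn.symm (h.coprime_ends hn v hadj hnb hadj0 hadjn
        (Or.inl h20) (Or.inl hn2) fun e => by subst e; exact h20),
      coprime_toNat hadj0.symm hw'.symm (h.coprime_ends hn v hadj hnb hadj0 hw'
        (Or.inl h20) (Or.inl hw'n2) fun e => by subst e; exact hw'n2.symm)⟩,
      ⟨coprime_toNat hw.symm hadjn.symm (h.coprime_ends hn v hadj hnb hw hadjn
        (Or.inl hw2) (Or.inl hn2) fun e => by subst e; exact hw2),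
      coprime_toNat hw.symm hw'.symm (h.coprime_ends hn v hadj hnb hw hw'
        (Or.inl hw2) (Or.inl hw'n2) hww')⟩,
      coprime_toNat hadjn.symm hw'.symm (h.coprime_of_two hadjn hw' hw'n.symm)⟩
  -- The path keeps the indices 0, …, n; the extra leaf w' at v (n-1) becomes n + 1 and w at v 1
  -- becomes n + 2.
  refine h _ (.affD (n + 2) _ _ _ _ (by omega) (one_le_toNat_A hadj0.symm)
    (one_le_toNat_A hw.symm) (one_le_toNat_A hadjn.symm) (one_le_toNat_A hw'.symm) hcop)
    (embeds_tree h.isAcyclic h.loopless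
      (fun j => if j = n + 2 then w else if j = n + 1 then w' else v j) ?_ ?_ ?_ ?_ ?_ ?_ ?_)
  · intro j h1 h2
    split_ifs <;> omega
  · intro j h1 h2
    have := one_le_toNat_A hadj0.symm
    split_ifs <;> omega
  · intro j h1 h2
    rcases hsplit j h2 with h3 | rfl | rfl
    · simp only [hlt j h3, if_neg (show j ≠ n + 2 by omega), if_neg (show j ≠ n + 2 - 1 by omega),
        hlt (j - 1) (by omega)]
      rcases h1.eq_or_lt with rfl | h1
      · exact (toNat_A hadj0.symm).symm
      · rw [if_neg (by omega)]
        rcases h3.eq_or_lt with rfl | h3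
        · exact hn1
        · have := (hs (j - 1) (by omega) (by omega)).1
          rwa [show j - 1 + 1 = j by omega] at this
    · simp only [if_neg (show n + 1 ≠ n + 2 by omega), if_pos (show n + 1 = n + 2 - 1 by omega),
        if_true, if_neg (show n + 1 ≠ 1 by omega), show n + 2 - 3 = n - 1 by omega,
        hlt (n - 1) (by omega)]
      exact hw'1
    · simp only [if_true, hlt 1 (by omega), if_neg (show n + 2 ≠ 1 by omega)]
      exact hw1
  · intro j h1 h2
    rcases hsplit j h2 with h3 | rfl | rfl
    · simp only [hlt j h3, if_neg (show j ≠ n + 2 by omega), if_neg (show j ≠ n + 2 - 1 by omega),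
        hlt (j - 1) (by omega), show n + 2 - 2 = n by omega]
      rcases h3.eq_or_lt with rfl | h3
      · rw [if_pos rfl]
        exact (toNat_A hadjn.symm).symm
      · rw [if_neg (by omega)]
        rcases h1.eq_or_lt with rfl | h1
        · exact h0
        · have := (hs (j - 1) (by omega) (by omega)).2
          rwa [show j - 1 + 1 = j by omega] at this
    · simp only [if_neg (show n + 1 ≠ n + 2 by omega), if_pos (show n + 1 = n + 2 - 1 by omega),
        if_true, if_neg (show n + 1 ≠ n + 2 - 2 by omega), show n + 2 - 3 = n - 1 by omega,
        hlt (n - 1) (by omega)]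
      exact (toNat_A hw'.symm).symm
    · simp only [if_true, hlt 1 (by omega)]
      exact (toNat_A hw.symm).symm
  · intro i j h1 h2 h3 h4
    rw [if_neg (show i ≠ n + 2 by omega)] at h4
    rcases hsplit j h3 with h5 | rfl | rfl
    · rw [if_neg (by omega), if_neg (by omega), if_neg (by omega)] at h4
      omega
    · rw [if_neg (by omega), if_neg (by omega), if_pos (by omega)] at h4
      obtain rfl : i = n := by omega
      simp only [hlt i le_rfl, if_neg (show i + 1 ≠ i + 2 by omega), if_true]
      exact hw'n.symm
    · rw [if_pos rfl] at h4
      simp only [if_neg (show i ≠ n + 2 by omega), if_true]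
      split_ifs at h4 ⊢ with h6 h7 h7
      · exact (hww' (by omega)).symm
      · omega
      · omega
      · obtain rfl : i = 2 := by omega
        exact hw2.symm
  · intro j h1 h2
    rcases hsplit j h2 with h3 | rfl | rfl
    · simp only [hlt j h3, if_neg (show j ≠ n + 2 by omega), if_neg (show j ≠ n + 2 - 1 by omega)]
      intro h5
      simp only [if_neg (show j - 1 ≠ n + 2 by omega), if_neg (show j - 1 ≠ n + 2 - 1 by omega),
        hlt (j - 1 - 1) (by omega)]
      have := hnb (j - 2) (by omega)
      rwa [show j - 2 + 2 = j by omega] at this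
    · intro _
      simp only [if_neg (show n + 1 ≠ n + 2 by omega), if_pos (show n + 1 = n + 2 - 1 by omega),
        if_true, if_neg (show n + 2 - 3 ≠ n + 2 by omega),
        if_neg (show n + 2 - 3 ≠ n + 2 - 1 by omega), show n + 2 - 3 - 1 = n - 2 by omega,
        hlt (n - 2) (by omega)]
      exact hw'n2
    · intro _
      simp only [if_true, if_neg (show 1 ≠ n + 2 by omega), if_neg (show 1 ≠ n + 2 - 1 by omega),
        Nat.sub_self, hlt 0 (by omega)]
      exact hw0
  · intro j h2
    rcases hsplit j h2 with h3 | rfl | rfl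
    · simp only [hlt j h3]
      have := Q.weight_pos (v j)
      split_ifs with h4
      · omega
      · exact ⟨two_pos, hK j (by omega) (by omega)⟩
    · rw [if_pos (by omega)]
      exact ⟨one_pos, Q.weight_pos _⟩
    · rw [if_pos (by omega)]
      exact ⟨one_pos, Q.weight_pos _⟩

/-- Two branchings at the same vertex: the case n = 2 of `false_of_affD`, namely D₄⁽¹⁾. -/
lemma false_of_four (h : Q.NoListed) {x y z w t : V} (hx : 2 ≤ Q.K x) (hy : Q.graph.Adj x y)
    (hz : Q.graph.Adj x z) (hw : Q.graph.Adj x w) (ht : Q.graph.Adj x t) (hyz : y ≠ z)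
    (hyw : y ≠ w) (hyt : y ≠ t) (hzw : z ≠ w) (hzt : z ≠ t) (hwt : w ≠ t) : False := by
  refine h.false_of_affD (n := 2) le_rfl (fun i => [y, x, z].getD i x) w t (fun i hi => ?_)
    (fun i hi => ?_) (fun i h1 h2 => ?_) (fun i h1 h2 => by omega)
    (h.A_eq_one_of_three hx hy hz hw hyz hyw hzw) hw
    (h.A_eq_one_of_three hx hw hy hz hyw.symm hzw.symm hyz) hyw.symm hzw.symm
    (h.A_eq_one_of_three hx hz hy hw hyz.symm hzw hyw) ht
    (h.A_eq_one_of_three hx ht hy hz hyt.symm hzt.symm hyz) hzt.symm hyt.symm (fun _ => hwt)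
  · interval_cases i
    · exact hy.symm
    · exact hz
  · obtain rfl : i = 0 := by omega
    exact hyz.symm
  · obtain rfl : i = 1 := by omega
    exact hx

end NoListed

end UnitaryQuiver


/-! ### Chains with special ends -/

namespace UnitaryQuiver

open QuiverShape

variable {V : Type*} {Q : UnitaryQuiver V}

/-- `v 0, …, v n` is a path whose inner vertices have weight at least two, and whose inner edges are
simple. -/
structure IsChain (Q : UnitaryQuiver V) (n : ℕ) (v : ℕ → V) : Prop where
  adj : ∀ i, i < n → Q.graph.Adj (v i) (v (i + 1))
  nonbacktracking : ∀ i, i + 2 ≤ n → v (i + 2) ≠ v i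
  two_le_weight : ∀ i, 1 ≤ i → i < n → 2 ≤ Q.K (v i)
  simple : ∀ i, 1 ≤ i → i + 2 ≤ n → Q.A (v i) (v (i + 1)) = 1 ∧ Q.A (v (i + 1)) (v i) = 1

/-- The three ways in which a chain starting with `x, y, z` may end on the side of `x`: with the
target of a double edge, with the source of a multiple edge, or with a branching. -/
inductive Cap (Q : UnitaryQuiver V) (x y z : V) : Prop
  | target (h : Q.A y x = 2)
  | source (hK : 2 ≤ Q.K x) (h : 2 ≤ Q.A x y)
  | branch (w : V) (hw : Q.graph.Adj y w) (hwx : w ≠ x) (hwz : w ≠ z)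

namespace IsChain

variable {n : ℕ} {v : ℕ → V}

lemma reverse (hv : Q.IsChain n v) : Q.IsChain n (fun i => v (n - i)) where
  adj i hi := by
    have := hv.adj (n - (i + 1)) (by omega)
    rw [show n - (i + 1) + 1 = n - i by omega] at this
    exact this.symm
  nonbacktracking i hi := by
    have := hv.nonbacktracking (n - (i + 2)) (by omega)
    rw [show n - (i + 2) + 2 = n - i by omega] at this
    exact this.symm
  two_le_weight i h1 h2 := hv.two_le_weight _ (by omega) (by omega)
  simple i h1 h2 := by
    have := hv.simple (n - (i + 1)) (by omega) (by omega)
    rw [show n - (i + 1) + 1 = n - i by omega] at this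
    exact this.symm

lemma adj' (hv : Q.IsChain n v) {j : ℕ} (h1 : 1 ≤ j) (h2 : j ≤ n) :
    Q.graph.Adj (v (j - 1)) (v j) := by
  have := hv.adj (j - 1) (by omega)
  rwa [Nat.sub_add_cancel h1] at this

lemma simple' (hv : Q.IsChain n v) {j : ℕ} (h1 : 2 ≤ j) (h2 : j + 1 ≤ n) :
    Q.A (v (j - 1)) (v j) = 1 ∧ Q.A (v j) (v (j - 1)) = 1 := by
  have := hv.simple (j - 1) (by omega) (by omega)
  rwa [Nat.sub_add_cancel (by omega)] at this

lemma weight (hv : Q.IsChain n v) {j a : ℕ} (hj : j ≤ n) (ha : 1 ≤ a) (ha2 : a ≤ 2)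
    (h0 : j = 0 → a ≤ Q.K (v 0)) (hn : j = n → a ≤ Q.K (v n)) : 0 < a ∧ a ≤ Q.K (v j) := by
  refine ⟨ha, ?_⟩
  rcases Nat.eq_zero_or_pos j with rfl | h1
  · exact h0 rfl
  rcases hj.eq_or_lt with rfl | h2
  · exact hn rfl
  · exact ha2.trans (hv.two_le_weight j h1 h2)

/-- A chain, ended by prescribed edges, is a linear quiver. -/
lemma embeds_linear (h : Q.NoListed) (hn : 2 ≤ n) (hv : Q.IsChain n v) {d u k : ℕ → ℕ}
    (hd0 : ∀ j, 1 ≤ j → j ≤ n → 1 ≤ d j)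
    (hd1 : Q.A (v 0) (v 1) = d 1) (hu1 : Q.A (v 1) (v 0) = u 1)
    (hdn : Q.A (v (n - 1)) (v n) = d n) (hun : Q.A (v n) (v (n - 1)) = u n)
    (hd : ∀ j, 2 ≤ j → j + 1 ≤ n → d j = 1) (hu : ∀ j, 2 ≤ j → j + 1 ≤ n → u j = 1)
    (hk0 : k 0 ≤ Q.K (v 0)) (hkn : k n ≤ Q.K (v n)) (hk : ∀ j, 1 ≤ k j ∧ k j ≤ 2) :
    (linear n d u k).Embeds Q := by
  refine h.embeds_linear v hd0 (fun j h1 h2 => ?_) (fun j h1 h2 => ?_) hv.nonbacktracking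
    (fun j hj => hv.weight hj (hk j).1 (hk j).2 (by rintro rfl; exact hk0) (by rintro rfl; exact hkn))
  · rcases h1.eq_or_lt with rfl | h1
    · exact hd1
    rcases h2.eq_or_lt with rfl | h2
    · exact hdn
    · rw [hd j h1 h2, (hv.simple' h1 h2).1]; rfl
  · rcases h1.eq_or_lt with rfl | h1
    · exact hu1
    rcases h2.eq_or_lt with rfl | h2
    · exact hun
    · rw [hu j h1 h2, (hv.simple' h1 h2).2]; rfl

/-- A chain, ended by a prescribed edge and a branching, is a forked quiver. -/
lemma embeds_forked (h : Q.NoListed) (hn : 2 ≤ n) (hv : Q.IsChain n v) {w : V}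
    (hw : Q.graph.Adj (v (n - 1)) w) (hwn : w ≠ v n) (hwn' : w ≠ v (n - 2)) {d u k : ℕ → ℕ}
    (hd0 : ∀ j, 1 ≤ j → j ≤ n → 1 ≤ d j)
    (hd1 : Q.A (v 0) (v 1) = d 1) (hu1 : Q.A (v 1) (v 0) = u 1)
    (hun : Q.A (v n) (v (n - 1)) = u n) (hun1 : Q.A w (v (n - 1)) = u (n + 1))
    (hd : ∀ j, 2 ≤ j → d j = 1) (hu : ∀ j, 2 ≤ j → j + 1 ≤ n → u j = 1)
    (hk0 : k 0 ≤ Q.K (v 0)) (hkn : k n = 1) (hkn1 : k (n + 1) = 1)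
    (hk : ∀ j, 1 ≤ k j ∧ k j ≤ 2) : (forked (n + 1) d u k).Embeds Q := by
  have hadj1 : Q.graph.Adj (v (n - 1)) (v (n - 2)) := by
    have := hv.adj' (j := n - 1) (by omega) (by omega)
    rw [show n - 1 - 1 = n - 2 by omega] at this
    exact this.symm
  have hadjn := hv.adj' (j := n) (by omega) le_rfl
  have hK := hv.two_le_weight (n - 1) (by omega) (by omega)
  have hnn : v n ≠ v (n - 2) := by
    have := hv.nonbacktracking (n - 2) (by omega)
    rwa [show n - 2 + 2 = n by omega] at this
  refine h.embeds_forked hn v w hw hwn hwn' hd0 (fun j h1 h2 => ?_) (fun j h1 h2 => ?_) ?_ hun1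
    hv.nonbacktracking
    (fun j hj => hv.weight hj (hk j).1 (hk j).2 (by rintro rfl; exact hk0)
      (by rintro rfl; rw [hkn]; exact Q.weight_pos _)) ⟨(hk _).1, by rw [hkn1]; exact Q.weight_pos _⟩
  · rcases h1.eq_or_lt with rfl | h1
    · exact hd1
    rw [hd j h1]
    rcases h2.eq_or_lt with rfl | h2
    · rw [h.A_eq_one_of_three hK hadjn hadj1 hw hnn hwn.symm hwn'.symm]; rfl
    · rw [(hv.simple' h1 h2).1]; rfl
  · rcases h1.eq_or_lt with rfl | h1
    · exact hu1
    rcases h2.eq_or_lt with rfl | h2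
    · exact hun
    · rw [hu j h1 h2, (hv.simple' h1 h2).2]; rfl
  · rw [hd _ (by omega), h.A_eq_one_of_three hK hw hadjn hadj1 hwn hwn' hnn]; rfl

lemma coprime_two (h : Q.NoListed) (hn : 2 ≤ n) (hv : Q.IsChain n v) :
    IsCoprime (Q.A (v 0) (v 1)) (Q.A (v n) (v (n - 1))) :=
  h.coprime_of_path (by omega) v hv.adj hv.nonbacktracking

/-- First of the exclusions by pairs of special ends. Two targets give D⁽²⁾; source and target give
A⁽²⁾ with even index, or gb; two sources give gc; target and branching give B⁽¹⁾; source and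
branching give A⁽²⁾ with odd index, or gd; two branchings give D⁽¹⁾. -/
lemma false_of_target_target (h : Q.NoListed) (hn : 2 ≤ n) (hv : Q.IsChain n v)
    (h0 : Q.A (v 1) (v 0) = 2) (h1 : Q.A (v (n - 1)) (v n) = 2) : False := by
  have hadj0 := hv.adj 0 (by omega)
  have hadjn := hv.adj' (j := n) (by omega) le_rfl
  refine h _ (.affD2 n hn) (hv.embeds_linear h hn (fun j _ _ => ?_) ?_ ?_ ?_ ?_ ?_ ?_ ?_ ?_ ?_)
  · split_ifs <;> omega
  · rw [if_neg (by omega), h.eq_one_of_two_le hadj0.symm h0.ge]; rfl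
  · rw [if_pos rfl, h0]; rfl
  · rw [if_pos rfl, h1]; rfl
  · rw [if_neg (by omega), h.eq_one_of_two_le hadjn h1.ge]; rfl
  · intro j _ _; exact if_neg (by omega)
  · intro j _ _; exact if_neg (by omega)
  · rw [if_pos (by omega)]; exact Q.weight_pos _
  · rw [if_pos (by omega)]; exact Q.weight_pos _
  · intro j; split_ifs <;> omega

lemma false_of_source_target (h : Q.NoListed) (hn : 2 ≤ n) (hv : Q.IsChain n v)
    (hK : 2 ≤ Q.K (v 0)) (h0 : 2 ≤ Q.A (v 0) (v 1)) (h1 : Q.A (v (n - 1)) (v n) = 2) : False := by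
  have hadj0 := hv.adj 0 (by omega)
  have hadjn := hv.adj' (j := n) (by omega) le_rfl
  have h3 := h.A_le_three hK hadj0
  have h01 : Q.A (v 1) (v 0) = 1 := h.eq_one_of_two_le hadj0 h0
  rcases (show Q.A (v 0) (v 1) = 2 ∨ Q.A (v 0) (v 1) = 3 by
    rw [zero_add] at h3; omega) with h2 | h2
  · refine h _ (.affA2even n hn) (hv.embeds_linear h hn (fun j _ _ => ?_) ?_ h01 ?_ ?_ ?_
      (fun _ _ _ => rfl) ?_ ?_ ?_)
    · split_ifs <;> omega
    · rw [if_pos (by omega), h2]; rfl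
    · rw [if_pos (by omega), h1]; rfl
    · rw [h.eq_one_of_two_le hadjn h1.ge]; rfl
    · intro j _ _; exact if_neg (by omega)
    · rw [if_neg (by omega)]; exact hK
    · rw [if_pos (by omega)]; exact Q.weight_pos _
    · intro j; split_ifs <;> omega
  · refine h _ (.gb n hn) (hv.embeds_linear h hn (fun j _ _ => ?_) ?_ h01 ?_ ?_ ?_
      (fun _ _ _ => rfl) ?_ ?_ ?_)
    · split_ifs <;> omega
    · rw [if_pos (by omega), h2]; rfl
    · rw [if_neg (by omega), if_pos rfl, h1]; rfl
    · rw [h.eq_one_of_two_le hadjn h1.ge]; rfl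
    · intro j _ _; rw [if_neg (by omega), if_neg (by omega)]
    · rw [if_neg (by omega)]; exact hK
    · rw [if_pos (by omega)]; exact Q.weight_pos _
    · intro j; split_ifs <;> omega

lemma false_of_source_source (h : Q.NoListed) (hn : 2 ≤ n) (hv : Q.IsChain n v)
    (hK : 2 ≤ Q.K (v 0)) (h0 : 2 ≤ Q.A (v 0) (v 1)) (hKn : 2 ≤ Q.K (v n))
    (h1 : 2 ≤ Q.A (v n) (v (n - 1))) : False := by
  wlog hle : Q.A (v n) (v (n - 1)) ≤ Q.A (v 0) (v 1) generalizing v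
  · refine this hv.reverse hKn ?_ ?_ ?_ ?_
    · exact h1
    · rwa [Nat.sub_self]
    · rwa [Nat.sub_self, show n - (n - 1) = 1 by omega]
    · rw [Nat.sub_self, show n - (n - 1) = 1 by omega]
      exact (not_le.1 hle).le
  have hadj0 := hv.adj 0 (by omega)
  have hadjn := hv.adj' (j := n) (by omega) le_rfl
  have h3 := h.A_le_three hK hadj0
  have hcop := hv.coprime_two h hn
  rw [zero_add] at h3
  -- Both multiplicities lie in {2, 3}; path coprimality excludes equality, and 3, 2 is gc.
  rcases (show Q.A (v 0) (v 1) = Q.A (v n) (v (n - 1)) ∨ Q.A (v 0) (v 1) = 3 ∧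
    Q.A (v n) (v (n - 1)) = 2 by omega) with h2 | ⟨h2, h4⟩
  · rw [h2, isCoprime_self, Int.isUnit_iff] at hcop
    omega
  · refine h _ (.gc n hn) (hv.embeds_linear h hn (fun j _ _ => ?_) ?_ ?_ ?_ ?_ ?_ ?_ hK hKn
      (fun _ => ⟨one_le_two, le_rfl⟩))
    · split_ifs <;> omega
    · rw [if_pos rfl, h2]; rfl
    · rw [if_neg (by omega), h.eq_one_of_two_le hadj0 h0]; rfl
    · rw [if_neg (by omega), h.eq_one_of_two_le hadjn.symm h1]; rfl
    · rw [if_pos rfl, h4]; rfl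
    · intro j _ _; exact if_neg (by omega)
    · intro j _ _; exact if_neg (by omega)

lemma false_of_target_branch (h : Q.NoListed) (hn : 2 ≤ n) (hv : Q.IsChain n v)
    (h0 : Q.A (v 1) (v 0) = 2) {w : V} (hw : Q.graph.Adj (v (n - 1)) w) (hwn : w ≠ v n)
    (hwn' : w ≠ v (n - 2)) : False := by
  have hadj0 := hv.adj 0 (by omega)
  have hadjn := hv.adj' (j := n) (by omega) le_rfl
  refine h _ (.affB (n + 1) (Q.A (v n) (v (n - 1))).toNat (Q.A w (v (n - 1))).toNat (by omega)
    (NoListed.one_le_toNat_A hadjn.symm) (NoListed.one_le_toNat_A hw.symm)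
    (NoListed.coprime_toNat hadjn.symm hw.symm (h.coprime_of_two hadjn hw hwn.symm)))
    (hv.embeds_forked h hn hw hwn hwn' (fun _ _ _ => le_rfl) ?_ ?_ ?_ ?_ (fun _ _ => rfl) ?_ ?_ ?_
      ?_ ?_)
  · rw [h.eq_one_of_two_le hadj0.symm h0.ge]; rfl
  · rw [if_pos rfl, h0]; rfl
  · rw [if_neg (by omega), if_pos (by omega), NoListed.toNat_A hadjn.symm]
  · rw [if_neg (by omega), if_neg (by omega), if_pos rfl, NoListed.toNat_A hw.symm]
  · intro j _ _
    rw [if_neg (by omega), if_neg (by omega), if_neg (by omega)]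
  · rw [if_pos (by omega)]; exact Q.weight_pos _
  · exact if_pos (by omega)
  · exact if_pos (by omega)
  · intro j; split_ifs <;> omega

lemma false_of_source_branch (h : Q.NoListed) (hn : 2 ≤ n) (hv : Q.IsChain n v)
    (hK : 2 ≤ Q.K (v 0)) (h0 : 2 ≤ Q.A (v 0) (v 1)) {w : V} (hw : Q.graph.Adj (v (n - 1)) w)
    (hwn : w ≠ v n) (hwn' : w ≠ v (n - 2)) : False := by
  have hadj0 : Q.graph.Adj (v 0) (v 1) := hv.adj 0 (by omega)
  have hadjn := hv.adj' (j := n) (by omega) le_rfl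
  have h3 := h.A_le_three hK hadj0
  have h02 : v 0 ≠ v 2 := (hv.nonbacktracking 0 (by omega)).symm
  have hnn : v n ≠ v (n - 2) := by
    have := hv.nonbacktracking (n - 2) (by omega)
    rwa [show n - 2 + 2 = n by omega] at this
  have hcop : Nat.Coprime (Q.A (v n) (v (n - 1))).toNat (Q.A w (v (n - 1))).toNat :=
    NoListed.coprime_toNat hadjn.symm hw.symm (h.coprime_of_two hadjn hw hwn.symm)
  have hcop1 : Nat.Coprime (Q.A (v 0) (v 1)).toNat (Q.A (v n) (v (n - 1))).toNat :=
    NoListed.coprime_toNat hadj0 hadjn.symm (h.coprime_ends hn v hv.adj hv.nonbacktracking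
      hadj0.symm hadjn (Or.inl h02) (Or.inl hnn) fun e => by subst e; exact h02)
  have hcop2 : Nat.Coprime (Q.A (v 0) (v 1)).toNat (Q.A w (v (n - 1))).toNat :=
    NoListed.coprime_toNat hadj0 hw.symm (h.coprime_ends hn v hv.adj hv.nonbacktracking
      hadj0.symm hw (Or.inl h02) (Or.inl hwn') fun e => by subst e; exact hwn'.symm)
  have hl1 := NoListed.one_le_toNat_A hadjn.symm
  have hl2 := NoListed.one_le_toNat_A hw.symm
  have key : ∀ a : ℕ, 1 ≤ a → Q.A (v 0) (v 1) = a →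
      (forked (n + 1) (fun j => if j = 1 then a else 1)
        (fun j => if j = n + 1 - 1 then (Q.A (v n) (v (n - 1))).toNat else
          if j = n + 1 then (Q.A w (v (n - 1))).toNat else 1)
        (fun i => if n + 1 - 1 ≤ i then 1 else 2)).Embeds Q := by
    intro a ha ha1
    refine hv.embeds_forked h hn hw hwn hwn' (fun _ _ _ => ?_) ?_ ?_ ?_ ?_ ?_ ?_ ?_ ?_ ?_ ?_
    · split_ifs <;> omega
    · rw [if_pos rfl, ha1]
    · rw [if_neg (by omega), if_neg (by omega), h.eq_one_of_two_le hadj0 h0]; rfl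
    · rw [if_pos (by omega), NoListed.toNat_A hadjn.symm]
    · rw [if_neg (by omega), if_pos rfl, NoListed.toNat_A hw.symm]
    · intro j _
      rw [if_neg (by omega)]
    · intro j _ _
      rw [if_neg (by omega), if_neg (by omega)]
    · rw [if_neg (by omega)]; exact hK
    · exact if_pos (by omega)
    · exact if_pos (by omega)
    · intro j; split_ifs <;> omega
  rcases (show Q.A (v 0) (v 1) = 2 ∨ Q.A (v 0) (v 1) = 3 by omega) with h2 | h2
  · rw [h2] at hcop1 hcop2
    exact h _ (.affA2odd (n + 1) _ _ (by omega) (Nat.coprime_two_left.1 hcop1)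
      (Nat.coprime_two_left.1 hcop2) hcop) (key 2 (by omega) h2)
  · rw [h2] at hcop1 hcop2
    exact h _ (.gd (n + 1) _ _ (by omega) hl1 hl2 hcop hcop1.symm hcop2.symm) (key 3 (by omega) h2)

lemma false_of_cap_target (h : Q.NoListed) (hn : 2 ≤ n) (hv : Q.IsChain n v)
    (h0 : Q.Cap (v 0) (v 1) (v 2)) (h1 : Q.A (v (n - 1)) (v n) = 2) : False := by
  have e1 : n - (n - 1) = 1 := by omega
  have e2 : n - (n - 2) = 2 := by omega
  rcases h0 with h0 | ⟨hK0, h0⟩ | ⟨w, hw, hw0, hw2⟩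
  · exact hv.false_of_target_target h hn h0 h1
  · exact hv.false_of_source_target h hn hK0 h0 h1
  · exact hv.reverse.false_of_target_branch h hn h1 (w := w) (by rwa [e1])
      (by rwa [Nat.sub_self]) (by rwa [e2])

lemma false_of_cap_source (h : Q.NoListed) (hn : 2 ≤ n) (hv : Q.IsChain n v)
    (h0 : Q.Cap (v 0) (v 1) (v 2)) (hK : 2 ≤ Q.K (v n)) (h1 : 2 ≤ Q.A (v n) (v (n - 1))) :
    False := by
  have e1 : n - (n - 1) = 1 := by omega
  have e2 : n - (n - 2) = 2 := by omega
  rcases h0 with h0 | ⟨hK0, h0⟩ | ⟨w, hw, hw0, hw2⟩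
  · exact hv.reverse.false_of_source_target h hn hK h1 (by rwa [Nat.sub_self, e1])
  · exact hv.false_of_source_source h hn hK0 h0 hK h1
  · exact hv.reverse.false_of_source_branch h hn hK h1 (w := w) (by rwa [e1])
      (by rwa [Nat.sub_self]) (by rwa [e2])

/-- At least three edges are required: for n = 2 the branching at v 1 may be the cap itself. -/
lemma false_of_cap_branch (h : Q.NoListed) (hn : 3 ≤ n) (hv : Q.IsChain n v)
    (h0 : Q.Cap (v 0) (v 1) (v 2)) {w' : V} (hw' : Q.graph.Adj (v (n - 1)) w') (hwn : w' ≠ v n)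
    (hwn' : w' ≠ v (n - 2)) : False := by
  have hn2 : 2 ≤ n := by omega
  rcases h0 with h0 | ⟨hK0, h0⟩ | ⟨w, hw, hw0, hw2⟩
  · exact hv.false_of_target_branch h hn2 h0 hw' hwn hwn'
  · exact hv.false_of_source_branch h hn2 hK0 h0 hw' hwn hwn'
  have hK1 := hv.two_le_weight 1 (by omega) (by omega)
  have hKn := hv.two_le_weight (n - 1) (by omega) (by omega)
  have hadj0 : Q.graph.Adj (v 0) (v 1) := hv.adj 0 (by omega)
  have hadj1 : Q.graph.Adj (v 1) (v 2) := hv.adj 1 (by omega)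
  have hadjn := hv.adj' (j := n) (by omega) le_rfl
  have hadjn1 : Q.graph.Adj (v (n - 1)) (v (n - 2)) := by
    have := hv.adj' (j := n - 1) (by omega) (by omega)
    rw [show n - 1 - 1 = n - 2 by omega] at this
    exact this.symm
  have h02 : v 0 ≠ v 2 := (hv.nonbacktracking 0 (by omega)).symm
  have hnn : v n ≠ v (n - 2) := by
    have := hv.nonbacktracking (n - 2) (by omega)
    rwa [show n - 2 + 2 = n by omega] at this
  exact h.false_of_affD hn2 v w w' hv.adj hv.nonbacktracking hv.two_le_weight hv.simple
    (h.A_eq_one_of_three hK1 hadj0.symm hadj1 hw h02 hw0.symm hw2.symm)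
    hw (h.A_eq_one_of_three hK1 hw hadj0.symm hadj1 hw0 hw2 h02) hw0 hw2
    (h.A_eq_one_of_three hKn hadjn hadjn1 hw' hnn hwn.symm hwn'.symm) hw'
    (h.A_eq_one_of_three hKn hw' hadjn hadjn1 hwn hwn' hnn) hwn hwn' (fun e => by omega)

end IsChain

end UnitaryQuiver


/-! ### Legs -/

namespace UnitaryQuiver

open QuiverShape

variable {V : Type*} {Q : UnitaryQuiver V}

lemma NoListed.injOn_of_path (h : Q.NoListed) {n : ℕ} (v : ℕ → V)
    (hadj : ∀ i, i < n → Q.graph.Adj (v i) (v (i + 1)))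
    (hnb : ∀ i, i + 2 ≤ n → v (i + 2) ≠ v i) : ∀ i j, i < j → j ≤ n → v i ≠ v j :=
  (injOn_and_not_adj_of_isAcyclic h.isAcyclic (n := n) (p := fun j => j - 1) v
    (fun j h1 _ => by omega) (fun j h1 h2 => by
      have := hadj (j - 1) (by omega)
      rwa [Nat.sub_add_cancel h1] at this) (fun i j h1 h2 h3 h4 => by omega)
    (fun j h1 h2 h3 => by
      have := hnb (j - 2) (by omega)
      rwa [show j - 2 + 2 = j by omega] at this)).1

lemma IsChain.lt_card [Fintype V] (h : Q.NoListed) {n : ℕ} {v : ℕ → V} (hv : Q.IsChain n v) :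
    n < Fintype.card V := by
  have hinj := h.injOn_of_path v hv.adj hv.nonbacktracking
  have hle : ∀ i : Fin (n + 1), (i : ℕ) ≤ n := fun i => Nat.lt_succ_iff.1 i.2
  have : Function.Injective fun i : Fin (n + 1) => v i := by
    intro i j hij
    rcases lt_trichotomy (i : ℕ) j with h1 | h1 | h1
    · exact absurd hij (hinj _ _ h1 (hle j))
    · exact Fin.ext h1
    · exact absurd hij.symm (hinj _ _ h1 (hle i))
  have := Fintype.card_le_of_injective _ this
  rwa [Fintype.card_fin] at this

lemma IsChain.snoc {n : ℕ} {v : ℕ → V} (hn : 2 ≤ n) (hv : Q.IsChain n v) {z : V}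
    (hz : Q.graph.Adj (v n) z) (hzn : z ≠ v (n - 1)) (hK : 2 ≤ Q.K (v n))
    (h1 : Q.A (v (n - 1)) (v n) = 1) (h2 : Q.A (v n) (v (n - 1)) = 1) :
    Q.IsChain (n + 1) (fun i => if i = n + 1 then z else v i) where
  adj i hi := by
    rw [if_neg (by omega)]
    split_ifs with h3
    · obtain rfl : i = n := by omega
      exact hz
    · exact hv.adj i (by omega)
  nonbacktracking i hi := by
    rw [if_neg (show i ≠ n + 1 by omega)]
    split_ifs with h3
    · rwa [show i = n - 1 by omega]
    · exact hv.nonbacktracking i (by omega)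
  two_le_weight i h3 h4 := by
    rw [if_neg (by omega)]
    rcases Nat.lt_succ_iff_lt_or_eq.1 h4 with h5 | rfl
    · exact hv.two_le_weight i h3 h5
    · exact hK
  simple i h3 h4 := by
    rw [if_neg (by omega), if_neg (by omega)]
    rcases Nat.lt_or_ge (i + 1) n with h5 | h5
    · exact hv.simple i h3 h5
    · obtain rfl : n = i + 1 := by omega
      exact ⟨h1, h2⟩

/-- `Q.Leg p x y`: the branch of the quiver starting with the edge `x — y` is a linear quiver with
`p` vertices whose edges are simple, except possibly the last one. -/
inductive Leg (Q : UnitaryQuiver V) : ℕ → V → V → Prop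
  | tip {x y : V} (hadj : Q.graph.Adj x y) (h1 : Q.A x y = 1) (h2 : 2 ≤ Q.K y → Q.A y x = 1)
      (hK : 2 * Q.K y ≤ Q.K x) : Leg Q 1 x y
  | step {p : ℕ} {x y z : V} (hadj : Q.graph.Adj x y) (h1 : Q.A x y = 1) (h2 : Q.A y x = 1)
      (hz : Leg Q p y z) (hzx : z ≠ x) (hK : 2 * Q.K y ≤ Q.K x + Q.K z) : Leg Q (p + 1) x y

namespace Leg

variable {p : ℕ} {x y : V}

lemma adj (h : Q.Leg p x y) : Q.graph.Adj x y := by cases h <;> assumption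

lemma A_eq (h : Q.Leg p x y) : Q.A x y = 1 := by cases h <;> assumption

lemma pos (h : Q.Leg p x y) : 1 ≤ p := by cases h <;> omega

/-- The balances make the weights convex along the leg, with 2 K y ≤ K x at the tip. Hence they
strictly decrease outwards, and induction from the tip gives K y / K x ≤ p / (p + 1), with equality
in the pattern 1, 2, …, p, p + 1. -/
lemma le_weight (h : Q.Leg p x y) : p ≤ Q.K y ∧ Q.K y + 1 ≤ Q.K x ∧ (p + 1) * Q.K y ≤ p * Q.K x := by
  induction h with
  | @tip x y _ _ _ hK =>
    have := Q.weight_pos y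
    omega
  | @step p x y z _ _ _ _ _ hK ih =>
    obtain ⟨h1, h2, h3⟩ := ih
    refine ⟨by omega, by omega, ?_⟩
    nlinarith

/-- A leg with at least two vertices. -/
lemma exists_next (h : Q.Leg p x y) (hp : 2 ≤ p) : ∃ z, Q.Leg (p - 1) y z ∧ z ≠ x ∧
    Q.A y x = 1 ∧ 2 * Q.K y ≤ Q.K x + Q.K z := by
  cases h with
  | tip => omega
  | step hadj h1 h2 hz hzx hK => exact ⟨_, hz, hzx, h2, hK⟩

lemma A_symm_eq (h : Q.Leg p x y) (hK : 2 ≤ Q.K y) : Q.A y x = 1 := by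
  cases h with
  | tip _ _ h2 _ => exact h2 hK
  | step _ _ h2 => exact h2

lemma two_mul_le (h : Q.Leg 1 x y) : 2 * Q.K y ≤ Q.K x := by
  have := h.le_weight
  omega

end Leg

/-- The branches following a cap are legs. -/
theorem IsChain.exists_leg [Fintype V] (h : Q.NoListed) (hD : Q.DimBound) {n : ℕ} {v : ℕ → V}
    (hn : 2 ≤ n) (hv : Q.IsChain n v) (h0 : Q.Cap (v 0) (v 1) (v 2)) :
    ∃ p, Q.Leg p (v (n - 1)) (v n) := by
  classical
  -- A chain in a tree does not repeat vertices, so it can be extended only finitely often; the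
  -- induction is on the room left.
  induction hm : Fintype.card V - n using Nat.strong_induction_on generalizing n v with
  | _ m ih =>
    have hcard := hv.lt_card h
    have hadj := hv.adj' (j := n) (by omega) le_rfl
    have hadj1 : Q.graph.Adj (v (n - 1)) (v (n - 2)) := by
      have := hv.adj' (j := n - 1) (by omega) (by omega)
      rw [show n - 1 - 1 = n - 2 by omega] at this
      exact this.symm
    have hnn : v n ≠ v (n - 2) := by
      have := hv.nonbacktracking (n - 2) (by omega)
      rwa [show n - 2 + 2 = n by omega] at this
    have hKx := hv.two_le_weight (n - 1) (by omega) (by omega)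
    -- The two edges at v (n-1) have outgoing multiplicities of sum at most 3, so a multiplicity
    -- other than 1 would be 2, a second special end.
    have h1 : Q.A (v (n - 1)) (v n) = 1 := by
      have h1 := A_pos_of_adj hadj
      have h2 := A_pos_of_adj hadj1
      have h3 := h.A_add_A_le hKx hadj hadj1 hnn
      by_contra hne
      exact hv.false_of_cap_target h hn h0 (by omega)
    have h2 : 2 ≤ Q.K (v n) → Q.A (v n) (v (n - 1)) = 1 := fun hK => by
      have h2 := A_pos_of_adj hadj.symm
      by_contra hne
      exact hv.false_of_cap_source h hn h0 hK (by omega)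
    by_cases hK : 2 ≤ Q.K (v n)
    · have h2' := h2 hK
      by_cases hex : ∃ z, Q.graph.Adj (v n) z ∧ z ≠ v (n - 1)
      · obtain ⟨z, hz, hzn⟩ := hex
        have hv' := hv.snoc hn hz hzn hK h1 h2'
        obtain ⟨p, hp⟩ := ih (Fintype.card V - (n + 1)) (by omega) (by omega) hv' (by
          simpa only [if_neg (show ¬ 0 = n + 1 by omega), if_neg (show ¬ 1 = n + 1 by omega),
            if_neg (show ¬ 2 = n + 1 by omega)] using h0) rfl
        simp only [Nat.add_sub_cancel, if_neg (show n ≠ n + 1 by omega), if_true] at hp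
        refine ⟨p + 1, .step hadj h1 h2' hp hzn ?_⟩
        -- A further neighbour of v n would be a branching at the far end of the lengthened chain.
        -- So the balance at v n involves only the two neighbours on the chain.
        have hS : ∀ y, Q.graph.Adj (v n) y → y ∈ ({v (n - 1), z} : Finset V) := by
          intro w hw
          rw [Finset.mem_insert, Finset.mem_singleton]
          by_contra! hne
          refine hv'.false_of_cap_branch h (by omega) (w' := w) ?_ ?_ ?_ ?_
          · simpa only [if_neg (show ¬ 0 = n + 1 by omega), if_neg (show ¬ 1 = n + 1 by omega),
              if_neg (show ¬ 2 = n + 1 by omega)] using h0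
          · rwa [Nat.add_sub_cancel, if_neg (by omega)]
          · rw [if_pos rfl]; exact hne.2
          · rw [if_neg (by omega), show n + 1 - 2 = n - 1 by omega]; exact hne.1
        have := hD.two_mul_weight_le h.loopless hK hS (by
          rw [Finset.mem_insert, Finset.mem_singleton, not_or]
          exact ⟨hadj.1.symm, hz.1⟩)
        rw [Finset.sum_pair hzn.symm, h2', hp.A_eq] at this
        omega
      · push Not at hex
        have := hD.two_mul_weight_le h.loopless hK (S := {v (n - 1)})
          (fun y hy => Finset.mem_singleton.2 (hex y hy)) (by
            rw [Finset.mem_singleton]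
            exact hadj.1.symm)
        rw [Finset.sum_singleton, h2'] at this
        exact ⟨1, .tip hadj h1 h2 (by omega)⟩
    · have := Q.weight_pos (v n)
      exact ⟨1, .tip hadj h1 h2 (by omega)⟩

/-- The branches at the second vertex of a capped edge are legs. -/
lemma NoListed.exists_leg [Fintype V] (h : Q.NoListed) (hD : Q.DimBound) {x y z : V}
    (hy : 2 ≤ Q.K y) (hx : Q.graph.Adj y x) (hz : Q.graph.Adj y z) (hzx : z ≠ x)
    (h0 : Q.Cap x y z) : ∃ p, Q.Leg p y z := by
  refine IsChain.exists_leg h hD (n := 2) (v := fun i => [x, y, z].getD i x) le_rfl ?_ h0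
  refine ⟨fun i hi => ?_, fun i hi => ?_, fun i h1 h2 => ?_, fun i h1 h2 => by omega⟩
  · interval_cases i
    · exact hx.symm
    · exact hz
  · obtain rfl : i = 0 := by omega
    exact hzx
  · obtain rfl : i = 1 := by omega
    exact hy

end UnitaryQuiver


/-! ### No branchings and no multiple edges out of weight at least two -/

namespace UnitaryQuiver

open QuiverShape

variable {V : Type*} {Q : UnitaryQuiver V}

namespace NoListed

lemma false_of_affE6 (h : Q.NoListed) {c y₁ y₂ y₃ z₁ z₂ z₃ : V} (hc : 3 ≤ Q.K c)
    (h12 : y₁ ≠ y₂) (h13 : y₁ ≠ y₃) (h23 : y₂ ≠ y₃)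
    (a₁ : Q.graph.Adj c y₁) (a₂ : Q.graph.Adj c y₂) (a₃ : Q.graph.Adj c y₃)
    (d₁ : Q.A c y₁ = 1) (d₂ : Q.A c y₂ = 1) (d₃ : Q.A c y₃ = 1)
    (u₁ : Q.A y₁ c = 1) (u₂ : Q.A y₂ c = 1) (u₃ : Q.A y₃ c = 1)
    (k₁ : 2 ≤ Q.K y₁) (k₂ : 2 ≤ Q.K y₂) (k₃ : 2 ≤ Q.K y₃)
    (b₁ : Q.graph.Adj y₁ z₁) (b₂ : Q.graph.Adj y₂ z₂) (b₃ : Q.graph.Adj y₃ z₃)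
    (e₁ : Q.A y₁ z₁ = 1) (e₂ : Q.A y₂ z₂ = 1) (e₃ : Q.A y₃ z₃ = 1)
    (n₁ : z₁ ≠ c) (n₂ : z₂ ≠ c) (n₃ : z₃ ≠ c) : False := by
  have hcop : ∀ {y y' z z' : V}, y ≠ y' → Q.graph.Adj c y → Q.graph.Adj c y' → Q.graph.Adj y z →
      Q.graph.Adj y' z' → z ≠ c → z' ≠ c → Nat.Coprime (Q.A z y).toNat (Q.A z' y').toNat := by
    intro y y' z z' hy a a' b b' n n'
    refine coprime_toNat b.symm b'.symm (h.coprime_of_path (n := 4) (by omega)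
      (fun i => [z, y, c, y', z'].getD i c) (fun i hi => ?_) fun i hi => ?_)
    · interval_cases i
      exacts [b.symm, a.symm, a', b']
    · have hi' : i ≤ 2 := by omega
      interval_cases i
      exacts [n.symm, hy.symm, n']
  refine h _ (.affE6 (Q.A z₁ y₁).toNat (Q.A z₂ y₂).toNat (Q.A z₃ y₃).toNat
    (one_le_toNat_A b₁.symm) (one_le_toNat_A b₂.symm) (one_le_toNat_A b₃.symm) ?_)
    (embeds_tree h.isAcyclic h.loopless (fun i => [z₁, y₁, c, y₂, z₂, y₃, z₃].getD i c)
      ?_ ?_ ?_ ?_ ?_ ?_ ?_)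
  · simp only [List.pairwise_cons, List.mem_cons, List.not_mem_nil, or_false, forall_eq_or_imp,
      forall_eq, IsEmpty.forall_iff, implies_true, List.Pairwise.nil, and_true]
    exact ⟨⟨hcop h12 a₁ a₂ b₁ b₂ n₁ n₂, hcop h13 a₁ a₃ b₁ b₃ n₁ n₃⟩, hcop h23 a₂ a₃ b₂ b₃ n₂ n₃⟩
  · intro j _ _
    split_ifs <;> omega
  · intro j _ _
    have := one_le_toNat_A b₁.symm
    split_ifs <;> omega
  · intro j h1 h2
    interval_cases j
    exacts [(toNat_A b₁.symm).symm, u₁, d₂, e₂, d₃, e₃]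
  · intro j h1 h2
    interval_cases j
    exacts [e₁, d₁, u₂, (toNat_A b₂.symm).symm, u₃, (toNat_A b₃.symm).symm]
  · intro i j h1 h2 h3 h4
    obtain ⟨rfl, rfl⟩ : i = 3 ∧ j = 5 := by split_ifs at h4 <;> omega
    exact h23
  · intro j h1 h2
    interval_cases j
    exacts [fun h0 => absurd rfl h0, fun _ => n₁.symm, fun _ => h12.symm, fun _ => n₂,
      fun _ => h13.symm, fun _ => n₃]
  · intro j h1
    interval_cases j
    exacts [⟨by decide, Q.weight_pos _⟩, ⟨by decide, k₁⟩, ⟨by decide, hc⟩, ⟨by decide, k₂⟩,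
      ⟨by decide, Q.weight_pos _⟩, ⟨by decide, k₃⟩, ⟨by decide, Q.weight_pos _⟩]

lemma false_of_affE7 (h : Q.NoListed) {c a₁ a₂ a₃ b₁ b₂ b₃ e : V} (hc : 4 ≤ Q.K c)
    (hab : a₁ ≠ b₁) (hae : a₁ ≠ e) (hbe : b₁ ≠ e)
    (ca : Q.A c a₁ = 1) (cb : Q.A c b₁ = 1) (ce : Q.A c e = 1)
    (ac : Q.A a₁ c = 1) (bc : Q.A b₁ c = 1) (ec : Q.A e c = 1)
    (ka₁ : 3 ≤ Q.K a₁) (ka₂ : 2 ≤ Q.K a₂) (kb₁ : 3 ≤ Q.K b₁) (kb₂ : 2 ≤ Q.K b₂) (ke : 2 ≤ Q.K e)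
    (a12 : Q.A a₁ a₂ = 1) (a21 : Q.A a₂ a₁ = 1) (a23 : Q.A a₂ a₃ = 1) (ha : Q.graph.Adj a₂ a₃)
    (b12 : Q.A b₁ b₂ = 1) (b21 : Q.A b₂ b₁ = 1) (b23 : Q.A b₂ b₃ = 1) (hb : Q.graph.Adj b₂ b₃)
    (na₂ : a₂ ≠ c) (na₃ : a₃ ≠ a₁) (nb₂ : b₂ ≠ c) (nb₃ : b₃ ≠ b₁) : False := by
  have hA : ∀ {x y : V}, Q.A x y = 1 → Q.graph.Adj x y := fun {x y} hxy =>
    ⟨fun e => by rw [e, h.loopless] at hxy; omega, by omega⟩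
  refine h _ (.affE7 (Q.A a₃ a₂).toNat (Q.A b₃ b₂).toNat
    (one_le_toNat_A ha.symm) (one_le_toNat_A hb.symm) (coprime_toNat ha.symm hb.symm ?_))
    (embeds_tree h.isAcyclic h.loopless (fun i => [a₃, a₂, a₁, c, b₁, b₂, b₃, e].getD i c)
      ?_ ?_ ?_ ?_ ?_ ?_ ?_)
  · refine h.coprime_of_path (n := 6) (by omega)
      (fun i => [a₃, a₂, a₁, c, b₁, b₂, b₃].getD i c) (fun i hi => ?_) fun i hi => ?_
    · interval_cases i
      exacts [ha.symm, hA a21, hA ac, hA cb, hA b12, hb]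
    · have hi' : i ≤ 4 := by omega
      interval_cases i
      exacts [na₃.symm, na₂.symm, hab.symm, nb₂, nb₃]
  · intro j _ _
    split_ifs <;> omega
  · intro j _ _
    have := one_le_toNat_A ha.symm
    split_ifs <;> omega
  · intro j h1 h2
    interval_cases j
    exacts [(toNat_A ha.symm).symm, a21, ac, cb, b12, b23, ce]
  · intro j h1 h2
    interval_cases j
    exacts [a23, a12, ca, bc, b21, (toNat_A hb.symm).symm, ec]
  · intro i j h1 h2 h3 h4
    obtain ⟨rfl, rfl⟩ : i = 4 ∧ j = 7 := by split_ifs at h4 <;> omega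
    exact hbe
  · intro j h1 h2
    interval_cases j
    exacts [fun h0 => absurd rfl h0, fun _ => na₃.symm, fun _ => na₂.symm, fun _ => hab.symm,
      fun _ => nb₂, fun _ => nb₃, fun _ => hae.symm]
  · intro j h1
    interval_cases j
    exacts [⟨by decide, Q.weight_pos _⟩, ⟨by decide, ka₂⟩, ⟨by decide, ka₁⟩, ⟨by decide, hc⟩,
      ⟨by decide, kb₁⟩, ⟨by decide, kb₂⟩, ⟨by decide, Q.weight_pos _⟩, ⟨by decide, ke⟩]

lemma false_of_affE8 (h : Q.NoListed) {c a₁ a₂ a₃ a₄ a₅ b₁ b₂ e : V} (hc : 6 ≤ Q.K c)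
    (hab : a₁ ≠ b₁) (hae : a₁ ≠ e) (hbe : b₁ ≠ e)
    (ca : Q.A c a₁ = 1) (cb : Q.A c b₁ = 1) (ce : Q.A c e = 1)
    (ac : Q.A a₁ c = 1) (bc : Q.A b₁ c = 1) (ec : Q.A e c = 1)
    (ka₁ : 5 ≤ Q.K a₁) (ka₂ : 4 ≤ Q.K a₂) (ka₃ : 3 ≤ Q.K a₃) (ka₄ : 2 ≤ Q.K a₄)
    (kb₁ : 4 ≤ Q.K b₁) (kb₂ : 2 ≤ Q.K b₂) (ke : 3 ≤ Q.K e)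
    (a12 : Q.A a₁ a₂ = 1) (a21 : Q.A a₂ a₁ = 1) (a23 : Q.A a₂ a₃ = 1) (a32 : Q.A a₃ a₂ = 1)
    (a34 : Q.A a₃ a₄ = 1) (a43 : Q.A a₄ a₃ = 1) (a45 : Q.A a₄ a₅ = 1) (ha : Q.graph.Adj a₄ a₅)
    (b12 : Q.A b₁ b₂ = 1) (b21 : Q.A b₂ b₁ = 1)
    (na₂ : a₂ ≠ c) (na₃ : a₃ ≠ a₁) (na₄ : a₄ ≠ a₂) (na₅ : a₅ ≠ a₃) (nb₂ : b₂ ≠ c) : False := by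
  refine h _ (.affE8 (Q.A a₅ a₄).toNat (one_le_toNat_A ha.symm))
    (embeds_tree h.isAcyclic h.loopless (fun i => [a₅, a₄, a₃, a₂, a₁, c, b₁, b₂, e].getD i c)
      ?_ ?_ ?_ ?_ ?_ ?_ ?_)
  · intro j _ _
    split_ifs <;> omega
  · intro j _ _
    have := one_le_toNat_A ha.symm
    split_ifs <;> omega
  · intro j h1 h2
    interval_cases j
    exacts [(toNat_A ha.symm).symm, a43, a32, a21, ac, cb, b12, ce]
  · intro j h1 h2
    interval_cases j
    exacts [a45, a34, a23, a12, ca, bc, b21, ec]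
  · intro i j h1 h2 h3 h4
    obtain ⟨rfl, rfl⟩ : i = 6 ∧ j = 8 := by split_ifs at h4 <;> omega
    exact hbe
  · intro j h1 h2
    interval_cases j
    exacts [fun h0 => absurd rfl h0, fun _ => na₅.symm, fun _ => na₄.symm, fun _ => na₃.symm,
      fun _ => na₂.symm, fun _ => hab.symm, fun _ => nb₂, fun _ => hae.symm]
  · intro j h1
    interval_cases j
    exacts [⟨by decide, Q.weight_pos _⟩, ⟨by decide, ka₄⟩, ⟨by decide, ka₃⟩, ⟨by decide, ka₂⟩,
      ⟨by decide, ka₁⟩, ⟨by decide, hc⟩, ⟨by decide, kb₁⟩, ⟨by decide, kb₂⟩, ⟨by decide, ke⟩]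

/-- Three legs at a vertex which satisfies the balance condition. -/
lemma false_of_legs (h : Q.NoListed) {c y₁ y₂ y₃ : V} {p₁ p₂ p₃ : ℕ} (l₁ : Q.Leg p₁ c y₁)
    (l₂ : Q.Leg p₂ c y₂) (l₃ : Q.Leg p₃ c y₃) (h12 : y₁ ≠ y₂) (h13 : y₁ ≠ y₃) (h23 : y₂ ≠ y₃)
    (hb : 2 * Q.K c ≤ Q.K y₁ + Q.K y₂ + Q.K y₃) (hp : p₂ ≤ p₁) (hp' : p₃ ≤ p₂) : False := by
  obtain ⟨w₁, s₁, m₁⟩ := l₁.le_weight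
  obtain ⟨w₂, s₂, m₂⟩ := l₂.le_weight
  obtain ⟨w₃, s₃, m₃⟩ := l₃.le_weight
  -- Since K yᵢ / K c ≤ pᵢ / (pᵢ + 1), the balance requires ∑ 1/(pᵢ + 1) ≤ 1. With p₁ ≥ p₂ ≥ p₃ this
  -- leaves p₃ ≥ 2, containing E₆⁽¹⁾; p₃ = 1 and p₂ ≥ 3, containing E₇⁽¹⁾; or p₃ = 1, p₂ = 2 and p₁
  -- ≥ 5, containing E₈⁽¹⁾.
  by_cases h3 : 2 ≤ p₃
  · obtain ⟨z₁, n₁, o₁, u₁, -⟩ := l₁.exists_next (by omega)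
    obtain ⟨z₂, n₂, o₂, u₂, -⟩ := l₂.exists_next (by omega)
    obtain ⟨z₃, n₃, o₃, u₃, -⟩ := l₃.exists_next (by omega)
    exact h.false_of_affE6 (by omega) h12 h13 h23 l₁.adj l₂.adj l₃.adj l₁.A_eq l₂.A_eq l₃.A_eq
      u₁ u₂ u₃ (by omega) (by omega) (by omega) n₁.adj n₂.adj n₃.adj n₁.A_eq n₂.A_eq n₃.A_eq
      o₁ o₂ o₃
  obtain rfl : p₃ = 1 := by have := l₃.pos; omega
  by_cases h2 : 3 ≤ p₂
  · obtain ⟨z₁, n₁, o₁, u₁, -⟩ := l₁.exists_next (by omega)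
    obtain ⟨z₂, n₂, o₂, u₂, -⟩ := l₂.exists_next (by omega)
    obtain ⟨t₁, q₁, r₁, v₁, -⟩ := n₁.exists_next (by omega)
    obtain ⟨t₂, q₂, r₂, v₂, -⟩ := n₂.exists_next (by omega)
    have := n₁.le_weight
    have := n₂.le_weight
    exact h.false_of_affE7 (by omega) h12 h13 h23 l₁.A_eq l₂.A_eq l₃.A_eq u₁ u₂
      (l₃.A_symm_eq (by omega)) (by omega) (by omega) (by omega) (by omega) (by omega)
      n₁.A_eq v₁ q₁.A_eq q₁.adj n₂.A_eq v₂ q₂.A_eq q₂.adj o₁ r₁ o₂ r₂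
  rcases (show p₂ = 1 ∨ p₂ = 2 by have := l₂.pos; omega) with rfl | rfl
  · omega
  -- The other two legs contribute at most (2/3 + 1/2) K c, so the first one must supply at least
  -- (5/6) K c.
  have h5 : 5 ≤ p₁ := by
    by_contra! h5
    interval_cases p₁ <;> omega
  obtain ⟨z₁, n₁, o₁, u₁, -⟩ := l₁.exists_next (by omega)
  obtain ⟨z₂, n₂, o₂, u₂, f₂⟩ := l₂.exists_next (by omega)
  obtain ⟨t₁, q₁, r₁, v₁, -⟩ := n₁.exists_next (by omega)
  obtain ⟨x₁, i₁, j₁, k₁, -⟩ := q₁.exists_next (by omega)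
  obtain ⟨g₁, e₁, a₁, b₁, -⟩ := i₁.exists_next (by omega)
  have := n₁.le_weight
  have := q₁.le_weight
  have := i₁.le_weight
  exact h.false_of_affE8 (by omega) h12 h13 h23 l₁.A_eq l₂.A_eq l₃.A_eq u₁ u₂
    (l₃.A_symm_eq (by omega)) (by omega) (by omega) (by omega) (by omega) (by omega) (by omega)
    (by omega) n₁.A_eq v₁ q₁.A_eq k₁ i₁.A_eq b₁ e₁.A_eq e₁.adj n₂.A_eq
    (n₂.A_symm_eq (by omega)) o₁ r₁ j₁ a₁ o₂

/-- Seen along any one branch, another branch and the third form a branching cap, so all three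
branches are legs. A fourth neighbour is excluded, so the balance at c involves these legs only, and
it remains to sort them by length. -/
theorem false_of_three [Fintype V] (h : Q.NoListed) (hD : Q.DimBound) {c y₁ y₂ y₃ : V}
    (hc : 2 ≤ Q.K c) (a₁ : Q.graph.Adj c y₁) (a₂ : Q.graph.Adj c y₂) (a₃ : Q.graph.Adj c y₃)
    (h12 : y₁ ≠ y₂) (h13 : y₁ ≠ y₃) (h23 : y₂ ≠ y₃) : False := by
  classical
  obtain ⟨p₁, l₁⟩ := h.exists_leg hD hc a₂ a₁ h12 (.branch y₃ a₃ h23.symm h13.symm)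
  obtain ⟨p₂, l₂⟩ := h.exists_leg hD hc a₁ a₂ h12.symm (.branch y₃ a₃ h13.symm h23.symm)
  obtain ⟨p₃, l₃⟩ := h.exists_leg hD hc a₁ a₃ h13.symm (.branch y₂ a₂ h12.symm h23)
  have hb := hD.two_mul_weight_le h.loopless hc (S := {y₁, y₂, y₃}) (fun z hz => by
    simp only [Finset.mem_insert, Finset.mem_singleton]
    by_contra! hne
    exact h.false_of_four hc hz a₁ a₂ a₃ hne.1 hne.2.1 hne.2.2 h12 h13 h23) (by
    simp only [Finset.mem_insert, Finset.mem_singleton, not_or]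
    exact ⟨a₁.1, a₂.1, a₃.1⟩)
  rw [Finset.sum_insert (by simp [h12, h13]), Finset.sum_pair h23, l₁.A_eq, l₂.A_eq,
    l₃.A_eq] at hb
  rcases le_total p₁ p₂ with h1 | h1 <;> rcases le_total p₁ p₃ with h2 | h2 <;>
    rcases le_total p₂ p₃ with h3 | h3
  · exact h.false_of_legs l₃ l₂ l₁ h23.symm h13.symm h12.symm (by omega) h3 h1
  · exact h.false_of_legs l₂ l₃ l₁ h23 h12.symm h13.symm (by omega) h3 h2
  · exact h.false_of_legs l₃ l₂ l₁ h23.symm h13.symm h12.symm (by omega) h3 h1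
  · exact h.false_of_legs l₂ l₁ l₃ h12.symm h23 h13 (by omega) h1 h2
  · exact h.false_of_legs l₃ l₁ l₂ h13.symm h23.symm h12 (by omega) h2 h1
  · exact h.false_of_legs l₃ l₁ l₂ h13.symm h23.symm h12 (by omega) h2 h1
  · exact h.false_of_legs l₁ l₃ l₂ h13 h12 h23.symm (by omega) h2 h3
  · exact h.false_of_legs l₁ l₂ l₃ h12 h13 h23 (by omega) h1 h3

/-- The branch at the target of a multiple edge. -/
lemma exists_leg_of_source [Fintype V] (h : Q.NoListed) (hD : Q.DimBound) {x y : V}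
    (hx : 2 ≤ Q.K x) (hy : 2 ≤ Q.K y) (hxy : Q.graph.Adj x y) (h2 : 2 ≤ Q.A x y) :
    2 * Q.K y ≤ Q.K x ∨ ∃ p z, Q.Leg p y z ∧ z ≠ x ∧ 2 * Q.K y ≤ Q.K x + Q.K z := by
  classical
  have hyx := h.eq_one_of_two_le hxy h2
  by_cases hex : ∃ z, Q.graph.Adj y z ∧ z ≠ x
  · obtain ⟨z, hz, hzx⟩ := hex
    obtain ⟨p, hp⟩ := h.exists_leg hD hy hxy.symm hz hzx (.source hx h2)
    refine Or.inr ⟨p, z, hp, hzx, ?_⟩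
    have := hD.two_mul_weight_le h.loopless hy (S := {x, z}) (fun w hw => by
      rw [Finset.mem_insert, Finset.mem_singleton]
      by_contra! hne
      exact h.false_of_three hD hy hxy.symm hz hw hzx.symm hne.1.symm hne.2.symm) (by
      rw [Finset.mem_insert, Finset.mem_singleton, not_or]
      exact ⟨hxy.1.symm, hz.1⟩)
    rw [Finset.sum_pair hzx.symm, hyx, hp.A_eq] at this
    omega
  · push Not at hex
    have := hD.two_mul_weight_le h.loopless hy (S := {x})
      (fun z hz => Finset.mem_singleton.2 (hex z hz)) (by
        rw [Finset.mem_singleton]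
        exact hxy.1.symm)
    rw [Finset.sum_singleton, hyx] at this
    omega

/-- By `A_add_A_le` such an edge is the only one at x, so 2 K x ≤ 3 K y. The balance at y then
requires a leg beyond y, and the weights reach 1, 2, 3 along it towards x: this is D₄⁽³⁾. -/
theorem A_ne_three [Fintype V] (h : Q.NoListed) (hD : Q.DimBound) {x y : V} (hx : 2 ≤ Q.K x)
    (hxy : Q.graph.Adj x y) : Q.A x y ≠ 3 := by
  intro h3
  have hyx := h.eq_one_of_two_le hxy (by omega)
  have hb := hD.two_mul_weight_le h.loopless hx (S := {y}) (fun z hz => by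
    rw [Finset.mem_singleton]
    by_contra hne
    have := h.A_add_A_le hx hxy hz (Ne.symm hne)
    have := A_pos_of_adj hz
    omega) (by rw [Finset.mem_singleton]; exact hxy.1)
  rw [Finset.sum_singleton, h3] at hb
  rcases h.exists_leg_of_source hD hx (by omega) hxy (by omega) with hy | ⟨p, z, hl, hzx, hy⟩
  · omega
  obtain ⟨w, s, -⟩ := hl.le_weight
  have := Q.weight_pos z
  refine h _ (.affD43 (Q.A z y).toNat (one_le_toNat_A hl.adj.symm) ?_)
    (h.embeds_linear (fun i => [z, y, x].getD i x) ?_ ?_ ?_ ?_ ?_)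
  · have := coprime_toNat hl.adj.symm hxy (h.coprime_of_two hl.adj hxy.symm hzx)
    rwa [h3] at this
  · intro j _ _
    have := one_le_toNat_A hl.adj.symm
    split_ifs <;> omega
  · intro j h1 h2
    interval_cases j
    exacts [(toNat_A hl.adj.symm).symm, hyx]
  · intro j h1 h2
    interval_cases j
    exacts [hl.A_eq, h3]
  · intro i hi
    obtain rfl : i = 0 := by omega
    exact hzx.symm
  · intro j hj
    interval_cases j
    exacts [⟨by decide, Q.weight_pos _⟩, ⟨by decide, show 2 ≤ Q.K y by omega⟩,
      ⟨by decide, show 3 ≤ Q.K x by omega⟩]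

/-- The balances read 2 K x ≤ 2 K y + K z and 2 K y ≤ K x + K z', with z and z' the first vertices
of the legs at x and y, absent terms counting as zero. They force both legs to exist and one of them
to have at least two vertices: a long leg at x gives F₄⁽¹⁾, otherwise the leg at y is long and gives
E₆⁽²⁾. -/
theorem A_ne_two [Fintype V] (h : Q.NoListed) (hD : Q.DimBound) {x y : V} (hx : 2 ≤ Q.K x)
    (hxy : Q.graph.Adj x y) : Q.A x y ≠ 2 := by
  classical
  intro h2
  have hyx := h.eq_one_of_two_le hxy h2.ge
  have hb : Q.K x ≤ Q.K y ∨
      ∃ p z, Q.Leg p x z ∧ z ≠ y ∧ 2 * Q.K x ≤ 2 * Q.K y + Q.K z := by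
    by_cases hex : ∃ z, Q.graph.Adj x z ∧ z ≠ y
    · obtain ⟨z, hz, hzy⟩ := hex
      obtain ⟨p, hp⟩ := h.exists_leg hD hx hxy hz hzy (.target h2)
      refine Or.inr ⟨p, z, hp, hzy, ?_⟩
      have := hD.two_mul_weight_le h.loopless hx (S := {y, z}) (fun w hw => by
        rw [Finset.mem_insert, Finset.mem_singleton]
        by_contra! hne
        exact h.false_of_three hD hx hxy hz hw hzy.symm hne.1.symm hne.2.symm) (by
        rw [Finset.mem_insert, Finset.mem_singleton, not_or]
        exact ⟨hxy.1, hz.1⟩)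
      rw [Finset.sum_pair hzy.symm, h2, hp.A_eq] at this
      omega
    · push Not at hex
      have := hD.two_mul_weight_le h.loopless hx (S := {y})
        (fun z hz => Finset.mem_singleton.2 (hex z hz)) (by
          rw [Finset.mem_singleton]
          exact hxy.1)
      rw [Finset.sum_singleton, h2] at this
      omega
  have hKy : 2 ≤ Q.K y := by
    rcases hb with hb | ⟨p, z, hl, -, hb⟩
    · omega
    · have := hl.le_weight
      omega
  have hy := h.exists_leg_of_source hD hx hKy hxy h2.ge
  -- Without a leg at x one has K x ≤ K y, while the balance at y yields K y < K x in either case,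
  -- weights decreasing strictly along a leg.
  obtain ⟨p, z, hl, hzy, hb⟩ : ∃ p z, Q.Leg p x z ∧ z ≠ y ∧ 2 * Q.K x ≤ 2 * Q.K y + Q.K z := by
    refine hb.resolve_left fun hb => ?_
    rcases hy with hy | ⟨q, z', hl', -, hy⟩
    · omega
    · have := hl'.le_weight
      omega
  obtain ⟨wz, sz, -⟩ := hl.le_weight
  obtain ⟨q, z', hl', hz'x, hy⟩ := hy.resolve_left (by omega)
  obtain ⟨wz', sz', mz'⟩ := hl'.le_weight
  by_cases hp : 2 ≤ p
  · obtain ⟨t, ht, htx, hzx, -⟩ := hl.exists_next hp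
    have hq := hl'.pos
    have hcop1 : IsCoprime (Q.A t z) (Q.A z' y) := by
      refine h.coprime_of_path (n := 4) (by omega) (fun i => [t, z, x, y, z'].getD i x)
        (fun i hi => ?_) fun i hi => ?_
      · interval_cases i
        exacts [ht.adj.symm, hl.adj.symm, hxy, hl'.adj]
      · have hi' : i ≤ 2 := by omega
        interval_cases i
        exacts [htx.symm, hzy.symm, hz'x]
    have hcop2 := coprime_toNat hxy hl'.adj.symm (h.coprime_of_two hxy.symm hl'.adj hz'x.symm)
    rw [h2] at hcop2
    refine h _ (.affF4 _ _ (one_le_toNat_A ht.adj.symm) (Nat.coprime_two_left.1 hcop2)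
      (coprime_toNat ht.adj.symm hl'.adj.symm hcop1))
      (h.embeds_linear (fun i => [t, z, x, y, z'].getD i x) ?_ ?_ ?_ ?_ ?_)
    · intro j _ _
      have := one_le_toNat_A ht.adj.symm
      split_ifs <;> omega
    · intro j h1 h3
      interval_cases j
      exacts [(toNat_A ht.adj.symm).symm, hzx, h2, hl'.A_eq]
    · intro j h1 h3
      interval_cases j
      exacts [ht.A_eq, hl.A_eq, hyx, (toNat_A hl'.adj.symm).symm]
    · intro i hi
      have hi' : i ≤ 2 := by omega
      interval_cases i
      exacts [htx.symm, hzy.symm, hz'x]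
    · intro j hj
      interval_cases j
      exacts [⟨by decide, Q.weight_pos _⟩, ⟨by decide, show 2 ≤ Q.K z by omega⟩,
        ⟨by decide, show 3 ≤ Q.K x by omega⟩, ⟨by decide, hKy⟩, ⟨by decide, Q.weight_pos _⟩]
  · obtain rfl : p = 1 := by have := hl.pos; omega
    have hz2 := hl.two_mul_le
    -- If both legs had one vertex, then 2 K z ≤ K x and 2 K z' ≤ K y would turn the balances into 3
    -- K x ≤ 4 K y and 3 K y ≤ 2 K x, which are incompatible.
    have hq : 2 ≤ q := by
      by_contra hq
      obtain rfl : q = 1 := by have := hl'.pos; omega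
      omega
    obtain ⟨t, ht, hty, hz'y, -⟩ := hl'.exists_next hq
    have hcop : IsCoprime (Q.A x y) (Q.A t z') := by
      refine h.coprime_of_path (n := 3) (by omega) (fun i => [x, y, z', t].getD i x)
        (fun i hi => ?_) fun i hi => ?_
      · interval_cases i
        exacts [hxy, hl'.adj, ht.adj]
      · have hi' : i ≤ 1 := by omega
        interval_cases i
        exacts [hz'x, hty]
    have hcop2 := coprime_toNat hxy ht.adj.symm hcop
    rw [h2] at hcop2
    refine h _ (.affE62 _ (Nat.coprime_two_left.1 hcop2))
      (h.embeds_linear (fun i => [z, x, y, z', t].getD i x) ?_ ?_ ?_ ?_ ?_)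
    · intro j _ _
      split_ifs <;> omega
    · intro j h1 h3
      interval_cases j
      exacts [hl.A_symm_eq (by omega), h2, hl'.A_eq, ht.A_eq]
    · intro j h1 h3
      interval_cases j
      exacts [hl.A_eq, hyx, hz'y, (toNat_A ht.adj.symm).symm]
    · intro i hi
      have hi' : i ≤ 2 := by omega
      interval_cases i
      exacts [hzy.symm, hz'x, hty]
    · intro j hj
      interval_cases j
      exacts [⟨by decide, show 2 ≤ Q.K z by omega⟩, ⟨by decide, show 4 ≤ Q.K x by omega⟩,
        ⟨by decide, show 3 ≤ Q.K y by omega⟩, ⟨by decide, show 2 ≤ Q.K z' by omega⟩,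
        ⟨by decide, Q.weight_pos _⟩]

end NoListed

end UnitaryQuiver


/-! ### Maximal weights and the conclusion -/

namespace UnitaryQuiver

open QuiverShape

variable {V : Type*} {Q : UnitaryQuiver V}

lemma exists_adj_of_connected {G : SimpleGraph V} (hc : G.Connected) {x y : V} (h : x ≠ y) :
    ∃ z, G.Adj x z := by
  obtain ⟨p⟩ := hc.preconnected x y
  cases p with
  | nil => exact absurd rfl h
  | cons hadj _ => exact ⟨_, hadj⟩

namespace NoListed

lemma exists_two_le_weight [Fintype V] (h : Q.NoListed) (hD : Q.DimBound)
    (hc : Q.graph.Connected) (h2 : 2 ≤ Fintype.card Q.Coord) : ∃ x, 2 ≤ Q.K x := by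
  by_contra! hK
  have hK1 : ∀ x, Q.K x = 1 := fun x => by
    have := hK x
    have := Q.weight_pos x
    omega
  obtain ⟨p, q, hpq⟩ := Fintype.one_lt_card_iff.1 h2
  obtain ⟨z, hz⟩ := exists_adj_of_connected hc (x := p.1) (y := q.1) fun he => hpq (by
    rw [eq_coord0 (hK1 p.1), eq_coord0 (hK1 q.1), he])
  exact h.not_adj_of_weight_one hD (hK1 _) (hK1 _) hz

/-- A vertex of maximal weight has two neighbours of maximal weight, and no other one. -/
lemma exists_two_neighbours [Fintype V] (h : Q.NoListed) (hD : Q.DimBound) {x : V}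
    (hx : 2 ≤ Q.K x) (hmax : ∀ y, Q.K y ≤ Q.K x) : ∃ y z, y ≠ z ∧ Q.graph.Adj x y ∧
      Q.graph.Adj x z ∧ ∀ w, Q.graph.Adj x w → Q.K w = Q.K x := by
  classical
  have hA : ∀ y, Q.graph.Adj x y → Q.A x y = 1 := fun y hy => by
    have h1 := A_pos_of_adj hy
    have h2 := h.A_le_three hx hy
    have h3 := h.A_ne_two hD hx hy
    have h4 := h.A_ne_three hD hx hy
    omega
  obtain ⟨y, hy⟩ : ∃ y, Q.graph.Adj x y := by
    by_contra! hno
    have := hD.two_mul_weight_le h.loopless hx (S := ∅) (fun y hy => absurd hy (hno y)) (by simp)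
    rw [Finset.sum_empty] at this
    omega
  obtain ⟨z, hz, hzy⟩ : ∃ z, Q.graph.Adj x z ∧ z ≠ y := by
    by_contra! hno
    have := hD.two_mul_weight_le h.loopless hx (S := {y})
      (fun z hz => Finset.mem_singleton.2 (hno z hz)) (by rw [Finset.mem_singleton]; exact hy.1)
    rw [Finset.sum_singleton, hA y hy] at this
    have := hmax y
    omega
  have hS : ∀ w, Q.graph.Adj x w → w = y ∨ w = z := fun w hw => by
    by_contra! hne
    exact h.false_of_three hD hx hy hz hw hzy.symm hne.1.symm hne.2.symm
  have hb := hD.two_mul_weight_le h.loopless hx (S := {y, z})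
    (fun w hw => by rw [Finset.mem_insert, Finset.mem_singleton]; exact hS w hw) (by
      rw [Finset.mem_insert, Finset.mem_singleton, not_or]
      exact ⟨hy.1, hz.1⟩)
  rw [Finset.sum_pair hzy.symm, hA y hy, hA z hz] at hb
  have h1 := hmax y
  have h2 := hmax z
  refine ⟨y, z, hzy.symm, hy, hz, fun w hw => ?_⟩
  rcases hS w hw with rfl | rfl <;> omega

/-- Maximality of the weight passes from a vertex to its neighbours, hence to every vertex by
connectedness. Then every vertex has two distinct neighbours, whereas a finite non-trivial tree has
a leaf. -/
theorem false_of_dimBound [Fintype V] (h : Q.NoListed) (hD : Q.DimBound)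
    (hc : Q.graph.Connected) (h2 : 2 ≤ Fintype.card Q.Coord) : False := by
  classical
  obtain ⟨x₀, hx₀⟩ := h.exists_two_le_weight hD hc h2
  obtain ⟨x, -, hx⟩ := Finset.exists_max_image Finset.univ Q.K ⟨x₀, Finset.mem_univ _⟩
  have hmax : ∀ y, Q.K y ≤ Q.K x := fun y => hx y (Finset.mem_univ _)
  have hx2 : 2 ≤ Q.K x := hx₀.trans (hmax x₀)
  have hall : ∀ y, Q.K y = Q.K x := by
    intro y
    obtain ⟨p⟩ := hc.preconnected y x
    induction p with
    | nil => rfl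
    | @cons a b c hab p ih =>
      have hb := ih hx hmax hx2
      obtain ⟨-, -, -, -, -, hw⟩ := h.exists_two_neighbours hD (x := b) (by omega)
        (fun y => by rw [hb]; exact hmax y)
      rw [hw a hab.symm, hb]
  have hnb : ∀ w, ∃ y z, y ≠ z ∧ Q.graph.Adj w y ∧ Q.graph.Adj w z := fun w => by
    obtain ⟨y, z, hyz, hy, hz, -⟩ := h.exists_two_neighbours hD (x := w)
      (by rw [hall]; exact hx2) (fun y => by rw [hall w]; exact hmax y)
    exact ⟨y, z, hyz, hy, hz⟩
  obtain ⟨y, -, -, hy, -⟩ := hnb x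
  have : Nontrivial V := ⟨x, y, hy.1⟩
  have htree : Q.graph.IsTree := ⟨hc, h.isAcyclic⟩
  obtain ⟨v, hv⟩ := htree.exists_vert_degree_one_of_nontrivial
  obtain ⟨w, -, hw⟩ := SimpleGraph.degree_eq_one_iff_existsUnique_adj.1 hv
  obtain ⟨y, z, hyz, hy, hz⟩ := hnb v
  exact hyz ((hw y hy).trans (hw z hz).symm)

end NoListed

theorem IsGoodConnected.exists_embeds [Fintype V] (h : Q.IsGoodConnected) :
    ∃ s : QuiverShape, s.IsListed ∧ s.Embeds Q := by
  obtain ⟨hc, ⟨H, hH, hne, h1⟩ | ⟨N, hN, e, hA, hK⟩ | ⟨N, s, hN, hs, hiso⟩⟩ := h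
  · by_contra! hno
    exact NoListed.false_of_dimBound hno (dimBound_of_hasHilbertSeries hc hH h1) hc
      (two_le_card_coord_of_hasHilbertSeries hc hH hne)
  · have := hc.nonempty
    let x : V := Classical.arbitrary V
    exact exists_listed_of_oneVertex (x := x) le_rfl hN (hK x).ge (hA x x)
  · exact exists_listed_of_isSimplyLacedAffine hN hs hiso

theorem IsGood.exists_embeds [Fintype V] (h : Q.IsGood) :
    ∃ s : QuiverShape, s.IsListed ∧ s.Embeds Q := by
  rcases h with h | ⟨⟨x⟩, h⟩
  · exact h.exists_embeds
  · obtain ⟨s, hs, he⟩ := (h (Q.graph.connectedComponentMk x)).exists_embeds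
    exact ⟨s, hs, embeds_of_subquiver he⟩

end UnitaryQuiver

theorem mainTheorem2 {V : Type*} [Fintype V] (Q : UnitaryQuiver V) (hQ : Q.IsGood) :
    ∃ S : Q.Subquiver, Q.IsDecayProduct S ∧
      ∃ s : QuiverShape, s.IsListed ∧ S.toQuiver.IsoShape s := by
  obtain ⟨s, hs, he⟩ := hQ.exists_embeds
  exact UnitaryQuiver.exists_isDecayProduct_of_embeds hs he
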